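/- Let $\mathbb B_n\subset\mathbb C^n$ be the open unit ball with normalized Lebesgue measure $v$ (so $v(\mathbb B_n)=1$), let $\langle z,w\rangle=\sum_k z_k\overline{w_k}$, and let $L^2_a(\mathbb B_n)$ be the Bergman space of holomorphic functions in $L^2(\mathbb B_n,v)$. A submodule is a closed subspace $\mathcal P\subset L^2_a(\mathbb B_n)$ invariant under multiplication by $z_1,\dots,z_n$; put $R_k f=z_kf$ for $f\in\mathcal P$. It is called $p$-essentially normal if all commutators $[R_j,R_k^*]=R_jR_k^*-R_k^*R_j$ on $\mathcal P$ ($1\le j,k\le n$) belong to the Schatten class $\mathcal C_p$. The submodule $\mathcal P$ has the asymptotic stable division property with generating functions $\{h_i\}_{i\in\Lambda}\subset\mathcal P$, where $\Lambda$ is finite or countably infinite, if there are a bounded invertible operator $T$ on $\mathcal P$ and finite constants $A_1,A_2$ such that for every $f\in\mathcal P$ there are functions $g_i$ ($i\in\Lambda$) holomorphic on $\mathbb B_n$ with 1. $Tf=\sum_{i\in\Lambda}h_ig_i$ pointwise on $\mathbb B_n$; 2. $\displaystyle\int_{\mathbb B_n}\Big(\sum_{i\in\Lambda}|h_ig_i|\Big)^2dv\le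 A_1\int_{\mathbb B_n}|f|^2dv$; 3. $\displaystyle\int_{\mathbb B_n}\Big(\sum_{i\in\Lambda}|h_i(z)g_i(z)|\Big)^2(1-|z|^2)\,dv(z)\le A_2\int_{\mathbb B_n}|f(z)|^2(1-|z|^2)\,dv(z)$. For $w\in\mathbb B_n$ let $D(w,1)=\{\lambda\in\mathbb B_n:\beta(w,\lambda)<1\}$, where $\beta(w,\lambda)=\frac12\log\frac{1+|\varphi_w(\lambda)|}{1-|\varphi_w(\lambda)|}$ is the Bergman metric and $\varphi_w$ is the Möbius transform $$\varphi_w(\lambda)=\frac{w-P_w\lambda-(1-|w|^2)^{1/2}Q_w\lambda}{1-\langle\lambda,w\rangle},$$ with $P_w,Q_w$ the orthogonal projections of $\mathbb C^n$ onto $\mathbb Cw$ and $w^\perp$. A function $h$ satisfies the key inequality with constants $C>0$ and $N\in\{1,2,\dots\}$ if for all $z,w\in\mathbb B_n$ and all $f$ holomorphic on $\mathbb B_n$ $$|h(z)f(w)|\le C\,\frac{|1-\langle z,w\rangle|^N}{(1-|w|^2)^{n+1+N}}\int_{D(w,1)}|h(\lambda)f(\lambda)|\,dv(\lambda).$$ **Theorem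 3.2.** Let $\mathcal P$ be a submodule of $L^2_a(\mathbb B_n)$ with the asymptotic stable division property with generating functions $\{h_i\}_{i\in\Lambda}$. (a) Suppose that each $h_i$ is holomorphic in a neighborhood of $\overline{\mathbb B_n}$, and that each $h_i$ satisfies the key inequality with some constants $C_i,N_i$ such that $\{C_i\}_{i\in\Lambda}$ and $\{N_i\}_{i\in\Lambda}$ are bounded. Then $\mathcal P$ is $p$-essentially normal for all $p>n$. (b) In particular, if the $h_i$ are polynomials whose degrees are bounded by a constant independent of $i$, then $\mathcal P$ is $p$-essentially normal for all $p>n$. -/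

import Mathlib

open MeasureTheory
open scoped ENNReal NNReal ComplexConjugate

noncomputable section

namespace BergmanBall

/-! ### The unit ball, its normalized volume, and the Bergman space -/

/-- `ℂⁿ` with its Euclidean norm.  Note that `inner ℂ w z = ∑ i, z i * conj (w i)`, which is
`⟨z, w⟩` in the convention of being linear in the first variable. -/
abbrev Cn (n : ℕ) : Type := EuclideanSpace ℂ (Fin n)

/-- The open unit ball of `ℂⁿ`. -/
def unitBall (n : ℕ) : Set (Cn n) := Metric.ball 0 1

/-- Lebesgue measure on the unit ball, normalized to have total mass one
(`ℂⁿ` carries the Lebesgue measure of the underlying real Euclidean space). -/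
def ballVol (n : ℕ) : Measure (Cn n) :=
  (volume (unitBall n))⁻¹ • (volume : Measure (Cn n)).restrict (unitBall n)

/-- The Hilbert space `L²` of the unit ball with normalized volume. -/
abbrev L2 (n : ℕ) : Type := Lp ℂ 2 (ballVol n)

/-- `F` is holomorphic on the unit ball. -/
def IsHolo {n : ℕ} (F : Cn n → ℂ) : Prop := DifferentiableOn ℂ F (unitBall n)

/-- The function `F` is holomorphic on the ball and represents the class `f` in `L²`.
The values of `F` on the ball are then determined by `f`. -/
def Represents {n : ℕ} (F : Cn n → ℂ) (f : L2 n) : Prop :=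
  IsHolo F ∧ (f : Cn n → ℂ) =ᵐ[ballVol n] F

/-- The Bergman space of the ball: the square-integrable holomorphic functions, as a subspace
of `L²`. -/
def bergman (n : ℕ) : Submodule ℂ (L2 n) where
  carrier := {f | ∃ F, Represents F f}
  zero_mem' := ⟨0, differentiableOn_const (c := (0 : ℂ)), Lp.coeFn_zero _ _ _⟩
  add_mem' := by
    rintro f g ⟨F, hF, hfF⟩ ⟨G, hG, hgG⟩
    exact ⟨F + G, DifferentiableOn.add hF hG, (Lp.coeFn_add f g).trans (hfF.add hgG)⟩
  smul_mem' := by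
    rintro c f ⟨F, hF, hfF⟩
    exact ⟨c • F, DifferentiableOn.const_smul hF c,
      (Lp.coeFn_smul c f).trans (hfF.const_smul c)⟩

lemma ae_mem_unitBall (n : ℕ) : ∀ᵐ z ∂(ballVol n), z ∈ unitBall n :=
  Measure.ae_smul_measure (ae_restrict_mem Metric.isOpen_ball.measurableSet) _

lemma memLp_coord {n : ℕ} (i : Fin n) : MemLp (fun z : Cn n => z i) ∞ (ballVol n) := by
  refine memLp_top_of_bound (Continuous.aestronglyMeasurable (by fun_prop)) 1 ?_
  filter_upwards [ae_mem_unitBall n] with z hz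
  have h : ‖z‖ < 1 := by simpa [unitBall] using hz
  exact (PiLp.norm_apply_le z i).trans h.le

/-- Multiplication by the coordinate function `z_i`, as a bounded operator on `L²` of the ball. -/
def mulCoord {n : ℕ} (i : Fin n) : L2 n →L[ℂ] L2 n :=
  (ContinuousLinearMap.mul ℂ ℂ).holderL (ballVol n) ∞ 2 2 ((memLp_coord i).toLp _)

lemma coeFn_mulCoord {n : ℕ} (i : Fin n) (f : L2 n) :
    (mulCoord i f : Cn n → ℂ) =ᵐ[ballVol n] fun z => z i * f z := by
  have h1 := (ContinuousLinearMap.mul ℂ ℂ).coeFn_holder (r := 2)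
    ((memLp_coord i).toLp (fun z : Cn n => z i)) f
  filter_upwards [h1, (memLp_coord i).coeFn_toLp] with z hz hi
  rw [hi] at hz
  exact hz

/-! ### Submodules of the Bergman space and essential normality -/

/-- A (Hilbert) submodule of the Bergman space: a closed subspace of it that is invariant under
multiplication by the coordinate functions.  (The Bergman space is closed in `L²`, so that being
closed in it and being closed in `L²` are the same.) -/
structure BergmanSubmodule (n : ℕ) extends Submodule ℂ (L2 n) where
  le_bergman : toSubmodule ≤ bergman n
  isClosed : IsClosed (toSubmodule : Set (L2 n))
  mulCoord_mem : ∀ (i : Fin n), ∀ f ∈ toSubmodule, mulCoord i f ∈ toSubmodule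

instance {n : ℕ} (P : BergmanSubmodule n) : CompleteSpace P.toSubmodule :=
  P.isClosed.completeSpace_coe

/-- The operator `R_i` of multiplication by `z_i` on the submodule. -/
def BergmanSubmodule.R {n : ℕ} (P : BergmanSubmodule n) (i : Fin n) :
    P.toSubmodule →L[ℂ] P.toSubmodule :=
  ((mulCoord i).comp P.toSubmodule.subtypeL).codRestrict P.toSubmodule
    fun f => P.mulCoord_mem i f f.2

section Schatten

variable {H : Type*} [NormedAddCommGroup H] [InnerProductSpace ℂ H]

/-- The singular numbers `s_0(A) ≥ s_1(A) ≥ ⋯` of a bounded operator on a Hilbert space: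
`s_k(A)` is the distance in operator norm from `A` to the operators of rank at most `k`. -/
def singularNumber (A : H →L[ℂ] H) (k : ℕ) : ℝ :=
  ⨅ F : {F : H →L[ℂ] H // LinearMap.rank (F : H →ₗ[ℂ] H) ≤ k}, ‖A - F‖

/-- Membership in the Schatten class `𝒞_p`, `0 < p < ∞`: the singular numbers are `p`-summable. -/
def InSchatten (p : ℝ) (A : H →L[ℂ] H) : Prop :=
  Summable fun k : ℕ => singularNumber A k ^ p

end Schatten

/-- The submodule is `p`-essentially normal: every cross commutator `[R_i, R_j^*]` is in `𝒞_p`. -/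
def BergmanSubmodule.EssentiallyNormal {n : ℕ} (P : BergmanSubmodule n) (p : ℝ) : Prop :=
  ∀ i j : Fin n, InSchatten p
    ((P.R i).comp (ContinuousLinearMap.adjoint (P.R j)) -
      (ContinuousLinearMap.adjoint (P.R j)).comp (P.R i))

/-! ### The Bergman metric and the key inequality -/

/-- The Möbius transform `φ_z` of the ball.  For `z = 0` it is `w ↦ -w`. -/
def mobius {n : ℕ} (z w : Cn n) : Cn n :=
  (1 - inner ℂ z w)⁻¹ •
    (z - (ℂ ∙ z).starProjection w
      - ((Real.sqrt (1 - ‖z‖ ^ 2) : ℝ) : ℂ) • (ℂ ∙ z)ᗮ.starProjection w)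

/-- The pseudo-hyperbolic metric. -/
def pseudoHyperbolic {n : ℕ} (z w : Cn n) : ℝ := ‖mobius z w‖

/-- The hyperbolic (Bergman) metric of the ball. -/
def bergmanDist {n : ℕ} (z w : Cn n) : ℝ :=
  1 / 2 * Real.log ((1 + pseudoHyperbolic z w) / (1 - pseudoHyperbolic z w))

/-- The Bergman ball `D(z, r)`. -/
def bergmanDisc {n : ℕ} (z : Cn n) (r : ℝ) : Set (Cn n) :=
  {w | w ∈ unitBall n ∧ bergmanDist z w < r}

/-- The key inequality for `h` with constants `C` and `N`:
`|h(z) f(w)| ≤ C |1 - ⟨z, w⟩|^N / (1 - |w|²)^(n+1+N) * ∫_{D(w,1)} |h f| dv`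
for all `z, w` in the ball and all `f` holomorphic on the ball. -/
def KeyInequality {n : ℕ} (h : Cn n → ℂ) (C : ℝ) (N : ℕ) : Prop :=
  ∀ z ∈ unitBall n, ∀ w ∈ unitBall n, ∀ f : Cn n → ℂ, IsHolo f →
    ‖h z * f w‖ ≤ C * (‖1 - inner ℂ w z‖ ^ N / (1 - ‖w‖ ^ 2) ^ (n + 1 + N)) *
      ∫ x in bergmanDisc w 1, ‖h x * f x‖ ∂(ballVol n)

/-! ### Asymptotic stable division -/

/-- The submodule `P` has the asymptotic stable division property with generating functions
`h i`, `i : Λ`.  The squared norms are written as lower Lebesgue integrals, so that the bounds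
include the finiteness of the left-hand sides. -/
def BergmanSubmodule.AsympStableDivision {n : ℕ} (P : BergmanSubmodule n)
    {Λ : Type*} (h : Λ → Cn n → ℂ) : Prop :=
  (∀ i, ∃ u ∈ P.toSubmodule, Represents (h i) u) ∧
  ∃ (T : P.toSubmodule ≃L[ℂ] P.toSubmodule) (C₁ C₂ : ℝ≥0), ∀ f : P.toSubmodule,
    ∃ g : Λ → Cn n → ℂ, (∀ i, IsHolo (g i)) ∧
      (∃ F : Cn n → ℂ, Represents F (T f : L2 n) ∧
        ∀ z ∈ unitBall n, HasSum (fun i => h i z * g i z) (F z)) ∧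
      (∫⁻ z, (∑' i, ‖h i z * g i z‖ₑ) ^ 2 ∂(ballVol n)
        ≤ C₁ * ∫⁻ z, ‖(f : L2 n) z‖ₑ ^ 2 ∂(ballVol n)) ∧
      (∫⁻ z, (∑' i, ‖h i z * g i z‖ₑ) ^ 2 * ENNReal.ofReal (1 - ‖z‖ ^ 2) ∂(ballVol n)
        ≤ C₂ * ∫⁻ z, ‖(f : L2 n) z‖ₑ ^ 2 * ENNReal.ofReal (1 - ‖z‖ ^ 2) ∂(ballVol n))

/-- `h` is holomorphic in a neighbourhood of the closed unit ball. -/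
def HoloNearClosedBall {n : ℕ} (h : Cn n → ℂ) : Prop :=
  ∃ U : Set (Cn n), IsOpen U ∧ Metric.closedBall 0 1 ⊆ U ∧ DifferentiableOn ℂ h U

end BergmanBall

end

open MeasureTheory
open scoped ENNReal NNReal ComplexConjugate

noncomputable section

namespace BergmanBall

variable {n : ℕ}

/-! On all of `L²` the multiplications by `z_1, …, z_n` are commuting normal operators, so a
commutator on the submodule only sees what leaks out of it: in the sense of forms, `[R_i, R_j^*] =
-H_i^* H_j` with the Hankel type operators `H_k f = (1 - P)(conj z_k · f)`, where `P` denotes the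
projection onto the submodule (`inner_commutator`). The heart of the proof is the estimate `‖H_k T
f‖² ≤ A ∫ |f|² (1 - |z|²) dv` (`exists_norm_hankel_le`), where `T` is the operator of the division
property.

To obtain it, pair `conj z_k · T f = Σ conj z_k h_i g_i` with some `φ` orthogonal to the submodule.
For large `l` the function `g_i` is reproduced by the weighted kernel `(1 - |w|²)^l / (1 - ⟨z,
w⟩)^(n+l+1)`. For fixed `w`, the function `h_i(z) / (1 - ⟨z, w⟩)^(n+l+1)` lies in the submodule, so
`φ` annihilates the same expression with `conj w_k` in place of `conj z_k`. Only the factor `conj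
z_k - conj w_k = O(|1 - ⟨z, w⟩|^(1/2))` remains. The key inequality bounds the off-diagonal product
`h_i(z) g_i(w)` by the mass of `|h_i g_i|` on `D(w, 1)`. Integrating out `w` leaves the positive
kernel `(1 - |λ|²) / |1 - ⟨z, λ⟩|^(n+3/2)` acting on `Σ |h_i g_i|`. A Schur test
(`exists_schur_bound`) maps `L²` with weight `1 - |λ|²` into `L²`, and the third division condition
concludes.

If `f` is orthogonal to the `M^n` monomials with all exponents below `M`, then its Taylor expansion
starts in degree at least `M`, and the weight `1 - |z|²` gains a factor `1 / (M + 1)`. Hence a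
commutator is within `B / (M + 1)` of an operator of rank at most `2 M^n`. Its singular numbers are
`O(k^(-1/n))`, which is `p`-summable for `p > n`.

For polynomials of degree at most `d` the key inequality comes from one complex line through `w` and
`z`. A Bernstein–Walsh estimate (`norm_eval_mul_le`) passes from a small disc about `w` to `z` at
the cost of `(|1 - ⟨z, w⟩| / (1 - |w|²))^d`, and a sub-mean value property on an ellipsoid inside
`D(w, 1)` controls the product on that disc. -/

/-! ### The quantity `|1 - ⟨z, w⟩|` on the ball -/

lemma mem_unitBall {z : Cn n} : z ∈ unitBall n ↔ ‖z‖ < 1 := by simp [unitBall]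

lemma one_sub_norm_sq_pos {z : Cn n} (hz : ‖z‖ < 1) : 0 < 1 - ‖z‖ ^ 2 := by
  nlinarith [norm_nonneg z]

lemma norm_inner_lt_one {z w : Cn n} (hz : ‖z‖ < 1) (hw : ‖w‖ < 1) : ‖inner ℂ w z‖ < 1 :=
  (norm_inner_le_norm w z).trans_lt (by nlinarith [norm_nonneg z, norm_nonneg w])

lemma norm_one_sub_inner_comm (z w : Cn n) : ‖1 - inner ℂ w z‖ = ‖1 - inner ℂ z w‖ := by
  rw [← inner_conj_symm, ← RCLike.norm_conj]; simp

lemma one_sub_norm_le_norm_one_sub_inner {z w : Cn n} (hz : ‖z‖ ≤ 1) :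
    1 - ‖w‖ ≤ ‖1 - inner ℂ w z‖ := by
  have h1 : ‖(1 : ℂ)‖ - ‖inner ℂ w z‖ ≤ ‖1 - inner ℂ w z‖ := norm_sub_norm_le _ _
  have h2 := norm_inner_le_norm (𝕜 := ℂ) w z
  have h3 : ‖w‖ * ‖z‖ ≤ ‖w‖ := mul_le_of_le_one_right (norm_nonneg w) hz
  simp only [norm_one] at h1
  linarith

lemma one_sub_norm_sq_le {z w : Cn n} (hz : ‖z‖ ≤ 1) (hw : ‖w‖ ≤ 1) :
    1 - ‖w‖ ^ 2 ≤ 2 * ‖1 - inner ℂ w z‖ := by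
  have := one_sub_norm_le_norm_one_sub_inner (w := w) hz
  nlinarith [norm_nonneg w]

lemma one_sub_norm_sq_le' {z w : Cn n} (hz : ‖z‖ ≤ 1) (hw : ‖w‖ ≤ 1) :
    1 - ‖z‖ ^ 2 ≤ 2 * ‖1 - inner ℂ w z‖ := by
  rw [norm_one_sub_inner_comm]; exact one_sub_norm_sq_le hw hz

lemma norm_one_sub_inner_pos {z w : Cn n} (hz : ‖z‖ < 1) (hw : ‖w‖ < 1) :
    0 < ‖1 - inner ℂ w z‖ := by
  have := one_sub_norm_le_norm_one_sub_inner (w := w) hz.le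
  linarith

/-- Expanding the square leaves at most `2 (1 - Re ⟨z, w⟩)`. This is the source of the half power of
the kernel gained from `conj z_k - conj w_k`. -/
lemma norm_sub_sq_le {z w : Cn n} (hz : ‖z‖ ≤ 1) (hw : ‖w‖ ≤ 1) :
    ‖z - w‖ ^ 2 ≤ 2 * ‖1 - inner ℂ w z‖ := by
  have h1 := norm_sub_sq (𝕜 := ℂ) w z
  have h2 : 1 - (inner ℂ w z).re ≤ ‖1 - inner ℂ w z‖ := by
    have := Complex.re_le_norm (1 - inner ℂ w z)
    simpa using this
  rw [norm_sub_rev] 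
  simp only [RCLike.re_to_complex] at h1
  nlinarith [norm_nonneg z, norm_nonneg w]

/-- Quasi-triangle inequality for `|1 - ⟨z, w⟩|` on the ball. -/
lemma norm_one_sub_inner_quasi {z w l : Cn n} (hz : ‖z‖ ≤ 1) (hw : ‖w‖ ≤ 1) (hl : ‖l‖ ≤ 1) :
    ‖1 - inner ℂ l z‖ ≤ 2 * ‖1 - inner ℂ w z‖ + 4 * ‖1 - inner ℂ l w‖ := by
  set a := ‖1 - inner ℂ w z‖
  set b := ‖1 - inner ℂ l w‖
  -- Inserting `w` produces the cross term `⟨z - w, w - l⟩`, at most `a + b` by Cauchy–Schwarz and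
  -- `norm_sub_sq_le`, and the defect `(1 - ⟨w, l⟩) - (1 - |w|²)`, at most `b + 2b`.
  have e : (1 - inner ℂ l z : ℂ) = (1 - inner ℂ w z) + inner ℂ (w - l) (z - w) +
      ((1 - inner ℂ l w) - (1 - inner ℂ w w)) := by
    simp only [inner_sub_left, inner_sub_right]; ring
  have h1 : ‖inner ℂ (w - l) (z - w)‖ ≤ a + b := by
    refine (norm_inner_le_norm _ _).trans ?_
    have := norm_sub_sq_le hz hw
    have := norm_sub_sq_le hw hl
    nlinarith [sq_nonneg (‖w - l‖ - ‖z - w‖)]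
  have h2 : ‖(1 - inner ℂ w w : ℂ)‖ ≤ 2 * b := by
    rw [inner_self_eq_norm_sq_to_K]
    have h3 : ‖(1 - (((‖w‖ : ℝ) : ℂ)) ^ 2 : ℂ)‖ = 1 - ‖w‖ ^ 2 := by
      rw [← Complex.ofReal_pow, ← Complex.ofReal_one, ← Complex.ofReal_sub, Complex.norm_real,
        Real.norm_of_nonneg (by nlinarith [norm_nonneg w])]
    exact h3.le.trans (one_sub_norm_sq_le' hw hl)
  rw [e]
  have h4 := norm_add_le ((1 - inner ℂ w z) + inner ℂ (w - l) (z - w) : ℂ)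
    ((1 - inner ℂ l w) - (1 - inner ℂ w w))
  have h5 := norm_add_le ((1 - inner ℂ w z)  : ℂ) (inner ℂ (w - l) (z - w))
  have h6 := norm_sub_le (1 - inner ℂ l w : ℂ) (1 - inner ℂ w w)
  change _ ≤ 2 * a + 4 * b
  linarith

/-! ### The Möbius transform and Bergman balls of radius one -/

lemma norm_starProjection_sq_add (z w : Cn n) :
    ‖w‖ ^ 2 = ‖(ℂ ∙ z).starProjection w‖ ^ 2 + ‖(ℂ ∙ z)ᗮ.starProjection w‖ ^ 2 := by
  have h := Submodule.norm_sq_eq_add_norm_sq_projection w (ℂ ∙ z)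
  simpa using h

/-- This is the classical identity `1 - |φ_z(w)|² = (1 - |z|²)(1 - |w|²) / |1 - ⟨w, z⟩|²` with the
denominator cleared. With `P_z w = c z`, both sides become expressions in `c`, `|z|` and `|Q_z w|`,
by Pythagoras. -/
lemma norm_mobius_num_sq {z w : Cn n} (hz : ‖z‖ < 1) :
    ‖z - (ℂ ∙ z).starProjection w
      - ((Real.sqrt (1 - ‖z‖ ^ 2) : ℝ) : ℂ) • (ℂ ∙ z)ᗮ.starProjection w‖ ^ 2 =
    ‖1 - inner ℂ z w‖ ^ 2 - (1 - ‖z‖ ^ 2) * (1 - ‖w‖ ^ 2) := by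
  set p := (ℂ ∙ z).starProjection w with hp
  set q := (ℂ ∙ z)ᗮ.starProjection w with hq
  have hpm : p ∈ (ℂ ∙ z) := by
    rw [hp]; exact Submodule.starProjection_apply_mem _ _
  have hqm : q ∈ (ℂ ∙ z)ᗮ := by
    rw [hq]; exact Submodule.starProjection_apply_mem _ _
  obtain ⟨c, hc⟩ := Submodule.mem_span_singleton.1 hpm
  have hzq : inner ℂ z q = 0 := hqm z (Submodule.mem_span_singleton_self z)
  have hsum : w = p + q := by
    have := Submodule.starProjection_add_starProjection_orthogonal (K := (ℂ ∙ z)) w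
    exact this.symm
  have hin : inner ℂ z w = c * (‖z‖ : ℂ) ^ 2 := by
    rw [hsum, inner_add_right, hzq, ← hc, inner_smul_right, inner_self_eq_norm_sq_to_K]; simp
  have hw := norm_starProjection_sq_add z w
  rw [← hp, ← hq] at hw
  have hpn : ‖p‖ ^ 2 = ‖c‖ ^ 2 * ‖z‖ ^ 2 := by rw [← hc, norm_smul]; ring
  have horth : inner ℂ (z - p) (((Real.sqrt (1 - ‖z‖ ^ 2) : ℝ) : ℂ) • q) = 0 := by
    rw [← hc, inner_smul_right, inner_sub_left, inner_smul_left, hzq]; simp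
  have h1 := norm_sub_sq (𝕜 := ℂ) (z - p) (((Real.sqrt (1 - ‖z‖ ^ 2) : ℝ) : ℂ) • q)
  rw [horth] at h1
  rw [h1]
  have hs : Real.sqrt (1 - ‖z‖ ^ 2) ^ 2 = 1 - ‖z‖ ^ 2 :=
    Real.sq_sqrt (one_sub_norm_sq_pos hz).le
  have h2 : ‖z - p‖ ^ 2 = ‖1 - c‖ ^ 2 * ‖z‖ ^ 2 := by
    have : z - p = (1 - c) • z := by rw [← hc, sub_smul, one_smul]
    rw [this, norm_smul]; ring
  have h3 : ∀ t : ℝ, ‖1 - c * (t : ℂ)‖ ^ 2 = 1 - 2 * c.re * t + ‖c‖ ^ 2 * t ^ 2 := by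
    intro t
    rw [← Complex.normSq_eq_norm_sq, ← Complex.normSq_eq_norm_sq, Complex.normSq_apply,
      Complex.normSq_apply]
    simp
    ring
  have h4 := h3 (‖z‖ ^ 2)
  have h5 := h3 1
  push_cast at h4
  simp only [Complex.ofReal_one, mul_one] at h5
  rw [hin, h4, h2, h5, norm_smul, mul_pow, Complex.norm_real, Real.norm_eq_abs, sq_abs, hs, hw, hpn]
  simp
  ring

/-- `1 - tanh(1)^2`. -/
def kap : ℝ := 1 - Real.tanh 1 ^ 2

lemma tanh_one_bounds : 0 < Real.tanh 1 ∧ Real.tanh 1 < 1 := by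
  rw [Real.tanh_eq_sinh_div_cosh]
  have := Real.cosh_pos 1
  exact ⟨div_pos (Real.sinh_pos_iff.2 one_pos) this, (div_lt_one this).2 (Real.sinh_lt_cosh 1)⟩

lemma kap_pos : 0 < kap := by
  have := tanh_one_bounds
  unfold kap; nlinarith

lemma kap_lt_one : kap < 1 := by
  have := tanh_one_bounds
  unfold kap; nlinarith

/-- The left side is `artanh x < 1`; the Bergman ball of radius one is the pseudo-hyperbolic ball of
radius `tanh 1`. -/
lemma half_log_lt_one_iff {x : ℝ} (h0 : 0 ≤ x) (h1 : x < 1) :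
    1 / 2 * Real.log ((1 + x) / (1 - x)) < 1 ↔ x < Real.tanh 1 := by
  have hp : 0 < (1 + x) / (1 - x) := div_pos (by linarith) (by linarith)
  have : 1 / 2 * Real.log ((1 + x) / (1 - x)) < 1 ↔ Real.log ((1 + x) / (1 - x)) < 2 := by
    constructor <;> intro h <;> linarith
  rw [this, Real.log_lt_iff_lt_exp hp, div_lt_iff₀ (by linarith), Real.tanh_eq_sinh_div_cosh,
    lt_div_iff₀ (Real.cosh_pos 1), Real.sinh_eq, Real.cosh_eq]
  have e2 : Real.exp 2 = Real.exp 1 * Real.exp 1 := by rw [← Real.exp_add]; norm_num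
  have e1 : Real.exp 1 * Real.exp (-1) = 1 := by rw [← Real.exp_add]; norm_num
  have := Real.exp_pos 1
  rw [e2]
  constructor
  · intro h
    have h' := mul_lt_mul_of_pos_right h (Real.exp_pos (-1))
    nlinarith
  · intro h
    have h' := mul_lt_mul_of_pos_right h (Real.exp_pos 1)
    nlinarith

/-- The Bergman ball of radius one, described through `|1 - ⟨w, z⟩|`. -/
lemma mem_bergmanDisc_iff {z w : Cn n} (hz : ‖z‖ < 1) :
    w ∈ bergmanDisc z 1 ↔
      ‖w‖ < 1 ∧ kap * ‖1 - inner ℂ z w‖ ^ 2 < (1 - ‖z‖ ^ 2) * (1 - ‖w‖ ^ 2) := by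
  simp only [bergmanDisc, Set.mem_ofPred_eq, mem_unitBall]
  refine and_congr_right fun hw => ?_
  have hpos := norm_one_sub_inner_pos hw hz
  have hn := norm_mobius_num_sq (w := w) hz
  have hA := one_sub_norm_sq_pos hz
  have hB := one_sub_norm_sq_pos hw
  have hsq : pseudoHyperbolic z w ^ 2 * ‖1 - inner ℂ z w‖ ^ 2 =
      ‖1 - inner ℂ z w‖ ^ 2 - (1 - ‖z‖ ^ 2) * (1 - ‖w‖ ^ 2) := by
    rw [← hn, pseudoHyperbolic, mobius, norm_smul, norm_inv]
    field_simp
  have h0 : 0 ≤ pseudoHyperbolic z w := norm_nonneg _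
  have h1 : pseudoHyperbolic z w < 1 := by
    by_contra! h
    have : 1 ≤ pseudoHyperbolic z w ^ 2 := by nlinarith
    nlinarith [mul_pos hA hB, pow_pos hpos 2]
  rw [bergmanDist, half_log_lt_one_iff h0 h1, ← sq_lt_sq₀ h0 tanh_one_bounds.1.le,
    ← mul_lt_mul_iff_left₀ (pow_pos hpos 2), hsq, kap]
  constructor <;> intro h <;> nlinarith

lemma mem_bergmanDisc_comm {z w : Cn n} (hz : ‖z‖ < 1) (hw : ‖w‖ < 1) :
    w ∈ bergmanDisc z 1 ↔ z ∈ bergmanDisc w 1 := by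
  rw [mem_bergmanDisc_iff hz, mem_bergmanDisc_iff hw, norm_one_sub_inner_comm z w, mul_comm (1 - ‖z‖ ^ 2)]
  tauto

/-- Since `1 - |w|² ≤ 2 |1 - ⟨w, z⟩|`, one factor `|1 - ⟨w, z⟩|` cancels from the inequality that
defines the Bergman ball. -/
lemma bergmanDisc_norm_le {z w : Cn n} (hz : ‖z‖ < 1) (h : w ∈ bergmanDisc z 1) :
    kap * ‖1 - inner ℂ z w‖ ≤ 2 * (1 - ‖z‖ ^ 2) := by
  rw [mem_bergmanDisc_iff hz] at h
  have h2 := one_sub_norm_sq_le' h.1.le hz.le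
  have := norm_one_sub_inner_pos h.1 hz
  have := one_sub_norm_sq_pos hz
  have h3 : kap * ‖1 - inner ℂ z w‖ * ‖1 - inner ℂ z w‖ <
      2 * (1 - ‖z‖ ^ 2) * ‖1 - inner ℂ z w‖ := by nlinarith
  exact (lt_of_mul_lt_mul_right h3 (norm_nonneg _)).le

lemma bergmanDisc_one_sub_le {z w : Cn n} (hz : ‖z‖ < 1) (h : w ∈ bergmanDisc z 1) :
    kap * (1 - ‖w‖ ^ 2) ≤ 4 * (1 - ‖z‖ ^ 2) := by
  have h1 := bergmanDisc_norm_le hz h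
  rw [mem_bergmanDisc_iff hz] at h
  have h2 := one_sub_norm_sq_le' h.1.le hz.le
  nlinarith [kap_pos]

/-- For `w` in the Bergman ball at `u`, the quantities `|1 - ⟨z, w⟩|` and `|1 - ⟨z, u⟩|` are
comparable. -/
lemma bergmanDisc_kernel_le {z u w : Cn n} (hz : ‖z‖ < 1) (hu : ‖u‖ < 1)
    (h : w ∈ bergmanDisc u 1) :
    kap * ‖1 - inner ℂ w z‖ ≤ 18 * ‖1 - inner ℂ u z‖ := by
  have h1 := bergmanDisc_norm_le hu h
  have hw : ‖w‖ < 1 := ((mem_bergmanDisc_iff hu).1 h).1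
  have h2 := norm_one_sub_inner_quasi hz.le hu.le hw.le
  have h3 := one_sub_norm_sq_le hz.le hu.le
  rw [norm_one_sub_inner_comm u w] at h2
  have := kap_pos
  have := kap_lt_one
  have := norm_one_sub_inner_pos hz hu
  -- The constant is `18 = 2 + 4 · 4`: the quasi-triangle inequality contributes `2` directly, and
  -- its second term is bounded through `kap |1 - ⟨w, u⟩| ≤ 2 (1 - |u|²) ≤ 4 |1 - ⟨z, u⟩|`.
  nlinarith

/-! ### Measurability, anisotropic dilations and volumes of nonisotropic balls -/

lemma isOpen_unitBall : IsOpen (unitBall n) := Metric.isOpen_ball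

lemma measurableSet_unitBall : MeasurableSet (unitBall n) := isOpen_unitBall.measurableSet

lemma measurableSet_bergmanDisc_prod :
    MeasurableSet {p : Cn n × Cn n | ‖p.1‖ < 1 ∧ ‖p.2‖ < 1 ∧
      kap * ‖1 - inner ℂ p.1 p.2‖ ^ 2 < (1 - ‖p.1‖ ^ 2) * (1 - ‖p.2‖ ^ 2)} := by
  have h1 : Continuous fun p : Cn n × Cn n => ‖p.1‖ := by fun_prop
  have h2 : Continuous fun p : Cn n × Cn n => ‖p.2‖ := by fun_prop
  have h3 : Continuous fun p : Cn n × Cn n => kap * ‖1 - inner ℂ p.1 p.2‖ ^ 2 := by fun_prop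
  have h4 : Continuous fun p : Cn n × Cn n => (1 - ‖p.1‖ ^ 2) * (1 - ‖p.2‖ ^ 2) := by fun_prop
  exact ((isOpen_lt h1 continuous_const).inter
    ((isOpen_lt h2 continuous_const).inter (isOpen_lt h3 h4))).measurableSet

lemma volume_unitBall_pos : 0 < (volume : Measure (Cn n)) (unitBall n) :=
  Metric.measure_ball_pos _ _ one_pos

lemma volume_unitBall_lt_top : (volume : Measure (Cn n)) (unitBall n) < ∞ :=
  measure_ball_lt_top

instance : IsProbabilityMeasure (ballVol n) := by
  constructor
  simp only [ballVol, Measure.smul_apply, Measure.restrict_apply MeasurableSet.univ, Set.univ_inter,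
    smul_eq_mul]
  exact ENNReal.inv_mul_cancel volume_unitBall_pos.ne' volume_unitBall_lt_top.ne

/-- The linear map acting as `a` on the line through the unit vector `e` and as `b` on its
orthogonal complement. -/
def aniso (e : Cn n) (a b : ℂ) : Cn n →ₗ[ℂ] Cn n :=
  b • LinearMap.id + (a - b) • ((innerSL ℂ e).smulRight e : Cn n →L[ℂ] Cn n).toLinearMap

lemma aniso_apply (e : Cn n) (a b : ℂ) (w : Cn n) :
    aniso e a b w = b • w + ((a - b) * inner ℂ e w) • e := by
  simp [aniso, mul_smul]

lemma exists_orthonormalBasis_apply_zero [NeZero n] {e : Cn n} (he : ‖e‖ = 1) :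
    ∃ b : OrthonormalBasis (Fin n) ℂ (Cn n), b 0 = e := by
  have ho : Orthonormal ℂ (({0} : Set (Fin n)).domRestrict fun _ => e) := by
    constructor
    · intro i; exact he
    · intro i j hij
      exact absurd (Subsingleton.elim i j) hij
  obtain ⟨b, hb⟩ := ho.exists_orthonormalBasis_extension_of_card_eq (by simp)
  exact ⟨b, hb 0 rfl⟩

lemma det_aniso [NeZero n] {e : Cn n} (he : ‖e‖ = 1) (a b : ℂ) :
    LinearMap.det (aniso e a b) = a * b ^ (n - 1) := by
  obtain ⟨B, hB⟩ := exists_orthonormalBasis_apply_zero he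
  have hL : ∀ j, aniso e a b (B j) = (if j = 0 then a else b) • B j := by
    intro j
    rw [aniso_apply, ← hB, orthonormal_iff_ite.1 B.orthonormal]
    by_cases hj : j = 0
    · subst hj; simp [← add_smul]
    · simp [hj, Ne.symm hj]
  have hM : LinearMap.toMatrix B.toBasis B.toBasis (aniso e a b) =
      Matrix.diagonal fun j => if j = 0 then a else b := by
    ext i j
    rw [LinearMap.toMatrix_apply, OrthonormalBasis.coe_toBasis, hL, map_smul]
    have : B.toBasis.repr (B j) = Finsupp.single j 1 := by
      rw [← OrthonormalBasis.coe_toBasis, Module.Basis.repr_self]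
    rw [this, Finsupp.smul_apply, Finsupp.single_apply]
    by_cases hij : i = j
    · subst hij; simp
    · simp [Matrix.diagonal_apply_ne _ hij, Ne.symm hij]
  rw [← LinearMap.det_toMatrix B.toBasis, hM, Matrix.det_diagonal]
  obtain ⟨m, rfl⟩ := Nat.exists_eq_succ_of_ne_zero (NeZero.ne n)
  rw [Fin.prod_univ_succ]
  simp

/-- The real determinant of a complex linear map is the squared modulus of its complex determinant,
and `aniso` is diagonal in an orthonormal basis that starts with `e`. -/
lemma volume_image_aniso [NeZero n] {e : Cn n} (he : ‖e‖ = 1) (a b : ℝ) (s : Set (Cn n)) :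
    volume (aniso e a b '' s) = ENNReal.ofReal ((a * b ^ (n - 1)) ^ 2) * volume s := by
  have h := Measure.addHaar_image_linearMap (volume : Measure (Cn n))
    ((aniso e (a : ℂ) b).restrictScalars ℝ) s
  rw [LinearMap.det_restrictScalars, det_aniso he, Algebra.norm_complex_apply] at h
  have e1 : |Complex.normSq ((a : ℂ) * (b : ℂ) ^ (n - 1))| = (a * b ^ (n - 1)) ^ 2 := by
    rw [← Complex.ofReal_pow, ← Complex.ofReal_mul, Complex.normSq_ofReal, ← sq, abs_sq]
  rw [e1] at h
  exact h

lemma ballVol_le (s : Set (Cn n)) :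
    ballVol n s ≤ (volume (unitBall n))⁻¹ * volume s := by
  simp only [ballVol, Measure.smul_apply, smul_eq_mul]
  gcongr
  exact Measure.restrict_le_self

lemma exists_unit_smul [NeZero n] (l : Cn n) : ∃ e : Cn n, ‖e‖ = 1 ∧ l = (‖l‖ : ℂ) • e := by
  by_cases hl : l = 0
  · refine ⟨EuclideanSpace.single 0 1, by simp, by simp [hl]⟩
  · have : (‖l‖ : ℂ) ≠ 0 := by simpa using hl
    refine ⟨(‖l‖ : ℂ)⁻¹ • l, ?_, ?_⟩
    · rw [norm_smul, norm_inv, Complex.norm_real, norm_norm, inv_mul_cancel₀ (by simpa using hl)]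
    · rw [smul_smul, mul_inv_cancel₀ this, one_smul]

lemma norm_sub_inner_smul_sq {e : Cn n} (he : ‖e‖ = 1) (w : Cn n) :
    ‖w - (inner ℂ e w : ℂ) • e‖ ^ 2 = ‖w‖ ^ 2 - ‖inner ℂ e w‖ ^ 2 := by
  have h := norm_sub_sq (𝕜 := ℂ) w ((inner ℂ e w : ℂ) • e)
  rw [h, inner_smul_right, norm_smul, he, mul_one, ← inner_conj_symm w e]
  rw [RCLike.mul_conj]
  have h2 : RCLike.re ((((‖inner ℂ e w‖ : ℝ) : ℂ)) ^ 2) = ‖inner ℂ e w‖ ^ 2 := by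
    rw [← Complex.ofReal_pow]; exact Complex.ofReal_re _
  erw [h2]
  ring

/-- The nonisotropic balls `{|1 - ⟨w, l⟩| < t}` have volume `O(t^(n+1))`. -/
lemma ballVol_nonisotropic_le [NeZero n] {l : Cn n} (hl : ‖l‖ < 1) {t : ℝ} (ht : 0 < t) :
    ballVol n {w | ‖w‖ < 1 ∧ ‖1 - inner ℂ l w‖ < t} ≤ ENNReal.ofReal (36 ^ (n + 1) * t ^ (n + 1)) := by
  obtain ⟨e, he, hle⟩ := exists_unit_smul l
  -- A point of the nonisotropic ball differs from `e` by at most `2t` along `e` and at most `2√t`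
  -- across. Dilating by `6t` and `6√t` makes each part at most `1/3`, so the preimage stays in the
  -- unit ball. The real Jacobian is then `36^n t^(n+1)`.
  have hsub : {w | ‖w‖ < 1 ∧ ‖1 - inner ℂ l w‖ < t} ⊆
      (fun x => e + x) '' (aniso e ((6 * t : ℝ) : ℂ) ((6 * Real.sqrt t : ℝ) : ℂ) '' unitBall n) := by
    rintro w ⟨hw, hwt⟩
    set x := inner ℂ e w with hx
    have hlx : inner ℂ l w = (‖l‖ : ℂ) * x := by
      conv_lhs => rw [hle]
      rw [inner_smul_left]; simp [hx]
    have hxn : ‖x‖ ≤ 1 := (norm_inner_le_norm e w).trans (by rw [he]; linarith)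
    have h1 : ‖1 - x‖ ≤ 2 * t := by
      have h2 : (1 - x) = (1 - inner ℂ l w) - ((1 - ‖l‖ : ℝ) : ℂ) * x := by
        rw [hlx]; push_cast; ring
      have h3 := one_sub_norm_le_norm_one_sub_inner (w := l) hw.le
      rw [h2]
      refine (norm_sub_le _ _).trans ?_
      rw [norm_mul, Complex.norm_real, Real.norm_of_nonneg (by linarith)]
      nlinarith [norm_nonneg x]
    have hst : 0 < Real.sqrt t := Real.sqrt_pos.2 ht
    have hst2 : Real.sqrt t ^ 2 = t := Real.sq_sqrt ht.le
    have h2 : ‖w - x • e‖ ^ 2 ≤ 4 * t := by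
      rw [norm_sub_inner_smul_sq he]
      have : 1 - ‖x‖ ≤ 2 * t := by
        have := norm_sub_norm_le (1 : ℂ) x
        simp at this; linarith
      nlinarith [norm_nonneg x, norm_nonneg w]
    have h2' : ‖w - x • e‖ ≤ 2 * Real.sqrt t := by
      refine abs_le_of_sq_le_sq' ?_ (by positivity) |>.2
      rw [mul_pow, hst2]; linarith
    refine ⟨w - e, ⟨((6 * t : ℝ) : ℂ)⁻¹ • (x - 1) • e + ((6 * Real.sqrt t : ℝ) : ℂ)⁻¹ • (w - x • e), ?_, ?_⟩, by simp⟩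
    · rw [mem_unitBall]
      refine (norm_add_le _ _).trans_lt ?_
      rw [norm_smul, norm_smul, norm_smul, he, norm_inv, norm_inv, Complex.norm_real, Complex.norm_real,
        Real.norm_of_nonneg (by positivity), Real.norm_of_nonneg (by positivity), norm_sub_rev, mul_one,
        inv_mul_eq_div, inv_mul_eq_div]
      have a1 : ‖1 - x‖ / (6 * t) ≤ 1 / 3 := by rw [div_le_iff₀ (by positivity)]; linarith
      have a2 : ‖w - x • e‖ / (6 * Real.sqrt t) ≤ 1 / 3 := by
        rw [div_le_iff₀ (by positivity)]; linarith
      linarith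
    · have c1 : ((6 * t : ℝ) : ℂ) ≠ 0 := by exact_mod_cast (by positivity : (6 * t) ≠ 0)
      have c2 : ((6 * Real.sqrt t : ℝ) : ℂ) ≠ 0 := by
        exact_mod_cast (by positivity : (6 * Real.sqrt t) ≠ 0)
      have hee : inner ℂ e e = (1 : ℂ) := by rw [inner_self_eq_norm_sq_to_K, he]; simp
      have hew : inner ℂ e (w - x • e) = 0 := by
        rw [inner_sub_right, inner_smul_right, hee, ← hx]; ring
      rw [aniso_apply, inner_add_right, inner_smul_right, inner_smul_right, inner_smul_right, hew, hee]
      generalize ((6 * t : ℝ) : ℂ) = A at c1 ⊢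
      generalize ((6 * Real.sqrt t : ℝ) : ℂ) = D at c2 ⊢
      simp only [smul_add, smul_smul, mul_one, mul_zero, add_zero]
      rw [mul_inv_cancel₀ c2, one_smul, add_right_comm, ← add_smul]
      have : D * (A⁻¹ * (x - 1)) + (A - D) * (A⁻¹ * (x - 1)) = x - 1 := by field_simp; ring
      rw [this, sub_smul, one_smul]; abel
  refine (ballVol_le _).trans ?_
  calc (volume (unitBall n))⁻¹ * volume {w | ‖w‖ < 1 ∧ ‖1 - inner ℂ l w‖ < t}
      ≤ (volume (unitBall n))⁻¹ * (ENNReal.ofReal ((6 * t * (6 * Real.sqrt t) ^ (n - 1)) ^ 2) * volume (unitBall n)) := by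
        gcongr
        refine (measure_mono hsub).trans ?_
        rw [Set.image_add_left, measure_preimage_add, volume_image_aniso he]
    _ = ENNReal.ofReal ((6 * t * (6 * Real.sqrt t) ^ (n - 1)) ^ 2) := by
        rw [mul_comm, mul_assoc, ENNReal.mul_inv_cancel volume_unitBall_pos.ne' volume_unitBall_lt_top.ne,
          mul_one]
    _ ≤ _ := by
        apply ENNReal.ofReal_le_ofReal
        obtain ⟨m, hm⟩ := Nat.exists_eq_succ_of_ne_zero (NeZero.ne n)
        have hst2 : Real.sqrt t ^ 2 = t := Real.sq_sqrt ht.le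
        have : (6 * t * (6 * Real.sqrt t) ^ (n - 1)) ^ 2 = 36 ^ n * t ^ (n + 1) := by
          rw [hm]
          simp only [Nat.succ_eq_add_one, Nat.add_sub_cancel]
          rw [mul_pow, ← pow_mul, mul_comm m 2, pow_mul, mul_pow 6 (Real.sqrt t), hst2, mul_pow, mul_pow]
          norm_num
          ring
        rw [this]
        gcongr
        · norm_num
        · omega

/-! ### Polar coordinates and Forelli–Rudin estimates -/

lemma lintegral_polar (f : Cn n → ℝ≥0∞) (hf : Measurable f) [NeZero n] :
    ∫⁻ x, f x = ∫⁻ w : Metric.sphere (0 : Cn n) 1, (∫⁻ r in Set.Ioi (0 : ℝ),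
      ENNReal.ofReal (r ^ (2 * n - 1)) * f ((r : ℂ) • (w : Cn n)))
        ∂(volume : Measure (Cn n)).toSphere := by
  have hd : Module.finrank ℝ (Cn n) = 2 * n := by
    rw [← Module.finrank_mul_finrank ℝ ℂ (Cn n)]; simp
  have : Nontrivial (Cn n) := by
    apply Module.nontrivial_of_finrank_pos (R := ℝ)
    rw [hd]; have := NeZero.pos n; omega
  have hmp := (volume : Measure (Cn n)).measurePreserving_homeomorphUnitSphereProd
  have h1 : ∫⁻ x, f x = ∫⁻ x : ({(0)}ᶜ : Set (Cn n)), f x ∂((volume : Measure (Cn n)).comap (↑)) := by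
    rw [lintegral_subtype_comap (measurableSet_singleton _).compl f, restrict_compl_singleton]
  have h2 : ∀ x : ({(0)}ᶜ : Set (Cn n)), f x = (fun p : Metric.sphere (0 : Cn n) 1 × Set.Ioi (0 : ℝ) =>
      f ((p.2.1 : ℂ) • (p.1 : Cn n))) (homeomorphUnitSphereProd (Cn n) x) := by
    intro x
    have hx : (‖(x : Cn n)‖ : ℂ) ≠ 0 := by
      have := x.2
      simp only [Set.mem_compl_iff, Set.mem_singleton_iff] at this
      simpa using this
    congr 1
    simp only [homeomorphUnitSphereProd_apply_snd_coe, homeomorphUnitSphereProd_apply_fst_coe]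
    have e : ‖(x : Cn n)‖⁻¹ • (x : Cn n) = ((‖(x : Cn n)‖ : ℂ)⁻¹) • (x : Cn n) := by
      rw [← Complex.ofReal_inv]; exact (Complex.coe_smul _ _).symm
    rw [e, smul_smul, mul_inv_cancel₀ hx, one_smul]
  have hm : Measurable fun p : Metric.sphere (0 : Cn n) 1 × Set.Ioi (0 : ℝ) =>
      f ((p.2.1 : ℂ) • (p.1 : Cn n)) := hf.comp (by fun_prop)
  rw [h1, lintegral_congr h2,
    hmp.lintegral_comp_emb (Homeomorph.measurableEmbedding _)
      (fun p : Metric.sphere (0 : Cn n) 1 × Set.Ioi (0 : ℝ) => f ((p.2.1 : ℂ) • (p.1 : Cn n))),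
    lintegral_prod _ hm.aemeasurable]
  refine lintegral_congr fun w => ?_
  have hm' : Measurable fun r : ℝ => f ((r : ℂ) • (w : Cn n)) := hf.comp (by fun_prop)
  have hmr : Measurable fun r : Set.Ioi (0 : ℝ) => f ((r.1 : ℂ) • (w : Cn n)) :=
    hm'.comp measurable_subtype_coe
  change ∫⁻ r : Set.Ioi (0 : ℝ), f ((r.1 : ℂ) • (w : Cn n)) ∂(Measure.volumeIoiPow _) = _
  rw [Measure.volumeIoiPow, lintegral_withDensity_eq_lintegral_mul _ (by fun_prop) hmr, hd]
  simp only [Pi.mul_apply]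
  rw [lintegral_subtype_comap measurableSet_Ioi
    (fun r : ℝ => ENNReal.ofReal (r ^ (2 * n - 1)) * f ((r : ℂ) • (w : Cn n)))]

/-- Polar coordinates in the unit ball. -/
lemma lintegral_ballVol_polar [NeZero n] (f : Cn n → ℝ≥0∞) (hf : Measurable f) :
    ∫⁻ x, f x ∂(ballVol n) = (volume (unitBall n))⁻¹ *
      ∫⁻ w : Metric.sphere (0 : Cn n) 1, (∫⁻ r in Set.Ioo (0 : ℝ) 1,
      ENNReal.ofReal (r ^ (2 * n - 1)) * f ((r : ℂ) • (w : Cn n)))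
        ∂(volume : Measure (Cn n)).toSphere := by
  rw [ballVol, lintegral_smul_measure, smul_eq_mul, ← lintegral_indicator measurableSet_unitBall,
    lintegral_polar _ (hf.indicator measurableSet_unitBall)]
  congr 1
  refine lintegral_congr fun w => ?_
  rw [← lintegral_indicator measurableSet_Ioi, ← lintegral_indicator measurableSet_Ioo]
  refine lintegral_congr fun r => ?_
  have hw : ‖(w : Cn n)‖ = 1 := by simp
  by_cases h0 : 0 < r
  · have hmem : (r : ℂ) • (w : Cn n) ∈ unitBall n ↔ r < 1 := by
      rw [mem_unitBall, norm_smul, hw, mul_one, Complex.norm_real, Real.norm_of_nonneg h0.le]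
    by_cases h1 : r < 1
    · rw [Set.indicator_of_mem (show r ∈ Set.Ioi 0 from h0), Set.indicator_of_mem (hmem.2 h1),
        Set.indicator_of_mem (show r ∈ Set.Ioo 0 1 from ⟨h0, h1⟩)]
    · rw [Set.indicator_of_mem (show r ∈ Set.Ioi 0 from h0),
        Set.indicator_of_notMem (fun h => h1 (hmem.1 h)),
        Set.indicator_of_notMem (fun h => h1 h.2), mul_zero]
  · rw [Set.indicator_of_notMem (show r ∉ Set.Ioi 0 from h0),
      Set.indicator_of_notMem (fun h => h0 h.1)]

lemma lintegral_rpow_neg_half_le {B : ℝ} (h0 : 0 ≤ B) :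
    ∫⁻ r in Set.Ioo (1 - B) 1, ENNReal.ofReal ((1 - r) ^ (-(1 / 2) : ℝ)) ≤
      ENNReal.ofReal (2 * B ^ (1 / 2 : ℝ)) := by
  have hint : IntervalIntegrable (fun r : ℝ => (1 - r) ^ (-(1 / 2) : ℝ)) volume (1 - B) 1 := by
    have h := (intervalIntegral.intervalIntegrable_rpow' (a := 0) (b := B)
      (r := (-(1 / 2) : ℝ)) (by norm_num)).comp_sub_left 1
    simpa using h.symm
  have hle : 1 - B ≤ 1 := by linarith
  rw [Measure.restrict_congr_set Ioo_ae_eq_Ioc]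
  rw [← ofReal_integral_eq_lintegral_ofReal]
  · apply ENNReal.ofReal_le_ofReal
    rw [← intervalIntegral.integral_of_le hle]
    have h := intervalIntegral.integral_comp_sub_left (a := 1 - B) (b := 1)
      (fun x : ℝ => x ^ (-(1 / 2) : ℝ)) 1
    simp only [sub_self, sub_sub_cancel] at h
    rw [h, integral_rpow (Or.inl (by norm_num))]
    have : (-(1 / 2) + 1 : ℝ) = 1 / 2 := by norm_num
    rw [this, Real.zero_rpow (by norm_num)]
    linarith
  · exact (intervalIntegrable_iff_integrableOn_Ioc_of_le hle).1 hint
  · filter_upwards [ae_restrict_mem measurableSet_Ioc] with r hr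
    exact Real.rpow_nonneg (by linarith [hr.2]) _

/-- Here `x` stands for `⟨ω, l⟩` with `ω` on the unit sphere. The two quantities `1 - r x` and `1 -
x` differ by `(1 - r) x`, while `1 - r ≤ |1 - r x|`. -/
lemma radial_kernel_bounds {x : ℂ} (hx : ‖x‖ ≤ 1) {r : ℝ} (h0 : 0 < r) (h1 : r < 1) :
    1 - r ≤ ‖1 - r * x‖ ∧ ‖1 - x‖ ≤ 2 * ‖1 - r * x‖ ∧ ‖1 - r * x‖ ≤ ‖1 - x‖ + (1 - r) := by
  have a1 : 1 - r ≤ ‖1 - r * x‖ := by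
    have := norm_sub_norm_le (1 : ℂ) (r * x)
    rw [norm_mul, Complex.norm_real, Real.norm_of_nonneg h0.le, norm_one] at this
    nlinarith [norm_nonneg x]
  have e : ((1 - r : ℝ) : ℂ) * x = (1 - r * x) - (1 - x) := by push_cast; ring
  have e2 : ‖((1 - r : ℝ) : ℂ) * x‖ ≤ 1 - r := by
    rw [norm_mul, Complex.norm_real, Real.norm_of_nonneg (by linarith)]
    nlinarith [norm_nonneg x]
  refine ⟨a1, ?_, ?_⟩
  · have : (1 - x) = (1 - r * x) - ((1 - r : ℝ) : ℂ) * x := by rw [e]; ring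
    rw [this]
    refine (norm_sub_le _ _).trans ?_
    linarith
  · have : (1 - r * x) = (1 - x) + ((1 - r : ℝ) : ℂ) * x := by rw [e]; ring
    rw [this]
    refine (norm_add_le _ _).trans ?_
    linarith

/-- The range splits at `1 - r = |1 - x|`. Farther from the sphere, `1 - r` is comparable to `|1 - r
x|` and the weight is traded pointwise. Closer to it, `|1 - r x|` is comparable to `A = |1 - x|`,
and the singular weight integrates to a multiple of `B^(1/2)`; this is dominated by what the right
side collects on an interval of length `B / 2` next to `1`. -/
lemma lintegral_radial_le (k : ℕ) {m : ℝ} (hm : 0 < m) {x : ℂ} (hx : ‖x‖ < 1) :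
    ∫⁻ r in Set.Ioo (0 : ℝ) 1, ENNReal.ofReal (r ^ k) *
        ENNReal.ofReal ((1 - r ^ 2) ^ (-(1 / 2) : ℝ) * ‖1 - r * x‖ ^ (-m)) ≤
      ENNReal.ofReal (2 + 2 ^ (2 * m + k + 4)) * ∫⁻ r in Set.Ioo (0 : ℝ) 1, ENNReal.ofReal (r ^ k) *
        ENNReal.ofReal (‖1 - r * x‖ ^ (-(m + 1 / 2))) := by
  set A := ‖1 - x‖ with hA
  have hA0 : 0 < A := by
    have := norm_sub_norm_le (1 : ℂ) x
    rw [norm_one] at this; linarith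
  have hA2 : A ≤ 2 := by
    have := norm_sub_le (1 : ℂ) x
    rw [norm_one] at this; linarith
  -- Truncating at `1` keeps `(1 - B, 1)` inside `(0, 1)`; because `A ≤ 2`, nothing is lost but a
  -- factor `2`.
  set B := min A 1 with hB
  have hB0 : 0 < B := lt_min hA0 one_pos
  have hB1 : B ≤ 1 := min_le_right _ _
  have hBA : B ≤ A := min_le_left _ _
  have hAB : A ≤ 2 * B := by
    rcases min_choice A 1 with h | h <;> rw [hB, h] <;> linarith
  have hpos : ∀ r ∈ Set.Ioo (0 : ℝ) 1, 0 < ‖1 - r * x‖ := fun r hr =>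
    lt_of_lt_of_le (by linarith [hr.2]) (radial_kernel_bounds hx.le hr.1 hr.2).1
  set J := ∫⁻ r in Set.Ioo (0 : ℝ) 1, ENNReal.ofReal (r ^ k) *
        ENNReal.ofReal (‖1 - r * x‖ ^ (-(m + 1 / 2))) with hJ
  -- pointwise bound
  have hpt : ∀ r ∈ Set.Ioo (0 : ℝ) 1, ENNReal.ofReal (r ^ k) *
        ENNReal.ofReal ((1 - r ^ 2) ^ (-(1 / 2) : ℝ) * ‖1 - r * x‖ ^ (-m)) ≤
      ENNReal.ofReal 2 * (ENNReal.ofReal (r ^ k) * ENNReal.ofReal (‖1 - r * x‖ ^ (-(m + 1 / 2)))) +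
      (Set.Ioo (1 - B) 1).indicator
        (fun r => ENNReal.ofReal ((A / 2) ^ (-m)) * ENNReal.ofReal ((1 - r) ^ (-(1 / 2) : ℝ))) r := by
    intro r hr
    obtain ⟨b1, b2, b3⟩ := radial_kernel_bounds hx.le hr.1 hr.2
    have hp := hpos r hr
    have hr1 : 0 < 1 - r := by linarith [hr.2]
    have hw : (1 - r ^ 2) ^ (-(1 / 2) : ℝ) ≤ (1 - r) ^ (-(1 / 2) : ℝ) :=
      Real.rpow_le_rpow_of_nonpos hr1 (by nlinarith [hr.1]) (by norm_num)
    by_cases hcase : A ≤ 1 - r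
    · refine le_add_right ?_
      rw [mul_left_comm, ← ENNReal.ofReal_mul (p := 2) (by norm_num)]
      refine mul_le_mul_right (ENNReal.ofReal_le_ofReal ?_) _
      have h2 : (1 - r) ^ (-(1 / 2) : ℝ) ≤ (‖1 - r * x‖ / 2) ^ (-(1 / 2) : ℝ) :=
        Real.rpow_le_rpow_of_nonpos (by positivity) (by linarith) (by norm_num)
      rw [Real.div_rpow hp.le (by norm_num)] at h2
      have h3 : (2 : ℝ) ^ (-(1 / 2) : ℝ) ≥ 1 / 2 := by
        have : (2 : ℝ) ^ (-1 : ℝ) ≤ (2 : ℝ) ^ (-(1 / 2) : ℝ) :=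
          Real.rpow_le_rpow_of_exponent_le (by norm_num) (by norm_num)
        rw [Real.rpow_neg_one] at this; linarith
      have h4 : ‖1 - r * x‖ ^ (-(1 / 2) : ℝ) / (2 : ℝ) ^ (-(1 / 2) : ℝ) ≤ 2 * ‖1 - r * x‖ ^ (-(1 / 2) : ℝ) := by
        rw [div_le_iff₀ (by positivity)]
        nlinarith [Real.rpow_pos_of_pos hp (-(1 / 2) : ℝ)]
      calc (1 - r ^ 2) ^ (-(1 / 2) : ℝ) * ‖1 - r * x‖ ^ (-m)
          ≤ (2 * ‖1 - r * x‖ ^ (-(1 / 2) : ℝ)) * ‖1 - r * x‖ ^ (-m) := by gcongr; linarith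
        _ = 2 * ‖1 - r * x‖ ^ (-(m + 1 / 2)) := by
            rw [mul_assoc, ← Real.rpow_add hp]; congr 2; ring
    · push Not at hcase
      refine le_add_left ?_
      have hrB : r ∈ Set.Ioo (1 - B) 1 := by
        refine ⟨?_, hr.2⟩
        rcases min_choice A 1 with h | h <;> rw [hB, h]
        · linarith
        · linarith [hr.1]
      rw [Set.indicator_of_mem hrB, ← ENNReal.ofReal_mul (p := (A / 2) ^ (-m)) (by positivity),
        ← ENNReal.ofReal_mul (pow_nonneg hr.1.le _)]
      apply ENNReal.ofReal_le_ofReal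
      have h5 : r ^ k ≤ 1 := pow_le_one₀ hr.1.le hr.2.le
      have h6 : ‖1 - r * x‖ ^ (-m) ≤ (A / 2) ^ (-m) :=
        Real.rpow_le_rpow_of_nonpos (by positivity) (by linarith) (by linarith)
      have h7 : 0 ≤ (1 - r ^ 2) ^ (-(1 / 2) : ℝ) := Real.rpow_nonneg (by nlinarith [hr.1]) _
      calc r ^ k * ((1 - r ^ 2) ^ (-(1 / 2) : ℝ) * ‖1 - r * x‖ ^ (-m))
          ≤ 1 * ((1 - r) ^ (-(1 / 2) : ℝ) * (A / 2) ^ (-m)) := by gcongr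
        _ = _ := by ring
  have hmeas : Measurable fun r : ℝ => ENNReal.ofReal (r ^ k) *
      ENNReal.ofReal (‖1 - r * x‖ ^ (-(m + 1 / 2))) := by fun_prop
  -- On `(1 - B / 2, 1)` one has `r ≥ 1/2` and `|1 - r x| ≤ A + B / 2 ≤ 2A`, so the integrand is
  -- bounded below by a constant.
  have hlow : ENNReal.ofReal ((1 / 2) ^ k * (2 * A) ^ (-(m + 1 / 2)) * (B / 2)) ≤ J := by
    calc ENNReal.ofReal ((1 / 2) ^ k * (2 * A) ^ (-(m + 1 / 2)) * (B / 2))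
        = ∫⁻ r in Set.Ioo (1 - B / 2) 1, ENNReal.ofReal ((1 / 2) ^ k * (2 * A) ^ (-(m + 1 / 2))) := by
          rw [setLIntegral_const, Real.volume_Ioo, ← ENNReal.ofReal_mul (by positivity)]
          congr 2; ring
      _ ≤ ∫⁻ r in Set.Ioo (1 - B / 2) 1, ENNReal.ofReal (r ^ k) *
            ENNReal.ofReal (‖1 - r * x‖ ^ (-(m + 1 / 2))) := by
          refine setLIntegral_mono hmeas fun r hr => ?_
          have hr0 : 1 / 2 ≤ r := by linarith [hr.1]
          have hr' : r ∈ Set.Ioo (0 : ℝ) 1 := ⟨by linarith, hr.2⟩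
          obtain ⟨b1, b2, b3⟩ := radial_kernel_bounds hx.le hr'.1 hr'.2
          rw [← ENNReal.ofReal_mul (by positivity)]
          apply ENNReal.ofReal_le_ofReal
          have := hpos r hr'
          gcongr ?_ * ?_
          · gcongr
          · exact Real.rpow_le_rpow_of_nonpos this (by linarith [hr.1]) (by linarith)
      _ ≤ J := lintegral_mono_set (Set.Ioo_subset_Ioo_left (by linarith))
  calc _ ≤ ∫⁻ r in Set.Ioo (0 : ℝ) 1, (ENNReal.ofReal 2 * (ENNReal.ofReal (r ^ k) *
            ENNReal.ofReal (‖1 - r * x‖ ^ (-(m + 1 / 2)))) +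
        (Set.Ioo (1 - B) 1).indicator
        (fun r => ENNReal.ofReal ((A / 2) ^ (-m)) * ENNReal.ofReal ((1 - r) ^ (-(1 / 2) : ℝ))) r) :=
        setLIntegral_mono' measurableSet_Ioo hpt
    _ ≤ ENNReal.ofReal 2 * J + ENNReal.ofReal ((A / 2) ^ (-m)) * ENNReal.ofReal (2 * B ^ (1 / 2 : ℝ)) := by
        rw [lintegral_add_left (hmeas.const_mul _), lintegral_const_mul _ hmeas]
        gcongr
        refine (setLIntegral_le_lintegral _ _).trans ?_
        rw [lintegral_indicator measurableSet_Ioo, lintegral_const_mul _ (by fun_prop)]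
        gcongr
        exact lintegral_rpow_neg_half_le hB0.le
    _ ≤ ENNReal.ofReal 2 * J + ENNReal.ofReal (2 ^ (2 * m + k + 4)) * J := by
        refine add_le_add le_rfl ?_
        refine le_trans ?_ (mul_le_mul_right hlow _)
        rw [← ENNReal.ofReal_mul (by positivity), ← ENNReal.ofReal_mul (by positivity)]
        apply ENNReal.ofReal_le_ofReal
        have e1 : (A / 2) ^ (-m) = A ^ (-m) * 2 ^ m := by
          rw [Real.div_rpow hA0.le (by norm_num), Real.rpow_neg (x := 2) (by norm_num), div_inv_eq_mul]
        have e2 : (2 * A) ^ (-(m + 1 / 2)) = 2 ^ (-(m + 1 / 2)) * (A ^ (-m) * A ^ (-(1 / 2) : ℝ)) := by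
          rw [Real.mul_rpow (by norm_num) hA0.le, ← Real.rpow_add hA0]; congr 2; ring
        have e3 : (2 : ℝ) ^ (2 * m + k + 4) * ((1 / 2) ^ k * (2 ^ (-(m + 1 / 2)) * 2⁻¹)) = 2 ^ m * 2 ^ (5 / 2 : ℝ) := by
          have : ((1 : ℝ) / 2) ^ k = 2 ^ (-(k : ℝ)) := by
            rw [Real.rpow_neg (by norm_num), Real.rpow_natCast]; simp
          have h2 : (2 : ℝ)⁻¹ = 2 ^ (-1 : ℝ) := by rw [Real.rpow_neg_one]
          rw [this, h2, ← Real.rpow_add (by norm_num), ← Real.rpow_add (by norm_num), ← Real.rpow_add (by norm_num),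
            ← Real.rpow_add (by norm_num)]
          congr 1; ring
        have e4 : B ^ (1 / 2 : ℝ) ≤ 2 ^ (1 / 2 : ℝ) * (A ^ (-(1 / 2) : ℝ) * B) := by
          have h5 : (2 * B) ^ (-(1 / 2) : ℝ) ≤ A ^ (-(1 / 2) : ℝ) :=
            Real.rpow_le_rpow_of_nonpos hA0 hAB (by norm_num)
          rw [Real.mul_rpow (by norm_num) hB0.le] at h5
          calc B ^ (1 / 2 : ℝ) = 2 ^ (1 / 2 : ℝ) * (2 ^ (-(1 / 2) : ℝ) * B ^ (-(1 / 2) : ℝ) * B) := by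
                have a1 : (2 : ℝ) ^ (1 / 2 : ℝ) * 2 ^ (-(1 / 2) : ℝ) = 1 := by
                  rw [← Real.rpow_add (by norm_num)]; norm_num
                have a2 : B ^ (-(1 / 2) : ℝ) * B = B ^ (1 / 2 : ℝ) := by
                  nth_rewrite 2 [← Real.rpow_one B]
                  rw [← Real.rpow_add hB0]; norm_num
                rw [mul_assoc, a2, ← mul_assoc, a1, one_mul]
            _ ≤ _ := by gcongr
        have e5 : (2 : ℝ) ^ (5 / 2 : ℝ) = 4 * 2 ^ (1 / 2 : ℝ) := by
          rw [show (5 / 2 : ℝ) = 2 + 1 / 2 by norm_num, Real.rpow_add (by norm_num)]; norm_num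
        have hs : (0 : ℝ) < 2 ^ (1 / 2 : ℝ) := by positivity
        have hAm : 0 < A ^ (-m) := by positivity
        have h2m : (0 : ℝ) < 2 ^ m := by positivity
        rw [e1, e2]
        calc A ^ (-m) * 2 ^ m * (2 * B ^ (1 / 2 : ℝ))
            ≤ A ^ (-m) * 2 ^ m * (2 * (2 ^ (1 / 2 : ℝ) * (A ^ (-(1 / 2) : ℝ) * B))) := by gcongr
          _ ≤ A ^ (-m) * 2 ^ m * (4 * (2 ^ (1 / 2 : ℝ) * (A ^ (-(1 / 2) : ℝ) * B))) := by
              gcongr; norm_num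
          _ = (2 ^ m * 2 ^ (5 / 2 : ℝ)) * (A ^ (-m) * (A ^ (-(1 / 2) : ℝ) * B)) := by rw [e5]; ring
          _ = _ := by rw [← e3]; ring
    _ = _ := by rw [← add_mul, ENNReal.ofReal_add (by norm_num) (by positivity)]

/-- The weight `(1 - |z|²)^(-1/2)` may be traded for half a power of the kernel. -/
lemma lintegral_weight_kernel_le [NeZero n] {m : ℝ} (hm : 0 < m) {l : Cn n} (hl : ‖l‖ < 1) :
    ∫⁻ z, ENNReal.ofReal ((1 - ‖z‖ ^ 2) ^ (-(1 / 2) : ℝ) * ‖1 - inner ℂ l z‖ ^ (-m)) ∂(ballVol n) ≤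
      ENNReal.ofReal (2 + 2 ^ (2 * m + (2 * n - 1 : ℕ) + 4)) *
        ∫⁻ z, ENNReal.ofReal (‖1 - inner ℂ l z‖ ^ (-(m + 1 / 2))) ∂(ballVol n) := by
  rw [lintegral_ballVol_polar _ (by fun_prop), lintegral_ballVol_polar _ (by fun_prop), mul_left_comm]
  refine mul_le_mul_right ?_ _
  rw [← lintegral_const_mul' _ _ ENNReal.ofReal_ne_top]
  refine lintegral_mono fun w => ?_
  have hw : ‖(w : Cn n)‖ = 1 := by simp
  have hx : ‖inner ℂ l (w : Cn n)‖ < 1 :=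
    (norm_inner_le_norm _ _).trans_lt (by rw [hw]; linarith)
  have h := lintegral_radial_le (2 * n - 1) hm hx
  refine le_trans (le_of_eq ?_) (h.trans (le_of_eq ?_))
  · refine setLIntegral_congr_fun measurableSet_Ioo fun r hr => ?_
    simp only [norm_smul, hw, inner_smul_right, Complex.norm_real, Real.norm_of_nonneg hr.1.le, mul_one]
  · congr 1
    refine setLIntegral_congr_fun measurableSet_Ioo fun r hr => ?_
    simp only [inner_smul_right]

/-- Forelli–Rudin type estimate. -/
lemma lintegral_kernel_le [NeZero n] {c : ℝ} (hc : 0 < c) {z : Cn n} (hz : ‖z‖ < 1) :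
    ∫⁻ l, ENNReal.ofReal (‖1 - inner ℂ z l‖ ^ (-(n + 1 + c))) ∂(ballVol n) ≤
      ENNReal.ofReal (72 ^ (n + 1) * 2 ^ c * (1 - 2 ^ (-c))⁻¹ * (1 - ‖z‖ ^ 2) ^ (-c)) := by
  set d := (1 - ‖z‖ ^ 2) / 2 with hd
  have hd0 : 0 < d := by have := one_sub_norm_sq_pos hz; positivity
  have hq : (-(n + 1 + c) : ℝ) ≤ 0 := by
    have : (0 : ℝ) ≤ n := n.cast_nonneg
    linarith
  -- Dyadic shells `2^j d ≤ |1 - ⟨l, z⟩| < 2^(j+1) d`; they exhaust the ball because `d = (1 - |z|²)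
  -- / 2` is a lower bound for `|1 - ⟨l, z⟩|`. The volume `O((2^j d)^(n+1))` of a shell turns the
  -- sum into a geometric series of ratio `2^(-c)`.
  have hpt : ∀ᵐ l ∂(ballVol n), ENNReal.ofReal (‖1 - inner ℂ z l‖ ^ (-(n + 1 + c))) ≤
      ∑' j : ℕ, {w : Cn n | ‖w‖ < 1 ∧ ‖1 - inner ℂ z w‖ < 2 ^ (j + 1) * d}.indicator
        (fun _ => ENNReal.ofReal ((2 ^ j * d) ^ (-(n + 1 + c)))) l := by
    filter_upwards [ae_mem_unitBall n] with l hl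
    rw [mem_unitBall] at hl
    have h1 : 1 ≤ ‖1 - inner ℂ z l‖ / d := by
      rw [le_div_iff₀ hd0, one_mul, hd]
      have := one_sub_norm_sq_le (w := z) hl.le hz.le
      linarith
    obtain ⟨j, hj1, hj2⟩ := exists_nat_pow_near h1 (one_lt_two)
    rw [le_div_iff₀ hd0] at hj1
    rw [div_lt_iff₀ hd0] at hj2
    refine le_trans ?_ (ENNReal.le_tsum j)
    have hmem : l ∈ {w : Cn n | ‖w‖ < 1 ∧ ‖1 - inner ℂ z w‖ < 2 ^ (j + 1) * d} := ⟨hl, hj2⟩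
    rw [Set.indicator_of_mem hmem]
    exact ENNReal.ofReal_le_ofReal (Real.rpow_le_rpow_of_nonpos (by positivity) hj1 hq)
  have hms : ∀ j : ℕ, MeasurableSet {w : Cn n | ‖w‖ < 1 ∧ ‖1 - inner ℂ z w‖ < 2 ^ (j + 1) * d} :=
    fun j => by
      have c1 : Continuous fun w : Cn n => ‖w‖ := by fun_prop
      have c2 : Continuous fun w : Cn n => ‖1 - inner ℂ z w‖ := by fun_prop
      exact ((isOpen_lt c1 continuous_const).inter (isOpen_lt c2 continuous_const)).measurableSet
  have h2c : (2 : ℝ) ^ (-c) < 1 := Real.rpow_lt_one_of_one_lt_of_neg (by norm_num) (by linarith)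
  have h2c0 : (0 : ℝ) ≤ 2 ^ (-c) := by positivity
  calc _ ≤ ∫⁻ l, ∑' j : ℕ, {w : Cn n | ‖w‖ < 1 ∧ ‖1 - inner ℂ z w‖ < 2 ^ (j + 1) * d}.indicator
        (fun _ => ENNReal.ofReal ((2 ^ j * d) ^ (-(n + 1 + c)))) l ∂(ballVol n) := lintegral_mono_ae hpt
    _ = ∑' j : ℕ, ENNReal.ofReal ((2 ^ j * d) ^ (-(n + 1 + c))) *
          ballVol n {w : Cn n | ‖w‖ < 1 ∧ ‖1 - inner ℂ z w‖ < 2 ^ (j + 1) * d} := by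
        rw [lintegral_tsum (fun j => (measurable_const.indicator (hms j)).aemeasurable)]
        congr 1 with j
        rw [lintegral_indicator_const (hms j)]
    _ ≤ ∑' j : ℕ, ENNReal.ofReal (72 ^ (n + 1) * d ^ (-c) * (2 ^ (-c)) ^ j) := by
        gcongr with j
        refine (mul_le_mul_right (ballVol_nonisotropic_le hz (by positivity)) _).trans ?_
        rw [← ENNReal.ofReal_mul (by positivity)]
        apply ENNReal.ofReal_le_ofReal
        have e1 : (2 ^ j * d) ^ (-(n + 1 + c)) = ((2 ^ j * d) ^ (n + 1))⁻¹ * (d ^ (-c) * (2 ^ (-c)) ^ j) := by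
          have e0 : (-(n + 1 + c) : ℝ) = -((n + 1 : ℕ) : ℝ) + -c := by push_cast; ring
          rw [e0, Real.rpow_add (by positivity), Real.rpow_neg (by positivity), Real.rpow_natCast,
            Real.mul_rpow (by positivity) hd0.le, ← Real.rpow_natCast 2 j, ← Real.rpow_natCast (2 ^ (-c)) j,
            ← Real.rpow_mul (by norm_num), ← Real.rpow_mul (by norm_num), mul_comm (j : ℝ) (-c)]
          ring
        rw [e1]
        have e2 : (2 : ℝ) ^ (j + 1) * d = 2 * (2 ^ j * d) := by ring
        rw [e2, mul_pow 2 (2 ^ j * d)]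
        have e3 : ((2 ^ j * d) ^ (n + 1) : ℝ) ≠ 0 := by positivity
        have e4 : (72 : ℝ) ^ (n + 1) = 36 ^ (n + 1) * 2 ^ (n + 1) := by rw [← mul_pow]; norm_num
        rw [e4]
        generalize ((2 ^ j * d) ^ (n + 1) : ℝ) = Y at e3 ⊢
        apply le_of_eq
        field_simp
    _ = _ := by
        rw [← ENNReal.ofReal_tsum_of_nonneg (fun j => by positivity)
          ((summable_geometric_of_lt_one h2c0 h2c).mul_left _), tsum_mul_left,
          tsum_geometric_of_lt_one h2c0 h2c]
        congr 1
        have : d ^ (-c) = 2 ^ c * (1 - ‖z‖ ^ 2) ^ (-c) := by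
          rw [hd, Real.div_rpow (one_sub_norm_sq_pos hz).le (by norm_num), Real.rpow_neg (x := 2) (by norm_num),
            div_inv_eq_mul, mul_comm]
        rw [this]; ring

/-! ### The Schur test -/

lemma lintegral_mul_sq_le {α : Type*} [MeasurableSpace α] {μ : Measure α} {f g : α → ℝ≥0∞}
    (hf : AEMeasurable f μ) (hg : AEMeasurable g μ) :
    (∫⁻ x, f x * g x ∂μ) ^ 2 ≤ (∫⁻ x, f x ^ 2 ∂μ) * ∫⁻ x, g x ^ 2 ∂μ := by
  have h := ENNReal.lintegral_mul_le_Lp_mul_Lq μ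
    (Real.HolderConjugate.two_two) hf hg
  simp only [Pi.mul_apply, ENNReal.rpow_ofNat] at h
  calc _ ≤ ((∫⁻ x, f x ^ 2 ∂μ) ^ (1 / 2 : ℝ) * (∫⁻ x, g x ^ 2 ∂μ) ^ (1 / 2 : ℝ)) ^ 2 := by gcongr
    _ = _ := by
      rw [mul_pow, ← ENNReal.rpow_natCast, ← ENNReal.rpow_natCast, ← ENNReal.rpow_mul, ← ENNReal.rpow_mul]
      norm_num

/-- Schur test for the kernel `(1 - |l|²) / |1 - ⟨z, l⟩|^(n + 2 - κ)`. -/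
lemma exists_schur_bound (n : ℕ) [NeZero n] {κ : ℝ} (h0 : 0 ≤ κ) (h1 : κ ≤ 1 / 2) :
    ∃ C : ℝ≥0, ∀ H : Cn n → ℝ≥0∞, Measurable H →
      ∫⁻ z, (∫⁻ l, ENNReal.ofReal ((1 - ‖l‖ ^ 2) * ‖1 - inner ℂ l z‖ ^ (-(n + 2 - κ))) * H l ∂(ballVol n)) ^ 2
        ∂(ballVol n) ≤
      C * ∫⁻ l, H l ^ 2 * ENNReal.ofReal ((1 - ‖l‖ ^ 2) ^ (2 * κ)) ∂(ballVol n) := by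
  have hn1 : (1 : ℝ) ≤ n := by exact_mod_cast NeZero.one_le
  set C1 : ℝ := 2 * (72 ^ (n + 1) * 2 ^ (1 / 2 : ℝ) * (1 - 2 ^ (-(1 / 2) : ℝ))⁻¹) with hC1
  set C2 : ℝ := (2 + 2 ^ (2 * (n + 2 - κ) + (2 * n - 1 : ℕ) + 4)) *
    (72 ^ (n + 1) * 2 ^ (3 / 2 - κ) * (1 - 2 ^ (-(3 / 2 - κ)))⁻¹) with hC2
  have hC1p : 0 ≤ C1 := by
    have : (2 : ℝ) ^ (-(1 / 2) : ℝ) < 1 := Real.rpow_lt_one_of_one_lt_of_neg (by norm_num) (by norm_num)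
    have : 0 ≤ (1 - (2 : ℝ) ^ (-(1 / 2) : ℝ))⁻¹ := inv_nonneg.2 (by linarith)
    positivity
  have hC2p : 0 ≤ C2 := by
    have : (2 : ℝ) ^ (-(3 / 2 - κ)) < 1 := Real.rpow_lt_one_of_one_lt_of_neg (by norm_num) (by linarith)
    have : 0 ≤ (1 - (2 : ℝ) ^ (-(3 / 2 - κ)))⁻¹ := inv_nonneg.2 (by linarith)
    positivity
  refine ⟨Real.toNNReal (C1 * C2), fun H hH => ?_⟩
  -- the first Schur integral
  have hA : ∀ z : Cn n, ‖z‖ < 1 →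
      ∫⁻ l, ENNReal.ofReal ((1 - ‖l‖ ^ 2) ^ (1 / 2 - κ) * ‖1 - inner ℂ l z‖ ^ (-(n + 2 - κ))) ∂(ballVol n) ≤
        ENNReal.ofReal (C1 * (1 - ‖z‖ ^ 2) ^ (-(1 / 2) : ℝ)) := by
    intro z hz
    calc _ ≤ ∫⁻ l, ENNReal.ofReal 2 * ENNReal.ofReal (‖1 - inner ℂ z l‖ ^ (-(n + 1 + 1 / 2) : ℝ)) ∂(ballVol n) := by
          refine lintegral_mono_ae ?_
          filter_upwards [ae_mem_unitBall n] with l hl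
          rw [mem_unitBall] at hl
          rw [← ENNReal.ofReal_mul (by norm_num)]
          apply ENNReal.ofReal_le_ofReal
          rw [norm_one_sub_inner_comm l z]
          have hp := norm_one_sub_inner_pos hz hl
          have h2 := one_sub_norm_sq_le hz.le hl.le
          have h3 := one_sub_norm_sq_pos hl
          calc (1 - ‖l‖ ^ 2) ^ (1 / 2 - κ) * ‖1 - inner ℂ l z‖ ^ (-(n + 2 - κ))
              ≤ (2 * ‖1 - inner ℂ l z‖) ^ (1 / 2 - κ) * ‖1 - inner ℂ l z‖ ^ (-(n + 2 - κ)) := by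
                gcongr
            _ = 2 ^ (1 / 2 - κ) * ‖1 - inner ℂ l z‖ ^ (-(n + 1 + 1 / 2) : ℝ) := by
                rw [Real.mul_rpow (by norm_num) hp.le, mul_assoc, ← Real.rpow_add hp]
                congr 2; ring
            _ ≤ 2 * ‖1 - inner ℂ l z‖ ^ (-(n + 1 + 1 / 2) : ℝ) := by
                gcongr
                calc (2 : ℝ) ^ (1 / 2 - κ) ≤ 2 ^ (1 : ℝ) :=
                      Real.rpow_le_rpow_of_exponent_le (by norm_num) (by linarith)
                  _ = 2 := Real.rpow_one 2
      _ ≤ _ := by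
          rw [lintegral_const_mul' _ _ ENNReal.ofReal_ne_top]
          refine (mul_le_mul_right (lintegral_kernel_le (by norm_num) hz) _).trans ?_
          rw [← ENNReal.ofReal_mul (by norm_num), hC1]
          apply ENNReal.ofReal_le_ofReal
          apply le_of_eq; ring
  -- the second Schur integral
  have hB : ∀ l : Cn n, ‖l‖ < 1 →
      ∫⁻ z, ENNReal.ofReal ((1 - ‖z‖ ^ 2) ^ (-(1 / 2) : ℝ) * ‖1 - inner ℂ l z‖ ^ (-(n + 2 - κ))) ∂(ballVol n) ≤
        ENNReal.ofReal (C2 * (1 - ‖l‖ ^ 2) ^ (-(3 / 2 - κ))) := by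
    intro l hl
    refine (lintegral_weight_kernel_le (by linarith) hl).trans ?_
    have e : (-(n + 2 - κ + 1 / 2) : ℝ) = -(n + 1 + (3 / 2 - κ)) := by ring
    rw [e]
    refine (mul_le_mul_right (lintegral_kernel_le (by linarith) hl) _).trans ?_
    rw [← ENNReal.ofReal_mul (by positivity), hC2]
    apply ENNReal.ofReal_le_ofReal
    apply le_of_eq; ring
  -- Cauchy-Schwarz
  have hCS : ∀ z : Cn n, ‖z‖ < 1 →
      (∫⁻ l, ENNReal.ofReal ((1 - ‖l‖ ^ 2) * ‖1 - inner ℂ l z‖ ^ (-(n + 2 - κ))) * H l ∂(ballVol n)) ^ 2 ≤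
      (∫⁻ l, H l ^ 2 * ENNReal.ofReal ((1 - ‖l‖ ^ 2) ^ (3 / 2 + κ)) *
        ENNReal.ofReal (‖1 - inner ℂ l z‖ ^ (-(n + 2 - κ))) ∂(ballVol n)) *
        ENNReal.ofReal (C1 * (1 - ‖z‖ ^ 2) ^ (-(1 / 2) : ℝ)) := by
    intro z hz
    -- The weight `(1 - |l|²)²` is divided as `(1 - |l|²)^(3/2+κ) · (1 - |l|²)^(1/2-κ)`, and the
    -- kernel evenly. The second factor is what the first Schur integral turns into `(1 -
    -- |z|²)^(-1/2)`; integrating that in `z` then costs `(1 - |l|²)^(-(3/2-κ))`, and `(1 -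
    -- |l|²)^(2κ)` is left.
    have hf : Measurable fun l : Cn n => H l * ENNReal.ofReal
        (((1 - ‖l‖ ^ 2) ^ (3 / 2 + κ) * ‖1 - inner ℂ l z‖ ^ (-(n + 2 - κ))) ^ (1 / 2 : ℝ)) :=
      hH.mul (by fun_prop)
    have hg : Measurable fun l : Cn n => ENNReal.ofReal
        (((1 - ‖l‖ ^ 2) ^ (1 / 2 - κ) * ‖1 - inner ℂ l z‖ ^ (-(n + 2 - κ))) ^ (1 / 2 : ℝ)) := by
      fun_prop
    have hcs := lintegral_mul_sq_le (μ := ballVol n) hf.aemeasurable hg.aemeasurable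
    refine le_trans (le_trans (le_of_eq ?_) hcs)
      (mul_le_mul' (le_of_eq ?_) (le_trans (le_of_eq ?_) (hA z hz)))
    · congr 1
      refine lintegral_congr_ae ?_
      filter_upwards [ae_mem_unitBall n] with l hl
      rw [mem_unitBall] at hl
      have hp := norm_one_sub_inner_pos hz hl
      have h3 := one_sub_norm_sq_pos hl
      rw [mul_comm, mul_assoc, ← ENNReal.ofReal_mul (by positivity)]
      congr 2
      rw [← Real.mul_rpow (by positivity) (by positivity)]
      have : (1 - ‖l‖ ^ 2) ^ (3 / 2 + κ) * ‖1 - inner ℂ l z‖ ^ (-(n + 2 - κ)) *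
          ((1 - ‖l‖ ^ 2) ^ (1 / 2 - κ) * ‖1 - inner ℂ l z‖ ^ (-(n + 2 - κ))) =
          ((1 - ‖l‖ ^ 2) * ‖1 - inner ℂ l z‖ ^ (-(n + 2 - κ))) ^ (2 : ℝ) := by
        have e : (1 - ‖l‖ ^ 2) ^ (3 / 2 + κ) * (1 - ‖l‖ ^ 2) ^ (1 / 2 - κ) = (1 - ‖l‖ ^ 2) ^ (2 : ℝ) := by
          rw [← Real.rpow_add h3]; congr 1; ring
        rw [Real.mul_rpow h3.le (by positivity), ← e, Real.rpow_two]
        ring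
      rw [this, ← Real.rpow_mul (by positivity)]
      norm_num
    · refine lintegral_congr_ae ?_
      filter_upwards [ae_mem_unitBall n] with l hl
      rw [mem_unitBall] at hl
      have h3 := one_sub_norm_sq_pos hl
      rw [mul_pow, ← ENNReal.ofReal_pow (by positivity), ← Real.rpow_natCast, ← Real.rpow_mul (by positivity),
        mul_assoc, ← ENNReal.ofReal_mul (by positivity)]
      norm_num
    · refine lintegral_congr_ae ?_
      filter_upwards [ae_mem_unitBall n] with l hl
      rw [mem_unitBall] at hl
      have h3 := one_sub_norm_sq_pos hl
      rw [← ENNReal.ofReal_pow (by positivity), ← Real.rpow_natCast, ← Real.rpow_mul (by positivity)]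
      norm_num
  calc _ ≤ ∫⁻ z, (∫⁻ l, H l ^ 2 * ENNReal.ofReal ((1 - ‖l‖ ^ 2) ^ (3 / 2 + κ)) *
        ENNReal.ofReal (‖1 - inner ℂ l z‖ ^ (-(n + 2 - κ))) ∂(ballVol n)) *
        ENNReal.ofReal (C1 * (1 - ‖z‖ ^ 2) ^ (-(1 / 2) : ℝ)) ∂(ballVol n) := by
        refine lintegral_mono_ae ?_
        filter_upwards [ae_mem_unitBall n] with z hz using hCS z (mem_unitBall.1 hz)
    _ = ∫⁻ z, ∫⁻ l, H l ^ 2 * ENNReal.ofReal ((1 - ‖l‖ ^ 2) ^ (3 / 2 + κ)) *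
        ENNReal.ofReal (‖1 - inner ℂ l z‖ ^ (-(n + 2 - κ))) *
        ENNReal.ofReal (C1 * (1 - ‖z‖ ^ 2) ^ (-(1 / 2) : ℝ)) ∂(ballVol n) ∂(ballVol n) := by
        congr 1 with z
        rw [lintegral_mul_const' _ _ ENNReal.ofReal_ne_top]
    _ = ∫⁻ l, ∫⁻ z, H l ^ 2 * ENNReal.ofReal ((1 - ‖l‖ ^ 2) ^ (3 / 2 + κ)) *
        ENNReal.ofReal (‖1 - inner ℂ l z‖ ^ (-(n + 2 - κ))) *
        ENNReal.ofReal (C1 * (1 - ‖z‖ ^ 2) ^ (-(1 / 2) : ℝ)) ∂(ballVol n) ∂(ballVol n) := by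
        refine lintegral_lintegral_swap (Measurable.aemeasurable ?_)
        simp only [Function.uncurry_def]
        fun_prop
    _ ≤ ∫⁻ l, ENNReal.ofReal (C1 * C2) * (H l ^ 2 * ENNReal.ofReal ((1 - ‖l‖ ^ 2) ^ (2 * κ))) ∂(ballVol n) := by
        refine lintegral_mono_ae ?_
        filter_upwards [ae_mem_unitBall n] with l hl
        rw [mem_unitBall] at hl
        have h3 := one_sub_norm_sq_pos hl
        calc _ = ∫⁻ z, (H l ^ 2 * (ENNReal.ofReal (C1 * (1 - ‖l‖ ^ 2) ^ (3 / 2 + κ)))) *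
              ENNReal.ofReal ((1 - ‖z‖ ^ 2) ^ (-(1 / 2) : ℝ) * ‖1 - inner ℂ l z‖ ^ (-(n + 2 - κ))) ∂(ballVol n) := by
              congr 1 with z
              have hk : 0 ≤ ‖1 - inner ℂ l z‖ ^ (-(n + 2 - κ)) := by positivity
              rw [ENNReal.ofReal_mul hC1p, ENNReal.ofReal_mul hC1p, ENNReal.ofReal_mul' hk]
              ring
          _ = (H l ^ 2 * (ENNReal.ofReal (C1 * (1 - ‖l‖ ^ 2) ^ (3 / 2 + κ)))) *
              ∫⁻ z, ENNReal.ofReal ((1 - ‖z‖ ^ 2) ^ (-(1 / 2) : ℝ) * ‖1 - inner ℂ l z‖ ^ (-(n + 2 - κ))) ∂(ballVol n) := by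
              rw [lintegral_const_mul _ (by fun_prop)]
          _ ≤ (H l ^ 2 * (ENNReal.ofReal (C1 * (1 - ‖l‖ ^ 2) ^ (3 / 2 + κ)))) *
              ENNReal.ofReal (C2 * (1 - ‖l‖ ^ 2) ^ (-(3 / 2 - κ))) := mul_le_mul_right (hB l hl) _
          _ = _ := by
              rw [mul_assoc, ← ENNReal.ofReal_mul (by positivity), mul_left_comm (ENNReal.ofReal (C1 * C2)),
                ← ENNReal.ofReal_mul (by positivity)]
              congr 2
              have e : (1 - ‖l‖ ^ 2) ^ (3 / 2 + κ) * (1 - ‖l‖ ^ 2) ^ (-(3 / 2 - κ)) = (1 - ‖l‖ ^ 2) ^ (2 * κ) := by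
                rw [← Real.rpow_add h3]; congr 1; ring
              rw [← e]; ring
    _ = _ := by
        rw [lintegral_const_mul' _ _ ENNReal.ofReal_ne_top]; rfl

/-! ### Unitary invariance and moments of the ball -/

/-- A complex linear isometry, regarded as a real one. -/
def realIsometry (U : Cn n ≃ₗᵢ[ℂ] Cn n) : Cn n ≃ₗᵢ[ℝ] Cn n :=
  { U.toLinearEquiv.restrictScalars ℝ with norm_map' := U.norm_map }

lemma measurePreserving_volume (U : Cn n ≃ₗᵢ[ℂ] Cn n) :
    MeasurePreserving U (volume : Measure (Cn n)) volume :=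
  (realIsometry U).measurePreserving

lemma measurePreserving_ballVol (U : Cn n ≃ₗᵢ[ℂ] Cn n) :
    MeasurePreserving U (ballVol n) (ballVol n) := by
  have h := (measurePreserving_volume U).restrict_preimage (measurableSet_unitBall (n := n))
  have hpre : U ⁻¹' (unitBall n) = unitBall n := by
    ext w; simp [mem_unitBall]
  rw [hpre] at h
  exact h.smul_measure _

lemma integral_complex_gaussian_moment (m : ℕ) :
    ∫ x : ℂ, ‖x‖ ^ (2 * m) * Real.exp (-‖x‖ ^ 2) = Real.pi * m.factorial := by
  have h := Complex.integral_rpow_mul_exp_neg_rpow (p := 2) (q := (2 * m : ℕ)) (by norm_num)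
    (by have : (0 : ℝ) ≤ (2 * m : ℕ) := Nat.cast_nonneg _
        linarith)
  simp only [Real.rpow_natCast, Real.rpow_two] at h
  rw [h, ← Real.Gamma_nat_eq_factorial]
  have : (((2 * m : ℕ) : ℝ) + 2) / 2 = m + 1 := by push_cast; ring
  rw [this]; ring

lemma integrable_complex_gaussian_moment (m : ℕ) :
    Integrable fun x : ℂ => ‖x‖ ^ (2 * m) * Real.exp (-‖x‖ ^ 2) := by
  by_contra h
  have h1 := integral_complex_gaussian_moment m
  rw [integral_undef h] at h1
  have : 0 < Real.pi * m.factorial := by positivity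
  linarith

/-- After a rotation `e` is the first basis vector and the Gaussian integral factors over the
coordinates. The constant absorbs the ratio of the two Haar measures; it is independent of `m` and
`e`, and its value is never needed. -/
lemma exists_gaussian_moment (n : ℕ) [NeZero n] : ∃ κ : ℝ≥0∞, ∀ (m : ℕ) (e : Cn n), ‖e‖ = 1 →
    ∫⁻ w, ENNReal.ofReal (‖inner ℂ e w‖ ^ (2 * m)) * ENNReal.ofReal (Real.exp (-‖w‖ ^ 2)) =
      κ * ENNReal.ofReal m.factorial := by
  set φ := PiLp.continuousLinearEquiv 2 ℂ (fun _ : Fin n => ℂ) with hφ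
  have : (Measure.map φ (volume : Measure (Cn n))).IsAddHaarMeasure := φ.isAddHaarMeasure_map _
  set c := Measure.addHaarScalarFactor (Measure.map φ (volume : Measure (Cn n)))
    (volume : Measure (Fin n → ℂ)) with hc
  have hmap : Measure.map φ (volume : Measure (Cn n)) = c • (volume : Measure (Fin n → ℂ)) :=
    Measure.isAddLeftInvariant_eq_smul _ _
  refine ⟨c * ENNReal.ofReal (Real.pi ^ n), fun m e he => ?_⟩
  obtain ⟨b, hb⟩ := exists_orthonormalBasis_apply_zero he
  have h1 : ∀ w : Cn n, ENNReal.ofReal (‖inner ℂ e w‖ ^ (2 * m)) * ENNReal.ofReal (Real.exp (-‖w‖ ^ 2)) =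
      (fun x : Cn n => ENNReal.ofReal (‖x 0‖ ^ (2 * m)) * ENNReal.ofReal (Real.exp (-‖x‖ ^ 2))) (b.repr w) := by
    intro w
    simp only [LinearIsometryEquiv.norm_map, b.repr_apply_apply, hb]
  have hm1 : Measurable fun x : Cn n =>
      ENNReal.ofReal (‖x 0‖ ^ (2 * m)) * ENNReal.ofReal (Real.exp (-‖x‖ ^ 2)) := by fun_prop
  set f : Fin n → ℂ → ℝ := fun i ζ => (if i = 0 then ‖ζ‖ ^ (2 * m) else 1) * Real.exp (-‖ζ‖ ^ 2) with hf
  have h2 : ∀ x : Cn n, ENNReal.ofReal (‖x 0‖ ^ (2 * m)) * ENNReal.ofReal (Real.exp (-‖x‖ ^ 2)) =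
      (fun y : Fin n → ℂ => ENNReal.ofReal (∏ i, f i (y i))) (φ x) := by
    intro x
    rw [← ENNReal.ofReal_mul (by positivity)]
    congr 1
    simp only [hf]
    rw [Finset.prod_mul_distrib, ← Real.exp_sum, EuclideanSpace.norm_sq_eq, Finset.sum_neg_distrib]
    congr 1
    rw [Finset.prod_ite_eq' Finset.univ 0 (fun i => ‖(φ x) i‖ ^ (2 * m))]
    simp [hφ]
  have hint : ∀ i, Integrable (f i) := by
    intro i
    by_cases hi : i = 0
    · simpa [hf, hi] using integrable_complex_gaussian_moment m
    · simpa [hf, hi] using integrable_complex_gaussian_moment 0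
  have hval : ∀ i, ∫ x, f i x = if i = 0 then Real.pi * m.factorial else Real.pi := by
    intro i
    by_cases hi : i = 0
    · simpa [hf, hi] using integral_complex_gaussian_moment m
    · simpa [hf, hi] using integral_complex_gaussian_moment 0
  have hfm : ∀ i, Measurable (f i) := by
    intro i
    by_cases hi : i = 0
    · simp only [hf, hi, if_true]; fun_prop
    · simp only [hf, hi, if_false]; fun_prop
  have hm2 : Measurable fun y : Fin n → ℂ => ENNReal.ofReal (∏ i, f i (y i)) := by
    refine ENNReal.measurable_ofReal.comp ?_
    exact Finset.measurable_prod _ fun i _ => (hfm i).comp (measurable_pi_apply i)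
  rw [lintegral_congr h1, (measurePreserving_volume b.repr).lintegral_comp hm1, lintegral_congr h2,
    ← lintegral_map hm2 φ.continuous.measurable, hmap, lintegral_smul_measure,
    ← ofReal_integral_eq_lintegral_ofReal]
  · rw [integral_fintype_prod_volume_eq_prod, Finset.prod_congr rfl (fun i _ => hval i)]
    have : (∏ i : Fin n, if i = 0 then Real.pi * (m.factorial : ℝ) else Real.pi) = Real.pi ^ n * m.factorial := by
      obtain ⟨k, hk⟩ := Nat.exists_eq_succ_of_ne_zero (NeZero.ne n)
      subst hk
      rw [Fin.prod_univ_succ]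
      simp [pow_succ]; ring
    rw [this, ENNReal.ofReal_mul (by positivity), mul_assoc]
    rfl
  · exact Integrable.fintype_prod hint
  · refine Filter.Eventually.of_forall fun y => Finset.prod_nonneg fun i _ => ?_
    simp only [hf]
    split_ifs <;> positivity

/-- The same spherical moment appears for every radial weight. The moments of the ball can therefore
be read off from the Gaussian ones without computing an integral over the sphere. -/
lemma lintegral_inner_mul_radial [NeZero n] (e : Cn n) (m : ℕ) {h : ℝ → ℝ≥0∞} (hh : Measurable h) :
    ∫⁻ w, ENNReal.ofReal (‖inner ℂ e w‖ ^ (2 * m)) * h ‖w‖ =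
      (∫⁻ w : Metric.sphere (0 : Cn n) 1, ENNReal.ofReal (‖inner ℂ e (w : Cn n)‖ ^ (2 * m))
        ∂(volume : Measure (Cn n)).toSphere) *
      ∫⁻ r in Set.Ioi (0 : ℝ), ENNReal.ofReal (r ^ (2 * (n + m) - 1)) * h r := by
  rw [lintegral_polar _ (by fun_prop), ← lintegral_mul_const _ (by fun_prop)]
  refine lintegral_congr fun w => ?_
  have hw : ‖(w : Cn n)‖ = 1 := by simp
  rw [← lintegral_const_mul _ (by fun_prop)]
  refine setLIntegral_congr_fun measurableSet_Ioi fun r hr => ?_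
  have hr0 : 0 < r := hr
  have hn := NeZero.pos n
  have : 2 * (n + m) - 1 = (2 * n - 1) + 2 * m := by omega
  simp only [inner_smul_right, norm_smul, hw, mul_one, norm_mul, Complex.norm_real,
    Real.norm_of_nonneg hr0.le]
  rw [this, pow_add, mul_pow, ENNReal.ofReal_mul (by positivity), ENNReal.ofReal_mul (by positivity)]
  ring

/-- Induction on `l` through `(1 - r²)^(l+1) = (1 - r²)^l - r² (1 - r²)^l`, which trades a power of
the weight for a shift of `a`. -/
lemma integral_radial_beta (a l : ℕ) :
    ∫ r in (0 : ℝ)..1, r ^ (2 * a + 1) * (1 - r ^ 2) ^ l =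
      (a.factorial : ℝ) * l.factorial / (2 * (a + l + 1).factorial) := by
  induction l generalizing a with
  | zero =>
    simp only [pow_zero, mul_one, integral_pow, Nat.factorial_zero, Nat.add_zero, Nat.factorial_succ]
    push_cast
    have : ((a.factorial : ℕ) : ℝ) ≠ 0 := by positivity
    field_simp
    simp
    ring
  | succ l ih =>
    have e : ∀ r : ℝ, r ^ (2 * a + 1) * (1 - r ^ 2) ^ (l + 1) =
        r ^ (2 * a + 1) * (1 - r ^ 2) ^ l - r ^ (2 * (a + 1) + 1) * (1 - r ^ 2) ^ l := by
      intro r; ring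
    simp_rw [e]
    rw [intervalIntegral.integral_sub (Continuous.intervalIntegrable (by fun_prop) _ _)
      (Continuous.intervalIntegrable (by fun_prop) _ _), ih, ih]
    have e1 : a + 1 + l + 1 = (a + l + 1) + 1 := by ring
    have e2 : a + (l + 1) + 1 = (a + l + 1) + 1 := by ring
    rw [e1, e2, Nat.factorial_succ (a + l + 1), Nat.factorial_succ a, Nat.factorial_succ l]
    push_cast
    have h1 : ((a + l + 1).factorial : ℝ) ≠ 0 := by positivity
    have h2 : ((a : ℝ) + l + 1 + 1) ≠ 0 := by positivity
    field_simp
    ring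

lemma lintegral_radial_beta (a l : ℕ) :
    ∫⁻ r in Set.Ioo (0 : ℝ) 1, ENNReal.ofReal (r ^ (2 * a + 1)) * ENNReal.ofReal ((1 - r ^ 2) ^ l) =
      ENNReal.ofReal (a.factorial * l.factorial / (2 * (a + l + 1).factorial)) := by
  rw [← integral_radial_beta, intervalIntegral.integral_of_le zero_le_one,
    Measure.restrict_congr_set Ioo_ae_eq_Ioc, ofReal_integral_eq_lintegral_ofReal]
  · refine setLIntegral_congr_fun measurableSet_Ioc fun r hr => ?_
    have := hr.1
    rw [ENNReal.ofReal_mul (by positivity)]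
  · exact (Continuous.intervalIntegrable (by fun_prop) _ _).1
  · filter_upwards [ae_restrict_mem measurableSet_Ioc] with r hr
    have h1 := hr.1
    have : 0 ≤ 1 - r ^ 2 := by nlinarith [hr.2]
    positivity

lemma lintegral_gaussian_radial (a : ℕ) :
    ∫⁻ r in Set.Ioi (0 : ℝ), ENNReal.ofReal (r ^ (2 * a + 1)) * ENNReal.ofReal (Real.exp (-r ^ 2)) =
      ENNReal.ofReal (a.factorial / 2) := by
  have h := integral_rpow_mul_exp_neg_rpow (p := 2) (q := (2 * a + 1 : ℕ)) (by norm_num)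
    (by have : (0 : ℝ) ≤ (2 * a + 1 : ℕ) := Nat.cast_nonneg _
        linarith)
  simp only [Real.rpow_natCast, Real.rpow_two] at h
  have e : (((2 * a + 1 : ℕ) : ℝ) + 1) / 2 = a + 1 := by push_cast; ring
  rw [e, Real.Gamma_nat_eq_factorial] at h
  have e2 : (a.factorial / 2 : ℝ) = 1 / 2 * a.factorial := by ring
  rw [e2, ← h, ofReal_integral_eq_lintegral_ofReal]
  · refine setLIntegral_congr_fun measurableSet_Ioi fun r hr => ?_
    have : 0 < r := hr
    rw [ENNReal.ofReal_mul (by positivity)]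
  · by_contra hc
    rw [integral_undef hc] at h
    have : (0 : ℝ) < 1 / 2 * a.factorial := by positivity
    linarith
  · filter_upwards [ae_restrict_mem measurableSet_Ioi] with r hr
    have : 0 < r := hr
    positivity

/-- Moments of the weighted ball along a unit vector. -/
lemma lintegral_moment [NeZero n] {e : Cn n} (he : ‖e‖ = 1) (m l : ℕ) :
    ∫⁻ w, ENNReal.ofReal (‖inner ℂ e w‖ ^ (2 * m)) * ENNReal.ofReal ((1 - ‖w‖ ^ 2) ^ l) ∂(ballVol n) =
      ENNReal.ofReal (n.factorial * m.factorial * l.factorial / (n + m + l).factorial) := by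
  obtain ⟨κ, hκ⟩ := exists_gaussian_moment n
  have hn := NeZero.pos n
  set v := volume (unitBall n) with hv
  set σ : ℕ → ℝ≥0∞ := fun m => ∫⁻ w : Metric.sphere (0 : Cn n) 1,
    ENNReal.ofReal (‖inner ℂ e (w : Cn n)‖ ^ (2 * m)) ∂(volume : Measure (Cn n)).toSphere with hσ
  have hG : ∀ m, κ * ENNReal.ofReal m.factorial = σ m * ENNReal.ofReal ((n + m - 1).factorial / 2) := by
    intro m
    rw [← hκ m e he, lintegral_inner_mul_radial e m (h := fun r => ENNReal.ofReal (Real.exp (-r ^ 2)))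
      (by fun_prop), ← lintegral_gaussian_radial]
    have : 2 * (n + m) - 1 = 2 * (n + m - 1) + 1 := by omega
    rw [this]
  have hB : ∀ m l, ∫⁻ w, ENNReal.ofReal (‖inner ℂ e w‖ ^ (2 * m)) *
      ENNReal.ofReal ((1 - ‖w‖ ^ 2) ^ l) ∂(ballVol n) =
      v⁻¹ * κ * ENNReal.ofReal (m.factorial * l.factorial / (n + m + l).factorial) := by
    intro m l
    have h1 : ∀ w : Cn n, (unitBall n).indicator (fun w => ENNReal.ofReal (‖inner ℂ e w‖ ^ (2 * m)) *
        ENNReal.ofReal ((1 - ‖w‖ ^ 2) ^ l)) w = ENNReal.ofReal (‖inner ℂ e w‖ ^ (2 * m)) *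
        (Set.Iio (1 : ℝ)).indicator (fun r => ENNReal.ofReal ((1 - r ^ 2) ^ l)) ‖w‖ := by
      intro w
      by_cases hw : ‖w‖ < 1
      · rw [Set.indicator_of_mem (mem_unitBall.2 hw), Set.indicator_of_mem (show ‖w‖ ∈ Set.Iio (1 : ℝ) from hw)]
      · rw [Set.indicator_of_notMem (fun h => hw (mem_unitBall.1 h)),
          Set.indicator_of_notMem (show ‖w‖ ∉ Set.Iio (1 : ℝ) from hw), mul_zero]
    have hmeas : Measurable ((Set.Iio (1 : ℝ)).indicator fun r => ENNReal.ofReal ((1 - r ^ 2) ^ l)) :=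
      Measurable.indicator (by fun_prop) measurableSet_Iio
    rw [ballVol, lintegral_smul_measure, smul_eq_mul, ← lintegral_indicator measurableSet_unitBall,
      lintegral_congr h1, lintegral_inner_mul_radial e m hmeas]
    have h2 : ∫⁻ r in Set.Ioi (0 : ℝ), ENNReal.ofReal (r ^ (2 * (n + m) - 1)) *
        (Set.Iio (1 : ℝ)).indicator (fun r => ENNReal.ofReal ((1 - r ^ 2) ^ l)) r =
        ENNReal.ofReal ((n + m - 1).factorial * l.factorial / (2 * (n + m + l).factorial)) := by
      have e1 : 2 * (n + m) - 1 = 2 * (n + m - 1) + 1 := by omega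
      have e2 : n + m - 1 + l + 1 = n + m + l := by omega
      rw [e1, ← e2, ← lintegral_radial_beta, ← lintegral_indicator measurableSet_Ioi,
        ← lintegral_indicator measurableSet_Ioo]
      refine lintegral_congr fun r => ?_
      by_cases h0 : 0 < r <;> by_cases h3 : r < 1 <;> simp [Set.indicator, h0, h3]
    rw [h2]
    have h3 : ENNReal.ofReal ((n + m - 1).factorial * l.factorial / (2 * (n + m + l).factorial)) =
        ENNReal.ofReal ((n + m - 1).factorial / 2) * ENNReal.ofReal (l.factorial / (n + m + l).factorial) := by
      rw [← ENNReal.ofReal_mul (by positivity)]; congr 1; field_simp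
    have h4 : ENNReal.ofReal (m.factorial * l.factorial / (n + m + l).factorial) =
        ENNReal.ofReal m.factorial * ENNReal.ofReal (l.factorial / (n + m + l).factorial) := by
      rw [← ENNReal.ofReal_mul (by positivity)]; congr 1; field_simp
    rw [h3, h4, ← mul_assoc, ← mul_assoc, ← mul_assoc, mul_assoc v⁻¹ κ, hG m, mul_assoc v⁻¹]
  -- The case `m = l = 0` is the total mass, which is one; it fixes the unknown constant as `v⁻¹ κ =
  -- n!`.
  have h0 : v⁻¹ * κ * ENNReal.ofReal (1 / n.factorial) = 1 := by
    have := hB 0 0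
    simpa using this.symm
  have hk : v⁻¹ * κ = ENNReal.ofReal n.factorial := by
    have h5 : ENNReal.ofReal (1 / n.factorial) * ENNReal.ofReal n.factorial = 1 := by
      rw [← ENNReal.ofReal_mul (by positivity), one_div_mul_cancel (by positivity), ENNReal.ofReal_one]
    calc v⁻¹ * κ = v⁻¹ * κ * (ENNReal.ofReal (1 / n.factorial) * ENNReal.ofReal n.factorial) := by
          rw [h5, mul_one]
      _ = _ := by rw [← mul_assoc, h0, one_mul]
  rw [hB, hk, ← ENNReal.ofReal_mul (by positivity)]
  congr 1; ring

/-! ### Averages over the circle -/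

/-- Normalized Lebesgue measure on `(0, 2π]`. -/
def circ : Measure ℝ := (ENNReal.ofReal (2 * Real.pi))⁻¹ • volume.restrict (Set.Ioc 0 (2 * Real.pi))

/-- The point of the unit circle with the given argument. -/
def expI (t : ℝ) : ℂ := Complex.exp (t * Complex.I)

lemma norm_expI (t : ℝ) : ‖expI t‖ = 1 := Complex.norm_exp_ofReal_mul_I t

@[fun_prop] lemma continuous_expI : Continuous expI := by unfold expI; fun_prop

@[fun_prop] lemma measurable_expI : Measurable expI := continuous_expI.measurable

lemma expI_ne_zero (t : ℝ) : expI t ≠ 0 := Complex.exp_ne_zero _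

lemma conj_expI (t : ℝ) : conj (expI t) = (expI t)⁻¹ := by
  rw [Complex.inv_def, Complex.normSq_eq_norm_sq, norm_expI]; simp

instance : IsProbabilityMeasure circ := by
  constructor
  have h : 0 < 2 * Real.pi := by positivity
  simp only [circ, Measure.smul_apply, Measure.restrict_apply MeasurableSet.univ, Set.univ_inter,
    smul_eq_mul, Real.volume_Ioc, sub_zero]
  exact ENNReal.inv_mul_cancel (by simpa using h) ENNReal.ofReal_ne_top

lemma integral_circ (f : ℝ → ℂ) :
    ∫ t, f t ∂circ = (2 * Real.pi : ℝ)⁻¹ • ∫ t in (0 : ℝ)..2 * Real.pi, f t := by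
  rw [circ, integral_smul_measure, intervalIntegral.integral_of_le (by positivity), ENNReal.toReal_inv,
    ENNReal.toReal_ofReal (by positivity)]

lemma integral_circ_zpow (k : ℤ) : ∫ t, expI t ^ k ∂circ = if k = 0 then 1 else 0 := by
  split_ifs with hk
  · subst hk; simp
  · rw [integral_circ]
    have hc : (k : ℂ) * Complex.I ≠ 0 := mul_ne_zero (by exact_mod_cast hk) Complex.I_ne_zero
    have e : ∀ t : ℝ, expI t ^ k = Complex.exp ((k : ℂ) * Complex.I * t) := by
      intro t
      rw [expI, ← Complex.exp_int_mul]; congr 1; ring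
    simp_rw [e]
    rw [integral_exp_mul_complex hc]
    have : Complex.exp ((k : ℂ) * Complex.I * ((2 * Real.pi : ℝ) : ℂ)) = 1 := by
      rw [← Complex.exp_int_mul_two_pi_mul_I k]; congr 1; push_cast; ring
    rw [this]; simp

lemma integral_circ_of_differentiableOn {f : ℂ → ℂ} (hf : DifferentiableOn ℂ f (Metric.closedBall 0 1)) :
    ∫ t, f (expI t) ∂circ = f 0 := by
  have h1 : DiffContOnCl ℂ f (Metric.ball 0 |1|) := by
    apply DifferentiableOn.diffContOnCl
    rw [abs_one, closure_ball _ one_ne_zero]; exact hf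
  rw [← h1.circleAverage, integral_circ, Real.circleAverage_def]
  simp [circleMap, expI]

lemma integral_circ_tsum_mul {c : ℕ → ℂ} (hc : Summable fun j => ‖c j‖) (m : ℕ) :
    ∫ t, (∑' j, c j * expI t ^ j) * conj (expI t) ^ m ∂circ = c m := by
  have h := hasSum_integral_of_summable_integral_norm (μ := circ)
    (F := fun j t => c j * expI t ^ j * conj (expI t) ^ m) (fun j => ?_) ?_
  · have h2 : ∀ t, ∑' j, c j * expI t ^ j * conj (expI t) ^ m =
        (∑' j, c j * expI t ^ j) * conj (expI t) ^ m := fun t => tsum_mul_right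
    simp_rw [h2] at h
    have h3 : ∀ j, ∫ t, c j * expI t ^ j * conj (expI t) ^ m ∂circ = if j = m then c m else 0 := by
      intro j
      have : ∀ t, c j * expI t ^ j * conj (expI t) ^ m = c j * expI t ^ ((j : ℤ) - m) := by
        intro t
        rw [conj_expI, zpow_sub₀ (expI_ne_zero t), zpow_natCast, zpow_natCast, inv_pow, mul_assoc]; rfl
      simp_rw [this]
      rw [integral_const_mul, integral_circ_zpow]
      by_cases hj : j = m
      · subst hj; simp
      · simp [sub_eq_zero, hj]
    simp_rw [h3] at h
    exact h.unique (hasSum_ite_eq m (c m))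
  · have hcont : Continuous fun t => c j * expI t ^ j * conj (expI t) ^ m := by fun_prop
    refine Integrable.of_bound hcont.aestronglyMeasurable (‖c j‖) (Filter.Eventually.of_forall fun t => ?_)
    simp [norm_expI]
  · refine hc.congr fun j => ?_
    simp [norm_expI]

lemma norm_aniso_sq {e : Cn n} (he : ‖e‖ = 1) (a b : ℂ) (w : Cn n) :
    ‖aniso e a b w‖ ^ 2 = ‖a‖ ^ 2 * ‖inner ℂ e w‖ ^ 2 + ‖b‖ ^ 2 * (‖w‖ ^ 2 - ‖inner ℂ e w‖ ^ 2) := by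
  have hee : inner ℂ e e = (1 : ℂ) := by rw [inner_self_eq_norm_sq_to_K, he]; simp
  have h1 : aniso e a b w = (a * inner ℂ e w) • e + b • (w - (inner ℂ e w : ℂ) • e) := by
    rw [aniso_apply]; module
  have h2 : inner ℂ ((a * inner ℂ e w) • e) (b • (w - (inner ℂ e w : ℂ) • e)) = 0 := by
    rw [inner_smul_left, inner_smul_right, inner_sub_right, inner_smul_right, hee]; simp
  have h3 := norm_add_sq (𝕜 := ℂ) ((a * inner ℂ e w) • e) (b • (w - (inner ℂ e w : ℂ) • e))
  rw [h2] at h3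
  rw [h1, h3, norm_smul, norm_smul, mul_pow, mul_pow, norm_sub_inner_smul_sq he, he, norm_mul]
  simp
  ring

lemma inner_aniso {e : Cn n} (he : ‖e‖ = 1) (a b : ℂ) (w : Cn n) :
    inner ℂ e (aniso e a b w) = a * inner ℂ e w := by
  have hee : inner ℂ e e = (1 : ℂ) := by rw [inner_self_eq_norm_sq_to_K, he]; simp
  rw [aniso_apply, inner_add_right, inner_smul_right, inner_smul_right, hee]; ring

lemma norm_aniso_of_norm_one {e : Cn n} (he : ‖e‖ = 1) {a b : ℂ} (ha : ‖a‖ = 1) (hb : ‖b‖ = 1) (w : Cn n) :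
    ‖aniso e a b w‖ = ‖w‖ := by
  have h := norm_aniso_sq he a b w
  rw [ha, hb] at h
  exact (sq_eq_sq₀ (norm_nonneg _) (norm_nonneg _)).1 (by rw [h]; ring)

lemma measurePreserving_aniso {e : Cn n} (he : ‖e‖ = 1) {a b : ℂ} (ha : ‖a‖ = 1) (hb : ‖b‖ = 1) :
    MeasurePreserving (aniso e a b) (ballVol n) (ballVol n) :=
  measurePreserving_ballVol (LinearIsometry.toLinearIsometryEquiv
    ⟨aniso e a b, norm_aniso_of_norm_one he ha hb⟩ rfl)

lemma measurePreserving_smul [NeZero n] {a : ℂ} (ha : ‖a‖ = 1) :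
    MeasurePreserving (fun w : Cn n => a • w) (ballVol n) (ballVol n) := by
  obtain ⟨e, he, -⟩ := exists_unit_smul (0 : Cn n)
  convert measurePreserving_aniso he ha ha using 1
  ext w : 1
  rw [aniso_apply]; simp

/-- Averaging over a circle of measure preserving maps. -/
lemma integral_eq_integral_circ {F : Cn n → ℂ} (hF : Measurable F) (hI : Integrable F (ballVol n))
    {A : ℂ → Cn n → Cn n} (hA : Measurable (Function.uncurry A))
    (hmp : ∀ ζ : ℂ, ‖ζ‖ = 1 → MeasurePreserving (A ζ) (ballVol n) (ballVol n)) :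
    Integrable (fun w => ∫ t, F (A (expI t) w) ∂circ) (ballVol n) ∧
    ∫ w, F w ∂(ballVol n) = ∫ w, ∫ t, F (A (expI t) w) ∂circ ∂(ballVol n) := by
  have hmeas : Measurable (Function.uncurry fun (t : ℝ) (w : Cn n) => F (A (expI t) w)) := by
    have h2 : Measurable fun p : ℝ × Cn n => (expI p.1, p.2) := by fun_prop
    exact hF.comp (hA.comp h2)
  have hint : Integrable (Function.uncurry fun (t : ℝ) (w : Cn n) => F (A (expI t) w))
      (circ.prod (ballVol n)) := by
    rw [integrable_prod_iff hmeas.aestronglyMeasurable]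
    refine ⟨Filter.Eventually.of_forall fun t => (hmp _ (norm_expI t)).integrable_comp_of_integrable hI, ?_⟩
    have : ∀ t, ∫ w, ‖Function.uncurry (fun (t : ℝ) (w : Cn n) => F (A (expI t) w)) (t, w)‖ ∂(ballVol n) =
        ∫ w, ‖F w‖ ∂(ballVol n) := by
      intro t
      have hm := hmp _ (norm_expI t)
      conv_rhs => rw [← hm.map_eq]
      rw [integral_map hm.measurable.aemeasurable hF.norm.aestronglyMeasurable]
      rfl
    simp_rw [this]
    exact integrable_const _
  refine ⟨hint.integral_prod_right, ?_⟩
  rw [← integral_integral_swap hint]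
  have : ∀ t, ∫ w, F (A (expI t) w) ∂(ballVol n) = ∫ w, F w ∂(ballVol n) := by
    intro t
    have hm := hmp _ (norm_expI t)
    conv_rhs => rw [← hm.map_eq]
    rw [integral_map hm.measurable.aemeasurable hF.aestronglyMeasurable]
  simp_rw [this]
  simp

lemma lintegral_eq_lintegral_circ {F : Cn n → ℝ≥0∞} (hF : Measurable F)
    {A : ℂ → Cn n → Cn n} (hA : Measurable (Function.uncurry A))
    (hmp : ∀ ζ : ℂ, ‖ζ‖ = 1 → MeasurePreserving (A ζ) (ballVol n) (ballVol n)) :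
    ∫⁻ w, F w ∂(ballVol n) = ∫⁻ w, ∫⁻ t, F (A (expI t) w) ∂circ ∂(ballVol n) := by
  have hmeas : Measurable (Function.uncurry fun (t : ℝ) (w : Cn n) => F (A (expI t) w)) := by
    have h2 : Measurable fun p : ℝ × Cn n => (expI p.1, p.2) := by fun_prop
    exact hF.comp (hA.comp h2)
  rw [← lintegral_lintegral_swap hmeas.aemeasurable]
  have : ∀ t, ∫⁻ w, F (A (expI t) w) ∂(ballVol n) = ∫⁻ w, F w ∂(ballVol n) := by
    intro t
    exact (hmp _ (norm_expI t)).lintegral_comp hF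
  simp_rw [this]
  simp

/-! ### Slices of holomorphic functions and the reproducing formula -/

/-- Holomorphy says nothing about values outside the ball. Extension by zero gives a Borel function,
to which Tonelli and changes of variables apply. -/
lemma measurable_indicator_of_isHolo {g : Cn n → ℂ} (hg : IsHolo g) :
    Measurable ((unitBall n).indicator g) := by
  classical
  rw [← Set.piecewise_eq_indicator]
  exact ContinuousOn.measurable_piecewise hg.continuousOn continuousOn_const measurableSet_unitBall

lemma aestronglyMeasurable_of_isHolo {g : Cn n → ℂ} (hg : IsHolo g) :
    AEStronglyMeasurable g (ballVol n) := by
  refine ⟨(unitBall n).indicator g, (measurable_indicator_of_isHolo hg).stronglyMeasurable, ?_⟩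
  filter_upwards [ae_mem_unitBall n] with w hw
  rw [Set.indicator_of_mem hw]

/-- Taylor coefficients of the restriction of `g` to the complex line through `e`. -/
def sliceCoeff (g : Cn n → ℂ) (e : Cn n) (m : ℕ) : ℂ :=
  (m.factorial : ℂ)⁻¹ * iteratedDeriv m (fun t : ℂ => g (t • e)) 0

lemma differentiableOn_slice {g : Cn n → ℂ} (hg : IsHolo g) {e : Cn n} (he : ‖e‖ = 1) :
    DifferentiableOn ℂ (fun t : ℂ => g (t • e)) (Metric.ball 0 1) := by
  refine DifferentiableOn.comp hg (by fun_prop) fun t ht => ?_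
  rw [mem_unitBall, norm_smul, he, mul_one]
  simpa using ht

lemma hasSum_sliceCoeff {g : Cn n → ℂ} (hg : IsHolo g) {e : Cn n} (he : ‖e‖ = 1) {t : ℂ} (ht : ‖t‖ < 1) :
    HasSum (fun m => sliceCoeff g e m * t ^ m) (g (t • e)) := by
  have h := Complex.hasSum_taylorSeries_on_ball (differentiableOn_slice hg he)
    (show t ∈ Metric.ball 0 1 by simpa using ht)
  refine (congrArg (HasSum · _) (funext fun m => ?_)).mpr h
  simp only [sliceCoeff, smul_eq_mul, sub_zero]; ring

lemma summable_sliceCoeff {g : Cn n → ℂ} (hg : IsHolo g) {e : Cn n} (he : ‖e‖ = 1) {t : ℂ} (ht : ‖t‖ < 1) :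
    Summable fun m => ‖sliceCoeff g e m * t ^ m‖ :=
  (hasSum_sliceCoeff hg he ht).summable.norm

lemma slice_expI_eq {g : Cn n → ℂ} (hg : IsHolo g) {e : Cn n} (he : ‖e‖ = 1) {x : ℂ} (hx : ‖x‖ < 1) (s : ℝ) :
    g ((expI s * x) • e) = ∑' j, sliceCoeff g e j * x ^ j * expI s ^ j := by
  rw [← (hasSum_sliceCoeff hg he (t := expI s * x) (by rwa [norm_mul, norm_expI, one_mul])).tsum_eq]
  congr 1 with j
  rw [mul_pow]; ring

/-- Weighted moments of a holomorphic function against powers of a linear form. -/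
lemma integral_holo_mul_conj_pow [NeZero n] {g : Cn n → ℂ} (hg : IsHolo g) {e : Cn n} (he : ‖e‖ = 1)
    (l m : ℕ) (hI : Integrable (fun w => g w * (((1 - ‖w‖ ^ 2) ^ l : ℝ) : ℂ)) (ballVol n)) :
    ∫ w, g w * conj (inner ℂ e w) ^ m * (((1 - ‖w‖ ^ 2) ^ l : ℝ) : ℂ) ∂(ballVol n) =
      sliceCoeff g e m *
        ((n.factorial * m.factorial * l.factorial / (n + m + l).factorial : ℝ) : ℂ) := by
  set G := (unitBall n).indicator g with hG
  have hGm : Measurable G := measurable_indicator_of_isHolo hg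
  have hGe : ∀ w, ‖w‖ < 1 → G w = g w := fun w hw => Set.indicator_of_mem (mem_unitBall.2 hw) _
  have hx1 : ∀ w : Cn n, ‖inner ℂ e w‖ ≤ ‖w‖ := fun w => by
    have := norm_inner_le_norm (𝕜 := ℂ) e w
    rwa [he, one_mul] at this
  set F : Cn n → ℂ := fun w => G w * conj (inner ℂ e w) ^ m * (((1 - ‖w‖ ^ 2) ^ l : ℝ) : ℂ) with hF
  have hFm : Measurable F := by
    refine (hGm.mul ?_).mul ?_
    · exact Continuous.measurable (by fun_prop)
    · exact Continuous.measurable (by fun_prop)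
  have hFI : Integrable F (ballVol n) := by
    refine Integrable.mono hI hFm.aestronglyMeasurable ?_
    filter_upwards [ae_mem_unitBall n] with w hw
    have hw' := mem_unitBall.1 hw
    rw [hF]
    simp only [hGe w hw', norm_mul, norm_pow, RCLike.norm_conj]
    have : ‖inner ℂ e w‖ ^ m ≤ 1 := pow_le_one₀ (norm_nonneg _) ((hx1 w).trans hw'.le)
    calc ‖g w‖ * ‖inner ℂ e w‖ ^ m * _ ≤ ‖g w‖ * 1 * _ := by gcongr
      _ = _ := by rw [mul_one]
  -- average in the directions orthogonal to `e`
  have hA1 : Measurable (Function.uncurry fun (ζ : ℂ) (w : Cn n) => aniso e 1 ζ w) := by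
    have : (Function.uncurry fun (ζ : ℂ) (w : Cn n) => aniso e 1 ζ w) =
        fun p : ℂ × Cn n => p.1 • p.2 + ((1 - p.1) * inner ℂ e p.2) • e := by
      ext p : 1; simp [Function.uncurry, aniso_apply]
    rw [this]; exact Continuous.measurable (by fun_prop)
  obtain ⟨hI1, hE1⟩ := integral_eq_integral_circ hFm hFI hA1
    (fun ζ hζ => measurePreserving_aniso he norm_one hζ)
  set F2 : Cn n → ℂ := fun w => G ((inner ℂ e w : ℂ) • e) * conj (inner ℂ e w) ^ m *
    (((1 - ‖w‖ ^ 2) ^ l : ℝ) : ℂ) with hF2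
  -- Rotating only the component orthogonal to `e` leaves `|w|` and `⟨w, e⟩` unchanged. As a
  -- function of `ζ`, `g` is holomorphic on the closed disc, so its circle mean is its value at `ζ =
  -- 0`, that is at `⟨w, e⟩ e`.
  have hav1 : ∀ᵐ w ∂(ballVol n), ∫ t, F (aniso e 1 (expI t) w) ∂circ = F2 w := by
    filter_upwards [ae_mem_unitBall n] with w hw
    have hw' := mem_unitBall.1 hw
    have h1 : ∀ t, F (aniso e 1 (expI t) w) = g (aniso e 1 (expI t) w) *
        (conj (inner ℂ e w) ^ m * (((1 - ‖w‖ ^ 2) ^ l : ℝ) : ℂ)) := by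
      intro t
      have hn := norm_aniso_of_norm_one he (a := 1) norm_one (norm_expI t) w
      simp only [hF]
      rw [hGe _ (by rw [hn]; exact hw'), hn, inner_aniso he, one_mul, mul_assoc]
    simp_rw [h1]
    rw [integral_mul_const]
    have hd : DifferentiableOn ℂ (fun ζ : ℂ => g (aniso e 1 ζ w)) (Metric.closedBall 0 1) := by
      refine DifferentiableOn.comp (t := unitBall n) hg ?_ fun ζ hζ => ?_
      · simp_rw [aniso_apply]; fun_prop
      · rw [mem_unitBall]
        have hζ' : ‖ζ‖ ≤ 1 := by simpa using hζ
        have h2 := norm_aniso_sq he 1 ζ w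
        have h3 : ‖ζ‖ ^ 2 ≤ 1 := pow_le_one₀ (norm_nonneg _) hζ'
        have h4 : 0 ≤ ‖w‖ ^ 2 - ‖inner ℂ e w‖ ^ 2 := by
          have := hx1 w
          have := norm_nonneg (inner ℂ e w)
          nlinarith
        rw [norm_one] at h2
        have h5 : ‖aniso e 1 ζ w‖ ^ 2 ≤ ‖w‖ ^ 2 := by nlinarith
        exact (abs_le_of_sq_le_sq' h5 (norm_nonneg _)).2.trans_lt hw'
    rw [integral_circ_of_differentiableOn hd]
    have h6 : aniso e 1 0 w = (inner ℂ e w : ℂ) • e := by rw [aniso_apply]; simp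
    simp only [hF2]
    rw [h6, hGe _ (by rw [norm_smul, he, mul_one]; exact (hx1 w).trans_lt hw'), mul_assoc]
  have hF2m : Measurable F2 := by
    refine (Measurable.mul (hGm.comp ?_) ?_).mul ?_
    · exact Continuous.measurable (by fun_prop)
    · exact Continuous.measurable (by fun_prop)
    · exact Continuous.measurable (by fun_prop)
  have hF2I : Integrable F2 (ballVol n) := hI1.congr hav1
  -- average over the circle action
  have hA2 : Measurable (Function.uncurry fun (ζ : ℂ) (w : Cn n) => ζ • w) :=
    Continuous.measurable (by fun_prop)
  obtain ⟨-, hE2⟩ := integral_eq_integral_circ hF2m hF2I hA2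
    (fun ζ hζ => measurePreserving_smul hζ)
  -- On the slice through `e`, orthogonality of characters selects the Taylor coefficient of degree
  -- `m`.
  have hav2 : ∀ᵐ w ∂(ballVol n), ∫ t, F2 (expI t • w) ∂circ =
      sliceCoeff g e m * ((‖inner ℂ e w‖ ^ (2 * m) * (1 - ‖w‖ ^ 2) ^ l : ℝ) : ℂ) := by
    filter_upwards [ae_mem_unitBall n] with w hw
    have hw' := mem_unitBall.1 hw
    have hxw : ‖inner ℂ e w‖ < 1 := (hx1 w).trans_lt hw'
    have h1 : ∀ t, F2 (expI t • w) = (∑' j, sliceCoeff g e j * inner ℂ e w ^ j * expI t ^ j) *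
        conj (expI t) ^ m * (conj (inner ℂ e w) ^ m * (((1 - ‖w‖ ^ 2) ^ l : ℝ) : ℂ)) := by
      intro t
      simp only [hF2, inner_smul_right, norm_smul, norm_expI, one_mul]
      rw [hGe _ (by rw [norm_smul, norm_mul, norm_expI, he, one_mul, mul_one]; exact hxw),
        slice_expI_eq hg he hxw, map_mul, mul_pow]
      ring
    simp_rw [h1]
    rw [integral_mul_const, integral_circ_tsum_mul (by
      simpa using summable_sliceCoeff hg he hxw)]
    have h2 : (inner ℂ e w : ℂ) ^ m * conj (inner ℂ e w : ℂ) ^ m = ((‖inner ℂ e w‖ ^ (2 * m) : ℝ) : ℂ) := by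
      rw [← mul_pow, RCLike.mul_conj, pow_mul]; push_cast; rfl
    rw [Complex.ofReal_mul, ← h2]; ring
  have hL : ∫ w, g w * conj (inner ℂ e w) ^ m * (((1 - ‖w‖ ^ 2) ^ l : ℝ) : ℂ) ∂(ballVol n) =
      ∫ w, F w ∂(ballVol n) := by
    refine integral_congr_ae ?_
    filter_upwards [ae_mem_unitBall n] with w hw
    simp only [hF]
    rw [hGe w (mem_unitBall.1 hw)]
  rw [hL, hE1, integral_congr_ae hav1, hE2, integral_congr_ae hav2, integral_const_mul,
    integral_complex_ofReal]
  congr 2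
  rw [integral_eq_lintegral_of_nonneg_ae, ← ENNReal.toReal_ofReal
    (show 0 ≤ (n.factorial * m.factorial * l.factorial / (n + m + l).factorial : ℝ) by positivity),
    ← lintegral_moment he m l]
  · congr 1
    refine lintegral_congr fun w => ?_
    rw [ENNReal.ofReal_mul (by positivity)]
  · filter_upwards [ae_mem_unitBall n] with w hw
    have := one_sub_norm_sq_pos (mem_unitBall.1 hw)
    simp only [Pi.zero_apply]
    positivity
  · exact (Continuous.measurable (by fun_prop)).aestronglyMeasurable

/-- The reproducing formula of the weighted Bergman space. -/
lemma integral_reproducing [NeZero n] {g : Cn n → ℂ} (hg : IsHolo g) (l : ℕ)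
    (hI : Integrable (fun w => g w * (((1 - ‖w‖ ^ 2) ^ l : ℝ) : ℂ)) (ballVol n)) {z : Cn n} (hz : ‖z‖ < 1) :
    ∫ w, g w * (((1 - ‖w‖ ^ 2) ^ l : ℝ) : ℂ) * (1 / (1 - inner ℂ w z) ^ (n + l + 1)) ∂(ballVol n) =
      ((n.factorial * l.factorial / (n + l).factorial : ℝ) : ℂ) * g z := by
  obtain ⟨e, he, hze⟩ := exists_unit_smul z
  set ρ := ‖z‖ with hρ
  have hρ0 : 0 ≤ ρ := norm_nonneg z
  have hin : ∀ w : Cn n, inner ℂ w z = (ρ : ℂ) * conj (inner ℂ e w) := by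
    intro w
    conv_lhs => rw [hze]
    rw [inner_smul_right, inner_conj_symm]
  have hx1 : ∀ w : Cn n, ‖inner ℂ e w‖ ≤ ‖w‖ := fun w => by
    have := norm_inner_le_norm (𝕜 := ℂ) e w
    rwa [he, one_mul] at this
  have hsum : Summable fun m : ℕ => ((m + (n + l)).choose (n + l) : ℝ) * ρ ^ m :=
    summable_choose_mul_geometric_of_norm_lt_one (n + l) (by rwa [Real.norm_of_nonneg hρ0])
  -- The terms of the binomial series of `(1 - ⟨z, w⟩)^(-(n+l+1))`, with `z = ρ e`. The binomial
  -- coefficient times the moment `n! m! l! / (n+m+l)!` equals `n! l! / (n+l)!` for every `m`, so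
  -- the Taylor series of `g` on the slice is recovered.
  set T : ℕ → Cn n → ℂ := fun m w => (((m + (n + l)).choose (n + l) : ℂ) * (ρ : ℂ) ^ m) *
    (g w * conj (inner ℂ e w) ^ m * (((1 - ‖w‖ ^ 2) ^ l : ℝ) : ℂ)) with hT
  have hTn : ∀ m, ∀ᵐ w ∂(ballVol n), ‖T m w‖ ≤ ((m + (n + l)).choose (n + l) : ℝ) * ρ ^ m *
      ‖g w * (((1 - ‖w‖ ^ 2) ^ l : ℝ) : ℂ)‖ := by
    intro m
    filter_upwards [ae_mem_unitBall n] with w hw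
    have hw' := mem_unitBall.1 hw
    simp only [hT, norm_mul, norm_pow, RCLike.norm_conj, Complex.norm_natCast]
    rw [Complex.norm_real, Real.norm_of_nonneg hρ0]
    have : ‖inner ℂ e w‖ ^ m ≤ 1 := pow_le_one₀ (norm_nonneg _) ((hx1 w).trans hw'.le)
    gcongr
    exact mul_le_of_le_one_right (norm_nonneg _) this
  have hTm : ∀ m, AEStronglyMeasurable (T m) (ballVol n) := by
    intro m
    refine AEStronglyMeasurable.const_mul ?_ _
    refine ((aestronglyMeasurable_of_isHolo hg).mul ?_).mul ?_
    · exact (Continuous.measurable (by fun_prop)).aestronglyMeasurable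
    · exact (Continuous.measurable (by fun_prop)).aestronglyMeasurable
  have hTI : ∀ m, Integrable (T m) (ballVol n) := fun m =>
    Integrable.mono' (hI.norm.const_mul _) (hTm m) (hTn m)
  have hS := hasSum_integral_of_summable_integral_norm hTI (by
    refine Summable.of_nonneg_of_le (fun m => integral_nonneg fun w => norm_nonneg _) (fun m => ?_)
      (hsum.mul_right (∫ w, ‖g w * (((1 - ‖w‖ ^ 2) ^ l : ℝ) : ℂ)‖ ∂(ballVol n)))
    rw [← integral_const_mul]
    exact integral_mono_ae (hTI m).norm (hI.norm.const_mul _) (hTn m))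
  have hL : ∫ w, ∑' m, T m w ∂(ballVol n) =
      ∫ w, g w * (((1 - ‖w‖ ^ 2) ^ l : ℝ) : ℂ) * (1 / (1 - inner ℂ w z) ^ (n + l + 1)) ∂(ballVol n) := by
    refine integral_congr_ae ?_
    filter_upwards [ae_mem_unitBall n] with w hw
    have hw' := mem_unitBall.1 hw
    have h := hasSum_choose_mul_geometric_of_norm_lt_one (n + l) (r := (inner ℂ w z : ℂ))
      (norm_inner_lt_one hz hw')
    rw [← (h.mul_left (g w * (((1 - ‖w‖ ^ 2) ^ l : ℝ) : ℂ))).tsum_eq]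
    congr 1 with m
    rw [hin, mul_pow]
    simp only [hT]; ring
  rw [hL] at hS
  refine hS.unique ?_
  have hS2 := (hasSum_sliceCoeff hg he (t := (ρ : ℂ)) (by
    rwa [Complex.norm_real, Real.norm_of_nonneg hρ0])).mul_left
      ((n.factorial * l.factorial / (n + l).factorial : ℝ) : ℂ)
  rw [← hze] at hS2
  refine (congrArg (HasSum · _) (funext fun m => ?_)).mpr hS2
  simp only [hT]
  rw [integral_const_mul, integral_holo_mul_conj_pow hg he l m hI]
  have hc : ((m + (n + l)).choose (n + l) : ℂ) = ((m + (n + l)).factorial : ℂ) /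
      ((n + l).factorial * m.factorial) := by
    rw [Nat.cast_choose ℂ (Nat.le_add_left _ _), Nat.add_sub_cancel]
  have e1 : n + m + l = m + (n + l) := by ring
  rw [hc, e1]
  push_cast
  have h1 : ((m + (n + l)).factorial : ℂ) ≠ 0 := by exact_mod_cast Nat.factorial_ne_zero _
  have h2 : ((n + l).factorial : ℂ) ≠ 0 := by exact_mod_cast Nat.factorial_ne_zero _
  have h3 : (m.factorial : ℂ) ≠ 0 := by exact_mod_cast Nat.factorial_ne_zero _
  field_simp

/-! ### Parseval and the weighted norm of a function vanishing at the origin -/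

/-- Parseval's identity for absolutely convergent Fourier series. -/
lemma lintegral_circ_parseval {c : ℕ → ℂ} (hc : Summable fun j => ‖c j‖) :
    ∫⁻ t, ‖∑' j, c j * expI t ^ j‖ₑ ^ 2 ∂circ = ∑' j, ENNReal.ofReal (‖c j‖ ^ 2) := by
  set f : ℝ → ℂ := fun t => ∑' j, c j * expI t ^ j with hf
  have hsum : ∀ t, Summable fun j => ‖c j * expI t ^ j‖ := fun t => by simpa [norm_expI] using hc
  have hfc : Continuous f := by
    refine continuous_tsum (u := fun j => ‖c j‖) (fun j => by fun_prop) hc fun j t => ?_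
    simp [norm_expI]
  have hfn : ∀ t, ‖f t‖ ≤ ∑' j, ‖c j‖ := fun t => by
    refine (norm_tsum_le_tsum_norm (hsum t)).trans (le_of_eq ?_)
    simp [norm_expI]
  have h := hasSum_integral_of_summable_integral_norm (μ := circ)
    (F := fun j t => conj (c j) * (f t * conj (expI t) ^ j)) (fun j => ?_) ?_
  · have h2 : ∀ t, ∑' j, conj (c j) * (f t * conj (expI t) ^ j) = ((‖f t‖ ^ 2 : ℝ) : ℂ) := by
      intro t
      have : ∀ j, conj (c j) * (f t * conj (expI t) ^ j) = f t * conj (c j * expI t ^ j) := by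
        intro j; rw [map_mul, map_pow]; ring
      simp_rw [this]
      rw [tsum_mul_left, ← Complex.conj_tsum]
      change f t * conj (f t) = _
      rw [RCLike.mul_conj]; push_cast; rfl
    simp_rw [h2, integral_const_mul] at h
    have h3 : ∀ j, ∫ t, f t * conj (expI t) ^ j ∂circ = c j := fun j => integral_circ_tsum_mul hc j
    simp_rw [h3] at h
    have h4 : ∀ j, conj (c j) * c j = ((‖c j‖ ^ 2 : ℝ) : ℂ) := by
      intro j; rw [RCLike.conj_mul]; push_cast; rfl
    simp_rw [h4] at h
    rw [integral_complex_ofReal] at h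
    have h5 := (Complex.hasSum_ofReal).1 h
    rw [← ENNReal.ofReal_tsum_of_nonneg (fun j => by positivity) h5.summable, h5.tsum_eq,
      ofReal_integral_eq_lintegral_ofReal]
    · refine lintegral_congr fun t => ?_
      rw [ENNReal.ofReal_pow (norm_nonneg _), ofReal_norm]
    · refine Integrable.of_bound (Continuous.aestronglyMeasurable (by fun_prop)) ((∑' j, ‖c j‖) ^ 2)
        (Filter.Eventually.of_forall fun t => ?_)
      rw [Real.norm_of_nonneg (by positivity)]
      exact pow_le_pow_left₀ (norm_nonneg _) (hfn t) 2
    · exact Filter.Eventually.of_forall fun t => by positivity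
  · refine Integrable.of_bound (Continuous.aestronglyMeasurable (by fun_prop)) (‖c j‖ * ∑' j, ‖c j‖)
      (Filter.Eventually.of_forall fun t => ?_)
    simp only [norm_mul, RCLike.norm_conj, norm_pow, norm_expI, one_pow, mul_one]
    gcongr; exact hfn t
  · have : ∀ j, ∫ t, ‖conj (c j) * (f t * conj (expI t) ^ j)‖ ∂circ = ‖c j‖ * ∫ t, ‖f t‖ ∂circ := by
      intro j
      simp only [norm_mul, RCLike.norm_conj, norm_pow, norm_expI, one_pow, mul_one]
      rw [integral_const_mul]
    simp_rw [this]
    exact hc.mul_right _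

/-- Averaging over `w ↦ ζ w` removes the cross terms between different degrees, for any radial
weight. The exponent is `2n - 1` from the volume plus `2m` from the square of the degree `m` term.
-/
lemma lintegral_holo_sq_radial [NeZero n] {g : Cn n → ℂ} (hg : IsHolo g) {h : ℝ → ℝ≥0∞} (hh : Measurable h) :
    ∫⁻ z, ‖g z‖ₑ ^ 2 * h ‖z‖ ∂(ballVol n) = (volume (unitBall n))⁻¹ *
      ∫⁻ w : Metric.sphere (0 : Cn n) 1, (∑' m : ℕ, ENNReal.ofReal (‖sliceCoeff g w m‖ ^ 2) *
        ∫⁻ r in Set.Ioo (0 : ℝ) 1, ENNReal.ofReal (r ^ (2 * (n + m - 1) + 1)) * h r)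
        ∂(volume : Measure (Cn n)).toSphere := by
  set G := (unitBall n).indicator g with hG
  have hGm : Measurable G := measurable_indicator_of_isHolo hg
  have hGe : ∀ w, ‖w‖ < 1 → G w = g w := fun w hw => Set.indicator_of_mem (mem_unitBall.2 hw) _
  have h1 : ∫⁻ z, ‖g z‖ₑ ^ 2 * h ‖z‖ ∂(ballVol n) = ∫⁻ z, ‖G z‖ₑ ^ 2 * h ‖z‖ ∂(ballVol n) := by
    refine lintegral_congr_ae ?_
    filter_upwards [ae_mem_unitBall n] with w hw
    rw [hGe w (mem_unitBall.1 hw)]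
  have hA2 : Measurable (Function.uncurry fun (ζ : ℂ) (w : Cn n) => ζ • w) :=
    Continuous.measurable (by fun_prop)
  have hm0 : Measurable fun z : Cn n => ‖G z‖ₑ ^ 2 * h ‖z‖ := by fun_prop
  rw [h1, lintegral_eq_lintegral_circ hm0 hA2 (fun ζ hζ => measurePreserving_smul hζ)]
  have hm1 : Measurable fun w : Cn n => ∫⁻ t, ‖G (expI t • w)‖ₑ ^ 2 * h ‖expI t • w‖ ∂circ := by
    refine Measurable.lintegral_prod_right' (f := fun p : Cn n × ℝ => ‖G (expI p.2 • p.1)‖ₑ ^ 2 * h ‖expI p.2 • p.1‖) ?_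
    have hc : Measurable fun p : Cn n × ℝ => expI p.2 • p.1 := Continuous.measurable (by fun_prop)
    exact hm0.comp hc
  rw [lintegral_ballVol_polar _ hm1]
  congr 1
  refine lintegral_congr fun w => ?_
  have hw : ‖(w : Cn n)‖ = 1 := by simp
  have hn := NeZero.pos n
  calc _ = ∫⁻ r in Set.Ioo (0 : ℝ) 1, ∑' m : ℕ, ENNReal.ofReal (‖sliceCoeff g w m‖ ^ 2) *
        (ENNReal.ofReal (r ^ (2 * (n + m - 1) + 1)) * h r) := by
        refine setLIntegral_congr_fun measurableSet_Ioo fun r hr => ?_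
        have hr' : ‖(r : ℂ)‖ < 1 := by rw [Complex.norm_real, Real.norm_of_nonneg hr.1.le]; exact hr.2
        have e1 : ∀ t, ‖G (expI t • (r : ℂ) • (w : Cn n))‖ₑ ^ 2 * h ‖expI t • (r : ℂ) • (w : Cn n)‖ =
            ‖∑' j, sliceCoeff g w j * (r : ℂ) ^ j * expI t ^ j‖ₑ ^ 2 * h r := by
          intro t
          have hnorm : ‖expI t • (r : ℂ) • (w : Cn n)‖ = r := by
            rw [norm_smul, norm_smul, norm_expI, hw, one_mul, mul_one, Complex.norm_real,
              Real.norm_of_nonneg hr.1.le]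
          rw [hnorm, hGe _ (by rw [hnorm]; exact hr.2), smul_smul, slice_expI_eq hg hw hr']
        have hcm : Measurable fun t => ‖∑' j, sliceCoeff g w j * (r : ℂ) ^ j * expI t ^ j‖ₑ ^ 2 := by
          have : Continuous fun t => ∑' j, sliceCoeff g w j * (r : ℂ) ^ j * expI t ^ j := by
            refine continuous_tsum (u := fun j => ‖sliceCoeff g w j * (r : ℂ) ^ j‖) (fun j => by fun_prop)
              (summable_sliceCoeff hg hw hr') fun j t => ?_
            simp [norm_expI]
          exact (this.measurable.enorm).pow_const 2
        simp_rw [e1]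
        rw [lintegral_mul_const _ hcm, lintegral_circ_parseval (summable_sliceCoeff hg hw hr'),
          ← ENNReal.tsum_mul_right, ← ENNReal.tsum_mul_left]
        congr 1 with m
        have e2 : 2 * (n + m - 1) + 1 = (2 * n - 1) + 2 * m := by omega
        have hr0 := hr.1.le
        rw [norm_mul, mul_pow, norm_pow, Complex.norm_real, Real.norm_of_nonneg hr0, e2, pow_add,
          ENNReal.ofReal_mul (by positivity), ENNReal.ofReal_mul (by positivity), ← pow_mul, mul_comm m 2]
        ring
    _ = _ := by
        rw [lintegral_tsum (fun m => by fun_prop)]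
        congr 1 with m
        rw [lintegral_const_mul _ (by fun_prop)]

/-- A holomorphic function vanishing to order `M` at the origin has small weighted norm. -/
lemma lintegral_weighted_le [NeZero n] {g : Cn n → ℂ} (hg : IsHolo g) {M : ℕ}
    (h0 : ∀ e : Cn n, ‖e‖ = 1 → ∀ m < M, sliceCoeff g e m = 0) :
    ∫⁻ z, ‖g z‖ₑ ^ 2 * ENNReal.ofReal (1 - ‖z‖ ^ 2) ∂(ballVol n) ≤
      ENNReal.ofReal (1 / (M + 1)) * ∫⁻ z, ‖g z‖ₑ ^ 2 ∂(ballVol n) := by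
  have h1 := lintegral_holo_sq_radial hg (h := fun r => ENNReal.ofReal (1 - r ^ 2)) (by fun_prop)
  have h2 := lintegral_holo_sq_radial hg (h := fun r => 1) (by fun_prop)
  simp only [mul_one] at h2
  rw [h1, h2, mul_left_comm]
  refine mul_le_mul_right ?_ _
  rw [← lintegral_const_mul' _ _ ENNReal.ofReal_ne_top]
  refine lintegral_mono fun w => ?_
  simp only
  rw [← ENNReal.tsum_mul_left]
  refine ENNReal.tsum_le_tsum fun m => ?_
  by_cases hm : m < M
  · rw [h0 w (by simp) m hm]; simp
  · push Not at hm
    rw [mul_left_comm]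
    refine mul_le_mul_right ?_ _
    -- In degree `m` the weight multiplies the radial integral by exactly `1 / (n + m + 1)`, which
    -- is at most `1 / (M + 1)` for `m ≥ M`.
    have e1 := lintegral_radial_beta (n + m - 1) 1
    have e0 := lintegral_radial_beta (n + m - 1) 0
    simp only [pow_one, pow_zero, ENNReal.ofReal_one, mul_one] at e1 e0
    rw [e1, e0, ← ENNReal.ofReal_mul (by positivity)]
    apply ENNReal.ofReal_le_ofReal
    have hn := NeZero.pos n
    obtain ⟨k, hk⟩ : ∃ k, n + m = k + 1 := ⟨n + m - 1, by omega⟩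
    have hkM : (M : ℝ) ≤ k := by exact_mod_cast (by omega : M ≤ k)
    have e2 : n + m - 1 = k := by omega
    rw [e2]
    have hf : (k.factorial : ℝ) ≠ 0 := by positivity
    simp only [Nat.add_zero, Nat.factorial_succ, Nat.factorial_zero]
    push_cast
    rw [div_mul_div_comm, div_le_div_iff₀ (by positivity) (by positivity)]
    have : 0 < (k.factorial : ℝ) := by positivity
    have hM0 : (0 : ℝ) ≤ M := by positivity
    have h3 : (k.factorial : ℝ) * 1 * ((M + 1) * (2 * ((k + 1) * k.factorial))) =
      (M + 1) * (2 * (k + 1) * (k.factorial : ℝ) ^ 2) := by ring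
    have h4 : 1 * ((k.factorial : ℝ) * 1) * (2 * ((k + 1 + 1) * ((k + 1) * k.factorial))) =
      (k + 1 + 1) * (2 * (k + 1) * (k.factorial : ℝ) ^ 2) := by ring
    nlinarith [show 0 ≤ 2 * (k + 1) * (k.factorial : ℝ) ^ 2 by positivity]

/-! ### Orthogonality to monomials forces vanishing at the origin -/

/-- The conjugate of a monomial. -/
def conjMonomial {M : ℕ} (α : Fin n → Fin M) (w : Cn n) : ℂ := ∏ k, conj (w k) ^ (α k : ℕ)

lemma continuous_conjProd (α : Fin n → ℕ) : Continuous fun w : Cn n => ∏ k, conj (w k) ^ α k := by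
  fun_prop

lemma norm_conjProd_le (α : Fin n → ℕ) {w : Cn n} (hw : ‖w‖ ≤ 1) : ‖∏ k, conj (w k) ^ α k‖ ≤ 1 := by
  rw [norm_prod]
  refine Finset.prod_le_one (fun _ _ => norm_nonneg _) fun k _ => ?_
  rw [norm_pow, RCLike.norm_conj]
  exact pow_le_one₀ (norm_nonneg _) ((PiLp.norm_apply_le w k).trans hw)

/-- The coefficient is a nonzero multiple of `∫ g · conj ⟨w, e⟩^m`, and `conj ⟨w, e⟩^m` is a
combination of conjugate monomials of total degree `m < M`, whose exponents are all below `M`. -/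
lemma sliceCoeff_eq_zero [NeZero n] {g : Cn n → ℂ} (hg : IsHolo g) (hI : Integrable g (ballVol n)) {M : ℕ}
    (h : ∀ α : Fin n → Fin M, ∫ w, g w * conjMonomial α w ∂(ballVol n) = 0) {e : Cn n} (he : ‖e‖ = 1)
    {m : ℕ} (hm : m < M) : sliceCoeff g e m = 0 := by
  have hmono : ∀ α : Fin n → ℕ, ∑ k, α k < M → ∫ w, g w * ∏ k, conj (w k) ^ α k ∂(ballVol n) = 0 := by
    intro α hα
    have hlt : ∀ k, α k < M := fun k =>
      (Finset.single_le_sum (f := α) (fun _ _ => Nat.zero_le _) (Finset.mem_univ k)).trans_lt hα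
    exact h fun k => ⟨α k, hlt k⟩
  have hin : ∀ w : Cn n, conj (inner ℂ e w) = ∑ k, e k * conj (w k) := by
    intro w
    rw [PiLp.inner_apply, map_sum]
    refine Finset.sum_congr rfl fun k _ => ?_
    simp [mul_comm]
  -- The factors `conj ⟨w, e⟩` are expanded one at a time, which raises one exponent of the
  -- monomial; the bound on total degree plus `j` is preserved.
  have key : ∀ j : ℕ, ∀ α : Fin n → ℕ, ∑ k, α k + j < M →
      ∫ w, g w * (∏ k, conj (w k) ^ α k) * conj (inner ℂ e w) ^ j ∂(ballVol n) = 0 := by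
    intro j
    induction j with
    | zero => intro α hα; simpa using hmono α hα
    | succ j ih =>
      intro α hα
      have h1 : ∀ w : Cn n, g w * (∏ k, conj (w k) ^ α k) * conj (inner ℂ e w) ^ (j + 1) =
          ∑ i, e i * (g w * (∏ k, conj (w k) ^ (α k + if k = i then 1 else 0)) * conj (inner ℂ e w) ^ j) := by
        intro w
        rw [pow_succ, ← mul_assoc, hin, Finset.mul_sum]
        refine Finset.sum_congr rfl fun i _ => ?_
        have : (∏ k, conj (w k) ^ (α k + if k = i then 1 else 0)) = (∏ k, conj (w k) ^ α k) * conj (w i) := by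
          simp only [pow_add, Finset.prod_mul_distrib]
          congr 1
          rw [Finset.prod_eq_single i]
          · simp
          · intro k _ hk; simp [hk]
          · simp
        rw [this]; ring
      simp_rw [h1]
      rw [integral_finsetSum]
      · refine Finset.sum_eq_zero fun i _ => ?_
        rw [integral_const_mul, ih, mul_zero]
        simp only [Finset.sum_add_distrib, Finset.sum_ite_eq', Finset.mem_univ, if_true]
        omega
      · intro i _
        refine Integrable.const_mul ?_ _
        refine Integrable.mono hI ?_ ?_
        · refine (hI.aestronglyMeasurable.mul (continuous_conjProd _).aestronglyMeasurable).mul ?_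
          exact Continuous.aestronglyMeasurable (by fun_prop)
        · filter_upwards [ae_mem_unitBall n] with w hw
          have hw' := (mem_unitBall.1 hw).le
          have h2 : ‖inner ℂ e w‖ ≤ 1 := by
            have := norm_inner_le_norm (𝕜 := ℂ) e w
            rw [he, one_mul] at this; linarith
          rw [norm_mul, norm_mul, norm_pow, RCLike.norm_conj]
          have h3 := norm_conjProd_le (fun k => α k + if k = i then 1 else 0) hw'
          have h4 : ‖inner ℂ e w‖ ^ j ≤ 1 := pow_le_one₀ (norm_nonneg _) h2
          calc _ ≤ ‖g w‖ * 1 * 1 := by gcongr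
            _ = ‖g w‖ := by ring
  have h5 := key m 0 (by simpa using hm)
  have h6 := integral_holo_mul_conj_pow hg he 0 m (by simpa using hI)
  simp only [Pi.zero_apply, pow_zero, Finset.prod_const_one, mul_one] at h5
  simp only [pow_zero, Complex.ofReal_one, mul_one] at h6
  rw [h5] at h6
  have h7 : ((n.factorial * m.factorial * (Nat.factorial 0) / (n + m + 0).factorial : ℝ) : ℂ) ≠ 0 := by
    exact_mod_cast (by positivity : (n.factorial * m.factorial * (Nat.factorial 0) / (n + m + 0).factorial : ℝ) ≠ 0)
  exact (mul_eq_zero.1 h6.symm).resolve_right h7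

/-! ### Consequences of the key inequality -/

/-- The constants in the key inequality may be increased. -/
lemma KeyInequality.mono {h : Cn n → ℂ} {C C' : ℝ} {N N' : ℕ} (hK : KeyInequality h C N) (hC0 : 0 ≤ C)
    (hC : C ≤ C') (hN : N ≤ N') : KeyInequality h (C' * 2 ^ N') N' := by
  intro z hz w hw f hf
  refine (hK z hz w hw f hf).trans ?_
  have hz' := mem_unitBall.1 hz
  have hw' := mem_unitBall.1 hw
  have h1 := one_sub_norm_sq_pos hw'
  have h2 := one_sub_norm_sq_le hz'.le hw'.le
  -- The ratio itself may be below `1`, its double may not; raising the exponent of the doubled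
  -- ratio is what costs `2^N'`.
  have h3 : 1 ≤ 2 * (‖1 - inner ℂ w z‖ / (1 - ‖w‖ ^ 2)) := by
    rw [mul_div_assoc', le_div_iff₀ h1]; linarith
  have hI : 0 ≤ ∫ x in bergmanDisc w 1, ‖h x * f x‖ ∂(ballVol n) := integral_nonneg fun _ => norm_nonneg _
  refine mul_le_mul_of_nonneg_right ?_ hI
  have e : ∀ k : ℕ, ‖1 - inner ℂ w z‖ ^ k / (1 - ‖w‖ ^ 2) ^ (n + 1 + k) =
      (‖1 - inner ℂ w z‖ / (1 - ‖w‖ ^ 2)) ^ k / (1 - ‖w‖ ^ 2) ^ (n + 1) := by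
    intro k; rw [div_pow, pow_add]; field_simp
  rw [e, e, mul_div_assoc', mul_div_assoc']
  refine div_le_div_of_nonneg_right ?_ (by positivity)
  set x := ‖1 - inner ℂ w z‖ / (1 - ‖w‖ ^ 2)
  have hx : 0 ≤ x := by positivity
  have hC' : 0 ≤ C' := hC0.trans hC
  have hx2 : x ≤ 2 * x := by linarith
  calc C * x ^ N ≤ C' * (2 * x) ^ N :=
        mul_le_mul hC (pow_le_pow_left₀ hx hx2 _) (by positivity) hC'
    _ ≤ C' * (2 * x) ^ N' := mul_le_mul_of_nonneg_left (pow_le_pow_right₀ h3 hN) hC'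
    _ = C' * 2 ^ N' * x ^ N' := by rw [mul_pow]; ring

/-- Division controls the product `h g` and not `g`. At a single point `z₀` where `h` does not
vanish, the key inequality gives `|g(w)| = O((1 - |w|²)^(-(n+1+N)))`, so the weight makes `g`
bounded. -/
lemma integrable_weight_of_keyInequality {h g : Cn n → ℂ} {C : ℝ} {N : ℕ} (hC : 0 ≤ C)
    (hK : KeyInequality h C N) (hg : IsHolo g) (hhg : Integrable (fun z => h z * g z) (ballVol n))
    {z₀ : Cn n} (hz₀ : z₀ ∈ unitBall n) (h0 : h z₀ ≠ 0) {l : ℕ} (hl : n + 1 + N ≤ l) :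
    Integrable (fun w => g w * (((1 - ‖w‖ ^ 2) ^ l : ℝ) : ℂ)) (ballVol n) := by
  set I := ∫ z, ‖h z * g z‖ ∂(ballVol n)
  have hI : 0 ≤ I := integral_nonneg fun _ => norm_nonneg _
  refine Integrable.of_bound ?_ (C * 2 ^ N * I / ‖h z₀‖) ?_
  · exact (aestronglyMeasurable_of_isHolo hg).mul (Continuous.aestronglyMeasurable (by fun_prop))
  filter_upwards [ae_mem_unitBall n] with w hw
  have hw' := mem_unitBall.1 hw
  have h1 := one_sub_norm_sq_pos hw'
  have hpos : 0 < ‖h z₀‖ := norm_pos_iff.2 h0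
  have h2 := hK z₀ hz₀ w hw g hg
  have h3 : ∫ x in bergmanDisc w 1, ‖h x * g x‖ ∂(ballVol n) ≤ I :=
    setIntegral_le_integral hhg.norm (Filter.Eventually.of_forall fun _ => norm_nonneg _)
  have h4 : ‖1 - inner ℂ w z₀‖ ≤ 2 := by
    refine (norm_sub_le _ _).trans ?_
    have := norm_inner_lt_one (mem_unitBall.1 hz₀) hw'
    rw [norm_one]; linarith
  rw [norm_mul, Complex.norm_real, Real.norm_of_nonneg (by positivity), le_div_iff₀ hpos]
  rw [norm_mul] at h2
  have h5 : (1 - ‖w‖ ^ 2) ^ l ≤ (1 - ‖w‖ ^ 2) ^ (n + 1 + N) :=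
    pow_le_pow_of_le_one h1.le (by nlinarith [norm_nonneg w]) hl
  have h6 : ‖1 - inner ℂ w z₀‖ ^ N ≤ 2 ^ N := by gcongr
  calc ‖g w‖ * (1 - ‖w‖ ^ 2) ^ l * ‖h z₀‖ = (‖h z₀‖ * ‖g w‖) * (1 - ‖w‖ ^ 2) ^ l := by ring
    _ ≤ (C * (‖1 - inner ℂ w z₀‖ ^ N / (1 - ‖w‖ ^ 2) ^ (n + 1 + N)) * I) * (1 - ‖w‖ ^ 2) ^ (n + 1 + N) :=
        mul_le_mul (h2.trans (mul_le_mul_of_nonneg_left h3 (by positivity))) h5 (by positivity) (by positivity)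
    _ = C * ‖1 - inner ℂ w z₀‖ ^ N * I := by field_simp
    _ ≤ C * 2 ^ N * I := by gcongr

/-- The relation `l ∈ D(w, 1)` as a measurable set of pairs. -/
def discRel (n : ℕ) : Set (Cn n × Cn n) := {p | ‖p.1‖ < 1 ∧ ‖p.2‖ < 1 ∧
      kap * ‖1 - inner ℂ p.1 p.2‖ ^ 2 < (1 - ‖p.1‖ ^ 2) * (1 - ‖p.2‖ ^ 2)}

lemma mem_discRel {w l : Cn n} (hw : ‖w‖ < 1) : (w, l) ∈ discRel n ↔ l ∈ bergmanDisc w 1 := by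
  rw [mem_bergmanDisc_iff hw]
  exact ⟨fun h => h.2, fun h => ⟨hw, h⟩⟩

lemma measurableSet_discRel : MeasurableSet (discRel n) := measurableSet_bergmanDisc_prod

lemma measurableSet_bergmanDisc {w : Cn n} (hw : ‖w‖ < 1) : MeasurableSet (bergmanDisc w 1) := by
  have : bergmanDisc w 1 = Prod.mk w ⁻¹' discRel n := by
    ext l; exact (mem_discRel hw).symm
  rw [this]
  exact measurable_prodMk_left measurableSet_discRel

/-- By symmetry of the relation, the set lies in the nonisotropic ball at `l` of radius comparable
to `1 - |l|²`. The constant `3` instead of `2` makes the inequality strict. -/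
lemma ballVol_bergmanDisc_le [NeZero n] {l : Cn n} (hl : ‖l‖ < 1) :
    ballVol n {w | (w, l) ∈ discRel n} ≤
      ENNReal.ofReal (36 ^ (n + 1) * (3 / kap * (1 - ‖l‖ ^ 2)) ^ (n + 1)) := by
  have hk := kap_pos
  have h1 := one_sub_norm_sq_pos hl
  refine (measure_mono ?_).trans (ballVol_nonisotropic_le hl (t := 3 / kap * (1 - ‖l‖ ^ 2)) (by positivity))
  rintro w hw
  have hwn : ‖w‖ < 1 := hw.1
  have h2 : w ∈ bergmanDisc l 1 := (mem_bergmanDisc_comm hwn hl).1 ((mem_discRel hwn).1 hw)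
  refine ⟨hwn, ?_⟩
  have h3 := bergmanDisc_norm_le hl h2
  rw [div_mul_eq_mul_div, lt_div_iff₀ hk]
  linarith

/-- The constant in `lintegral_kernel_mul_le`. -/
def kernelConst (n : ℕ) (C κ : ℝ) : ℝ :=
  C * ((4 / kap) * (18 / kap) ^ (2 * n + 3 - κ) * (36 ^ (n + 1) * (3 / kap) ^ (n + 1) * 2 ^ (n + 1)))

/-- Consequence of the key inequality: the values `h(z) g(w)` off the diagonal, integrated against a
Bergman type kernel, are controlled by the diagonal values. -/
lemma lintegral_kernel_mul_le [NeZero n] {h g : Cn n → ℂ} {C : ℝ} {N : ℕ} (hC : 0 ≤ C)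
    (hK : KeyInequality h C N) (hg : IsHolo g) {W : Cn n → ℝ≥0∞} (hW : Measurable W)
    (hWe : ∀ w, ‖w‖ < 1 → W w = ‖h w * g w‖ₑ) {κ : ℝ} (hκ : κ ≤ 1) {z : Cn n} (hz : ‖z‖ < 1) :
    ∫⁻ w, ‖h z * g w‖ₑ * ENNReal.ofReal ((1 - ‖w‖ ^ 2) ^ (N + n + 2) *
        ‖1 - inner ℂ w z‖ ^ (-((n + (N + n + 2) + 1 : ℕ) - κ))) ∂(ballVol n) ≤
      ENNReal.ofReal (kernelConst n C κ) * ∫⁻ l, ENNReal.ofReal ((1 - ‖l‖ ^ 2) *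
        ‖1 - inner ℂ l z‖ ^ (-(n + 2 - κ))) * W l ∂(ballVol n) := by
  have hk := kap_pos
  have hn1 : (0 : ℝ) ≤ n := Nat.cast_nonneg n
  set q : ℝ := 2 * n + 3 - κ with hq
  have hq0 : 0 ≤ q := by rw [hq]; linarith
  -- The key inequality is inserted for each `w`. Its powers depending on `N` cancel against the
  -- weight of order `N + n + 2`, leaving `1 - |w|²` and the exponent `q`, which does not involve
  -- `N`.
  calc _ ≤ ∫⁻ w, ∫⁻ l, (discRel n).indicator (fun _ => 1) (w, l) *
        (ENNReal.ofReal (C * ((1 - ‖w‖ ^ 2) * ‖1 - inner ℂ w z‖ ^ (-q))) * W l) ∂(ballVol n) ∂(ballVol n) := by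
        refine lintegral_mono_ae ?_
        filter_upwards [ae_mem_unitBall n] with w hw
        have hw' := mem_unitBall.1 hw
        have h1 := one_sub_norm_sq_pos hw'
        have hp := norm_one_sub_inner_pos hz hw'
        have hin : ‖h z * g w‖ₑ ≤ ENNReal.ofReal (C * (‖1 - inner ℂ w z‖ ^ N / (1 - ‖w‖ ^ 2) ^ (n + 1 + N))) *
            ∫⁻ l in bergmanDisc w 1, W l ∂(ballVol n) := by
          have h2 := hK z (mem_unitBall.2 hz) w hw g hg
          rw [← ofReal_norm]
          refine (ENNReal.ofReal_le_ofReal h2).trans ?_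
          rw [ENNReal.ofReal_mul (by positivity)]
          gcongr
          refine (ENNReal.ofReal_le_ofReal (le_abs_self _)).trans ?_
          rw [← Real.norm_eq_abs, ofReal_norm]
          refine (enorm_integral_le_lintegral_enorm _).trans ?_
          refine lintegral_mono_ae ?_
          filter_upwards [ae_restrict_mem (measurableSet_bergmanDisc hw')] with l hl
          rw [hWe l ((mem_bergmanDisc_iff hw').1 hl).1, enorm_norm]
        have hset : ∫⁻ l in bergmanDisc w 1, W l ∂(ballVol n) =
            ∫⁻ l, (discRel n).indicator (fun _ => 1) (w, l) * W l ∂(ballVol n) := by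
          rw [← lintegral_indicator (measurableSet_bergmanDisc hw')]
          refine lintegral_congr fun l => ?_
          by_cases hl : l ∈ bergmanDisc w 1
          · rw [Set.indicator_of_mem hl, Set.indicator_of_mem ((mem_discRel hw').2 hl), one_mul]
          · rw [Set.indicator_of_notMem hl, Set.indicator_of_notMem (fun h => hl ((mem_discRel hw').1 h)), zero_mul]
        have hmi : Measurable fun l => (discRel n).indicator (fun _ => (1 : ℝ≥0∞)) (w, l) :=
          (measurable_const.indicator measurableSet_discRel).comp measurable_prodMk_left
        calc _ ≤ (ENNReal.ofReal (C * (‖1 - inner ℂ w z‖ ^ N / (1 - ‖w‖ ^ 2) ^ (n + 1 + N))) *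
            ∫⁻ l in bergmanDisc w 1, W l ∂(ballVol n)) * ENNReal.ofReal ((1 - ‖w‖ ^ 2) ^ (N + n + 2) *
              ‖1 - inner ℂ w z‖ ^ (-((n + (N + n + 2) + 1 : ℕ) - κ))) := mul_le_mul_left hin _
          _ = ENNReal.ofReal (C * ((1 - ‖w‖ ^ 2) * ‖1 - inner ℂ w z‖ ^ (-q))) *
              ∫⁻ l in bergmanDisc w 1, W l ∂(ballVol n) := by
              rw [mul_right_comm, ← ENNReal.ofReal_mul (by positivity)]
              congr 2
              have e1 : ‖1 - inner ℂ w z‖ ^ N * ‖1 - inner ℂ w z‖ ^ (-((n + (N + n + 2) + 1 : ℕ) - κ)) =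
                  ‖1 - inner ℂ w z‖ ^ (-q) := by
                rw [← Real.rpow_natCast, ← Real.rpow_add hp]; congr 1; rw [hq]; push_cast; ring
              rw [← e1]
              have e2 : (1 - ‖w‖ ^ 2) ^ (N + n + 2) = (1 - ‖w‖ ^ 2) ^ (n + 1 + N) * (1 - ‖w‖ ^ 2) := by ring
              rw [e2]
              have : (1 - ‖w‖ ^ 2) ^ (n + 1 + N) ≠ 0 := by positivity
              generalize ‖1 - inner ℂ w z‖ ^ (-((n + (N + n + 2) + 1 : ℕ) - κ)) = Y
              field_simp
          _ = _ := by
              rw [hset, ← lintegral_const_mul' _ _ ENNReal.ofReal_ne_top]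
              refine lintegral_congr fun l => ?_
              ring
    _ = ∫⁻ l, ∫⁻ w, (discRel n).indicator (fun _ => 1) (w, l) *
        (ENNReal.ofReal (C * ((1 - ‖w‖ ^ 2) * ‖1 - inner ℂ w z‖ ^ (-q))) * W l) ∂(ballVol n) ∂(ballVol n) := by
        refine lintegral_lintegral_swap (Measurable.aemeasurable ?_)
        simp only [Function.uncurry_def]
        exact (measurable_const.indicator measurableSet_discRel).mul
          (Measurable.mul (by fun_prop) (hW.comp measurable_snd))
    _ ≤ ∫⁻ l, ENNReal.ofReal (kernelConst n C κ) * (ENNReal.ofReal ((1 - ‖l‖ ^ 2) *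
        ‖1 - inner ℂ l z‖ ^ (-(n + 2 - κ))) * W l) ∂(ballVol n) := by
        refine lintegral_mono_ae ?_
        filter_upwards [ae_mem_unitBall n] with l hl
        have hl' := mem_unitBall.1 hl
        have h1 := one_sub_norm_sq_pos hl'
        have hp := norm_one_sub_inner_pos hz hl'
        have hmi : Measurable fun w => (discRel n).indicator (fun _ => (1 : ℝ≥0∞)) (w, l) :=
          (measurable_const.indicator measurableSet_discRel).comp measurable_prodMk_right
        set B : ℝ := C * ((4 / kap * (1 - ‖l‖ ^ 2)) * ((18 / kap) ^ q * ‖1 - inner ℂ l z‖ ^ (-q))) with hB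
        have hB0 : 0 ≤ B := by positivity
        -- With `l` fixed and `w` near `l`, weight and kernel at `w` are comparable to those at `l`.
        -- The set of such `w` has measure `O((1 - |l|²)^(n+1))`, and this is `O(|1 - ⟨z,
        -- l⟩|^(n+1))`, which lowers the exponent from `q` to `n + 2 - κ`.
        calc _ ≤ ∫⁻ w, (discRel n).indicator (fun _ => 1) (w, l) * (ENNReal.ofReal B * W l) ∂(ballVol n) := by
              refine lintegral_mono fun w => ?_
              by_cases hw : (w, l) ∈ discRel n
              · have hw' : ‖w‖ < 1 := hw.1
                have hlw := (mem_discRel hw').1 hw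
                have hwl := (mem_bergmanDisc_comm hw' hl').1 hlw
                have a1 := bergmanDisc_one_sub_le hl' hwl
                have a2 := bergmanDisc_kernel_le hz hw' hlw
                have hpw := norm_one_sub_inner_pos hz hw'
                have b1 : 1 - ‖w‖ ^ 2 ≤ 4 / kap * (1 - ‖l‖ ^ 2) := by
                  rw [div_mul_eq_mul_div, le_div_iff₀ hk]; linarith
                have b2 : ‖1 - inner ℂ w z‖ ^ (-q) ≤ (18 / kap) ^ q * ‖1 - inner ℂ l z‖ ^ (-q) := by
                  have : kap / 18 * ‖1 - inner ℂ l z‖ ≤ ‖1 - inner ℂ w z‖ := by linarith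
                  refine (Real.rpow_le_rpow_of_nonpos (by positivity) this (by linarith)).trans (le_of_eq ?_)
                  rw [Real.mul_rpow (by positivity) hp.le]
                  congr 1
                  rw [Real.rpow_neg (by positivity), ← Real.inv_rpow (by positivity), inv_div]
                have b3 := (one_sub_norm_sq_pos hw').le
                refine mul_le_mul_right (mul_le_mul_left (ENNReal.ofReal_le_ofReal ?_) _) _
                exact mul_le_mul_of_nonneg_left (mul_le_mul b1 b2 (by positivity) (by positivity)) hC
              · rw [Set.indicator_of_notMem hw, zero_mul, zero_mul]
          _ = ballVol n {w | (w, l) ∈ discRel n} * (ENNReal.ofReal B * W l) := by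
              rw [lintegral_mul_const _ hmi]
              congr 1
              have : (fun w => (discRel n).indicator (fun _ => (1 : ℝ≥0∞)) (w, l)) =
                  {w | (w, l) ∈ discRel n}.indicator (fun _ => 1) := by
                ext w; rfl
              have hms : MeasurableSet {w | (w, l) ∈ discRel n} := measurable_prodMk_right measurableSet_discRel
              rw [this, lintegral_indicator_const hms, one_mul]
          _ ≤ ENNReal.ofReal (36 ^ (n + 1) * (3 / kap * (1 - ‖l‖ ^ 2)) ^ (n + 1)) * (ENNReal.ofReal B * W l) :=
              mul_le_mul_left (ballVol_bergmanDisc_le hl') _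
          _ ≤ _ := by
              rw [← mul_assoc, ← mul_assoc, ← ENNReal.ofReal_mul (by positivity), ← ENNReal.ofReal_mul
                (by unfold kernelConst; positivity)]
              refine mul_le_mul_left (ENNReal.ofReal_le_ofReal ?_) _
              have c1 : (1 - ‖l‖ ^ 2) ^ (n + 1) ≤ 2 ^ (n + 1) * ‖1 - inner ℂ l z‖ ^ (n + 1) := by
                rw [← mul_pow]; exact pow_le_pow_left₀ h1.le (one_sub_norm_sq_le hz.le hl'.le) _
              have c2 : ‖1 - inner ℂ l z‖ ^ (n + 1) * ‖1 - inner ℂ l z‖ ^ (-q) =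
                  ‖1 - inner ℂ l z‖ ^ (-(n + 2 - κ)) := by
                rw [← Real.rpow_natCast, ← Real.rpow_add hp]; congr 1; rw [hq]; push_cast; ring
              rw [hB, kernelConst, ← c2, mul_pow (3 / kap)]
              calc 36 ^ (n + 1) * ((3 / kap) ^ (n + 1) * (1 - ‖l‖ ^ 2) ^ (n + 1)) *
                    (C * (4 / kap * (1 - ‖l‖ ^ 2) * ((18 / kap) ^ q * ‖1 - inner ℂ l z‖ ^ (-q))))
                  ≤ 36 ^ (n + 1) * ((3 / kap) ^ (n + 1) * (2 ^ (n + 1) * ‖1 - inner ℂ l z‖ ^ (n + 1))) *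
                    (C * (4 / kap * (1 - ‖l‖ ^ 2) * ((18 / kap) ^ q * ‖1 - inner ℂ l z‖ ^ (-q)))) := by gcongr
                _ = _ := by ring
    _ = _ := by
        rw [lintegral_const_mul' _ _ ENNReal.ofReal_ne_top]

/-! ### Kernel multiples of elements of the submodule -/

/-- The integral of `u conj φ` vanishes for `u ∈ P` and `φ ⊥ P`. -/
lemma integral_mul_conj_eq_zero (P : BergmanSubmodule n) {φ : L2 n} (hφ : φ ∈ P.toSubmoduleᗮ) {u : L2 n}
    (hu : u ∈ P.toSubmodule) : ∫ z, u z * conj (φ z) ∂(ballVol n) = 0 := by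
  have h := (Submodule.mem_orthogonal' _ _).1 hφ u hu
  rw [L2.inner_def] at h
  rw [← h]
  refine integral_congr_ae (Filter.Eventually.of_forall fun z => ?_)
  simp

lemma exists_mem_inner_mul (P : BergmanSubmodule n) (w : Cn n) {u : L2 n} (hu : u ∈ P.toSubmodule) :
    ∃ u' ∈ P.toSubmodule, (u' : Cn n → ℂ) =ᵐ[ballVol n] fun z => inner ℂ w z * u z := by
  refine ⟨∑ k, conj (w k) • mulCoord k u, Submodule.sum_mem _ fun k _ =>
    P.toSubmodule.smul_mem _ (P.mulCoord_mem k u hu), ?_⟩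
  have h1 : ∀ k : Fin n, ((conj (w k) • mulCoord k u : L2 n) : Cn n → ℂ) =ᵐ[ballVol n]
      fun z => conj (w k) * (z k * u z) := by
    intro k
    filter_upwards [Lp.coeFn_smul (conj (w k)) (mulCoord k u), coeFn_mulCoord k u] with z h1 h2
    rw [h1, Pi.smul_apply, h2, smul_eq_mul]
  have h2 : ((∑ k, conj (w k) • mulCoord k u : L2 n) : Cn n → ℂ) =ᵐ[ballVol n]
      ∑ k, ((conj (w k) • mulCoord k u : L2 n) : Cn n → ℂ) := Lp.coeFn_finsetSum _ _ 
  filter_upwards [h2, ae_all_iff.2 h1] with z h3 h4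
  rw [h3, Finset.sum_apply, PiLp.inner_apply, Finset.sum_mul]
  refine Finset.sum_congr rfl fun k _ => ?_
  rw [h4 k]; simp; ring

lemma exists_mem_inner_pow_mul (P : BergmanSubmodule n) (w : Cn n) {u : L2 n} (hu : u ∈ P.toSubmodule) (m : ℕ) :
    ∃ u' ∈ P.toSubmodule, (u' : Cn n → ℂ) =ᵐ[ballVol n] fun z => inner ℂ w z ^ m * u z := by
  induction m with
  | zero => exact ⟨u, hu, by simp⟩
  | succ m ih =>
    obtain ⟨v, hv, hve⟩ := ih
    obtain ⟨v', hv', hve'⟩ := exists_mem_inner_mul P w hv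
    refine ⟨v', hv', ?_⟩
    filter_upwards [hve, hve'] with z h1 h2
    rw [h2, h1]; ring

lemma integrable_mul_conj (u φ : L2 n) : Integrable (fun z => u z * conj (φ z)) (ballVol n) := by
  have h := L2.integrable_inner (𝕜 := ℂ) φ u
  refine h.congr (Filter.Eventually.of_forall fun z => ?_)
  simp

/-- The function `u / (1 - ⟨·, w⟩)^(p+1)` is orthogonal to `φ` for `u ∈ P`, `φ ⊥ P` and `w` in the ball. -/
lemma integral_kernel_eq_zero (P : BergmanSubmodule n) {φ : L2 n} (hφ : φ ∈ P.toSubmoduleᗮ) {u : L2 n}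
    (hu : u ∈ P.toSubmodule) {w : Cn n} (hw : ‖w‖ < 1) (p : ℕ) :
    ∫ z, u z * conj (φ z) * (1 / (1 - inner ℂ w z) ^ (p + 1)) ∂(ballVol n) = 0 := by
  have hsum : Summable fun m : ℕ => ((m + p).choose p : ℝ) * ‖w‖ ^ m :=
    summable_choose_mul_geometric_of_norm_lt_one p (by rwa [norm_norm])
  have hI := integrable_mul_conj u φ
  -- The terms of the binomial series. Each is `⟨z, w⟩^m u` paired with `φ`, hence integrates to
  -- zero by invariance of the submodule; since `|w| < 1` the series converges absolutely and may be
  -- integrated termwise.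
  set T : ℕ → Cn n → ℂ := fun m z => ((m + p).choose p : ℂ) * inner ℂ w z ^ m * (u z * conj (φ z)) with hT
  have hTn : ∀ m, ∀ᵐ z ∂(ballVol n), ‖T m z‖ ≤ ((m + p).choose p : ℝ) * ‖w‖ ^ m * ‖u z * conj (φ z)‖ := by
    intro m
    filter_upwards [ae_mem_unitBall n] with z hz
    have hz' := mem_unitBall.1 hz
    simp only [hT]
    rw [norm_mul, norm_mul, norm_pow, Complex.norm_natCast]
    have : ‖inner ℂ w z‖ ≤ ‖w‖ := (norm_inner_le_norm w z).trans
      (mul_le_of_le_one_right (norm_nonneg _) hz'.le)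
    gcongr
  have hTm : ∀ m, AEStronglyMeasurable (T m) (ballVol n) := fun m =>
    AEStronglyMeasurable.mul (Continuous.aestronglyMeasurable (by fun_prop)) hI.aestronglyMeasurable
  have hTI : ∀ m, Integrable (T m) (ballVol n) := fun m =>
    Integrable.mono' (hI.norm.const_mul _) (hTm m) (hTn m)
  have hS := hasSum_integral_of_summable_integral_norm hTI (by
    refine Summable.of_nonneg_of_le (fun m => integral_nonneg fun w => norm_nonneg _) (fun m => ?_)
      (hsum.mul_right (∫ z, ‖u z * conj (φ z)‖ ∂(ballVol n)))
    rw [← integral_const_mul]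
    exact integral_mono_ae (hTI m).norm (hI.norm.const_mul _) (hTn m))
  have hL : ∫ z, ∑' m, T m z ∂(ballVol n) =
      ∫ z, u z * conj (φ z) * (1 / (1 - inner ℂ w z) ^ (p + 1)) ∂(ballVol n) := by
    refine integral_congr_ae ?_
    filter_upwards [ae_mem_unitBall n] with z hz
    have h := hasSum_choose_mul_geometric_of_norm_lt_one p (r := (inner ℂ w z : ℂ))
      (norm_inner_lt_one (mem_unitBall.1 hz) hw)
    rw [← (h.mul_left (u z * conj (φ z))).tsum_eq]
    congr 1 with m
    simp only [hT]; ring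
  rw [hL] at hS
  have h0 : ∀ m, ∫ z, T m z ∂(ballVol n) = 0 := by
    intro m
    obtain ⟨v, hv, hve⟩ := exists_mem_inner_pow_mul P w hu m
    have h1 := integral_mul_conj_eq_zero P hφ hv
    simp only [hT, mul_assoc]
    rw [integral_const_mul]
    convert mul_zero _
    rw [← h1]
    refine integral_congr_ae ?_
    filter_upwards [hve] with z hz
    rw [hz]; ring
  simp_rw [h0] at hS
  exact hS.unique hasSum_zero

/-! ### The pairing of `conj z_k T f` with the orthogonal complement -/

/-- The weighted Bergman kernel `(1 - |w|²)^l / (1 - ⟨z, w⟩)^(n+l+1)`. -/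
def weightKernel (n l : ℕ) (z w : Cn n) : ℂ :=
  (((1 - ‖w‖ ^ 2) ^ l : ℝ) : ℂ) * (1 / (1 - inner ℂ w z) ^ (n + l + 1))

lemma measurable_weightKernel (l : ℕ) : Measurable fun p : Cn n × Cn n => weightKernel n l p.1 p.2 := by
  unfold weightKernel
  refine Measurable.mul (Continuous.measurable (by fun_prop)) (Measurable.const_div ?_ _)
  exact Continuous.measurable (by fun_prop)

lemma norm_weightKernel {l : ℕ} {z w : Cn n} (hz : ‖z‖ < 1) (hw : ‖w‖ < 1) :
    ‖weightKernel n l z w‖ = (1 - ‖w‖ ^ 2) ^ l * ‖1 - inner ℂ w z‖ ^ (-((n + l + 1 : ℕ) : ℝ)) := by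
  have h1 := one_sub_norm_sq_pos hw
  have h2 := norm_one_sub_inner_pos hz hw
  rw [weightKernel, norm_mul, Complex.norm_real, Real.norm_of_nonneg (by positivity), norm_div, norm_one,
    norm_pow, Real.rpow_neg h2.le, Real.rpow_natCast, one_div]

lemma norm_coord_sub_mul_weightKernel_le {l : ℕ} {z w : Cn n} (hz : ‖z‖ < 1) (hw : ‖w‖ < 1) (k : Fin n) :
    ‖weightKernel n l z w * (conj (z k) - conj (w k))‖ ≤
      √2 * ((1 - ‖w‖ ^ 2) ^ l * ‖1 - inner ℂ w z‖ ^ (-((n + l + 1 : ℕ) - (1 / 2 : ℝ)))) := by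
  have h1 := one_sub_norm_sq_pos hw
  have h2 := norm_one_sub_inner_pos hz hw
  -- The half power gained here becomes `κ = 1/2` in the Schur test.
  have h3 : ‖conj (z k) - conj (w k)‖ ≤ √2 * ‖1 - inner ℂ w z‖ ^ (1 / 2 : ℝ) := by
    rw [← map_sub, RCLike.norm_conj]
    refine (PiLp.norm_apply_le (z - w) k).trans ?_
    rw [← Real.sqrt_eq_rpow, ← Real.sqrt_mul zero_le_two]
    exact Real.le_sqrt_of_sq_le (norm_sub_sq_le hz.le hw.le)
  rw [norm_mul, norm_weightKernel hz hw]
  calc _ ≤ (1 - ‖w‖ ^ 2) ^ l * ‖1 - inner ℂ w z‖ ^ (-((n + l + 1 : ℕ) : ℝ)) *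
        (√2 * ‖1 - inner ℂ w z‖ ^ (1 / 2 : ℝ)) := mul_le_mul_of_nonneg_left h3 (by positivity)
    _ = √2 * ((1 - ‖w‖ ^ 2) ^ l * (‖1 - inner ℂ w z‖ ^ (-((n + l + 1 : ℕ) : ℝ)) *
        ‖1 - inner ℂ w z‖ ^ (1 / 2 : ℝ))) := by ring
    _ = _ := by rw [← Real.rpow_add h2]; congr 3; ring

lemma memLp_two_of_lintegral {α : Type*} [MeasurableSpace α] {μ : Measure α} {f : α → ℂ}
    (hf : AEStronglyMeasurable f μ) (h : ∫⁻ x, ‖f x‖ₑ ^ 2 ∂μ < ∞) : MemLp f 2 μ := by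
  refine ⟨hf, ?_⟩
  rw [eLpNorm_lt_top_iff_lintegral_rpow_enorm_lt_top two_ne_zero ENNReal.ofNat_ne_top]
  simpa using h

lemma lintegral_enorm_sq_eq {μ : Measure (Cn n)} (f : Lp ℂ 2 μ) :
    ∫⁻ x, ‖f x‖ₑ ^ 2 ∂μ = ENNReal.ofReal (‖f‖ ^ 2) := by
  have h := eLpNorm_nnreal_pow_eq_lintegral (μ := μ) (f := f) (p := 2) two_ne_zero
  simp only [NNReal.coe_ofNat, ENNReal.rpow_ofNat] at h
  rw [← h, Lp.norm_def, ← ENNReal.toReal_pow, ENNReal.ofReal_toReal]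
  · rfl
  · exact ENNReal.pow_ne_top (Lp.eLpNorm_ne_top f)

/-- The constant in `enorm_integral_conj_coord_mul_le`. -/
def divisionConst (n : ℕ) (C : ℝ) (N : ℕ) : ℝ :=
  (n.factorial * (N + n + 2).factorial / (n + (N + n + 2)).factorial : ℝ)⁻¹ * (√2 * kernelConst n C (1 / 2))

/-- With `h g` written through the reproducing formula in `w`, replacing `conj z_k` by `conj w_k`
changes the pairing to zero, because `h / (1 - ⟨·, w⟩)^(n+l+1)` belongs to the submodule. Only the
difference of the coordinates has to be estimated. The bound is linear in `|h g|`, so that it can be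
summed over the generators. -/
lemma enorm_integral_conj_coord_mul_le [NeZero n] (P : BergmanSubmodule n) {φ : L2 n} (hφ : φ ∈ P.toSubmoduleᗮ)
    {u : L2 n} (hu : u ∈ P.toSubmodule) {h g : Cn n → ℂ} (hm : Measurable h) (gm : Measurable g)
    (hhu : (u : Cn n → ℂ) =ᵐ[ballVol n] h) (hg : IsHolo g) {C : ℝ} {N : ℕ} (hC : 0 ≤ C)
    (hK : KeyInequality h C N) (hI : ∫⁻ z, ‖h z * g z‖ₑ ^ 2 ∂(ballVol n) < ∞) (k : Fin n) :
    ‖∫ z, conj (z k) * (h z * g z) * conj (φ z) ∂(ballVol n)‖ₑ ≤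
      ENNReal.ofReal (divisionConst n C N) * ∫⁻ z, ‖φ z‖ₑ * (∫⁻ l, ENNReal.ofReal ((1 - ‖l‖ ^ 2) *
        ‖1 - inner ℂ l z‖ ^ (-(n + 2 - 1 / 2 : ℝ))) * ‖h l * g l‖ₑ ∂(ballVol n)) ∂(ballVol n) := by
  by_cases h0 : ∃ z₀ ∈ unitBall n, h z₀ ≠ 0
  swap
  · push Not at h0
    have : ∫ z, conj (z k) * (h z * g z) * conj (φ z) ∂(ballVol n) = 0 := by
      refine integral_eq_zero_of_ae ?_
      filter_upwards [ae_mem_unitBall n] with z hz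
      simp [h0 z hz]
    rw [this]; simp
  obtain ⟨z₀, hz₀, h0⟩ := h0
  -- One more than the `n + 1 + N` needed for integrability, so that a factor `1 - |w|²` survives
  -- the key inequality.
  set l := N + n + 2 with hl
  set c : ℝ := (n.factorial * l.factorial / (n + l).factorial : ℝ) with hc
  have hc0 : 0 < c := by positivity
  set W : Cn n → ℝ≥0∞ := fun w => ‖h w * g w‖ₑ with hW
  have hWm : Measurable W := (hm.mul gm).enorm
  have hLp : MemLp (fun z => h z * g z) 2 (ballVol n) :=
    memLp_two_of_lintegral (hm.mul gm).aestronglyMeasurable hI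
  have hgI : Integrable (fun w => g w * (((1 - ‖w‖ ^ 2) ^ l : ℝ) : ℂ)) (ballVol n) :=
    integrable_weight_of_keyInequality hC hK hg (hLp.integrable one_le_two) hz₀ h0 (by omega)
  have hφm : AEStronglyMeasurable (fun z => conj (φ z)) (ballVol n) :=
    Complex.continuous_conj.comp_aestronglyMeasurable (Lp.aestronglyMeasurable φ)
  set G : Cn n → Cn n → ℂ := fun z w => h z * g w * weightKernel n l z w with hG
  have hGm : Measurable fun p : Cn n × Cn n => G p.1 p.2 :=
    ((hm.comp measurable_fst).mul (gm.comp measurable_snd)).mul (measurable_weightKernel l)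
  have hGI : ∀ z, ‖z‖ < 1 → Integrable (G z) (ballVol n) := by
    intro z hz
    have hb : ∀ᵐ w ∂(ballVol n), ‖1 / (1 - inner ℂ w z) ^ (n + l + 1)‖ ≤ 1 / (1 - ‖z‖) ^ (n + l + 1) := by
      filter_upwards [ae_mem_unitBall n] with w hw
      rw [norm_div, norm_one, norm_pow]
      have h1 : 0 < 1 - ‖z‖ := by linarith
      have := one_sub_norm_le_norm_one_sub_inner (z := w) (w := z) (mem_unitBall.1 hw).le
      rw [norm_one_sub_inner_comm] at this
      gcongr
    have hkm : AEStronglyMeasurable (fun w : Cn n => 1 / (1 - inner ℂ w z) ^ (n + l + 1)) (ballVol n) :=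
      (Measurable.const_div (Continuous.measurable (by fun_prop)) _).aestronglyMeasurable
    refine ((hgI.mul_bdd hkm hb).const_mul (h z)).congr (Filter.Eventually.of_forall fun w => ?_)
    simp only [hG, weightKernel]; ring
  have hGint : ∀ z, ‖z‖ < 1 → ∫ w, G z w ∂(ballVol n) = (c : ℂ) * (h z * g z) := by
    intro z hz
    have := integral_reproducing hg l hgI hz
    have e : ∀ w, G z w = h z * (g w * (((1 - ‖w‖ ^ 2) ^ l : ℝ) : ℂ) * (1 / (1 - inner ℂ w z) ^ (n + l + 1))) := by
      intro w; simp only [hG, weightKernel]; ring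
    simp_rw [e]
    rw [integral_const_mul, this]; ring
  have hcoordm : ∀ j : Fin n, Measurable fun w : Cn n => conj (w j) := fun j =>
    Continuous.measurable (by fun_prop)
  have hcoord : ∀ j : Fin n, ∀ w ∈ unitBall n, ‖conj (w j)‖ ≤ 1 := fun j w hw => by
    rw [RCLike.norm_conj]; exact (PiLp.norm_apply_le w j).trans (mem_unitBall.1 hw).le
  -- absolute integrability of the second part
  have hBI : Integrable (Function.uncurry fun z w => G z w * conj (w k) * conj (φ z))
      ((ballVol n).prod (ballVol n)) := by
    have hmeas : AEStronglyMeasurable (Function.uncurry fun z w => G z w * conj (w k) * conj (φ z))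
        ((ballVol n).prod (ballVol n)) :=
      (hGm.mul ((hcoordm k).comp measurable_snd)).aestronglyMeasurable.mul hφm.comp_fst
    refine ⟨hmeas, ?_⟩
    rw [hasFiniteIntegral_iff_enorm, lintegral_prod _ hmeas.enorm]
    -- Without the coordinate difference no half power is available; the unweighted case `κ = 0` is
    -- enough for Fubini.
    obtain ⟨C0, hC0⟩ := exists_schur_bound n (κ := 0) le_rfl (by norm_num)
    have hin : ∀ᵐ z ∂(ballVol n), ∫⁻ w, ‖G z w * conj (w k) * conj (φ z)‖ₑ ∂(ballVol n) ≤
        ENNReal.ofReal (kernelConst n C 0) * (‖φ z‖ₑ * ∫⁻ l, ENNReal.ofReal ((1 - ‖l‖ ^ 2) *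
        ‖1 - inner ℂ l z‖ ^ (-(n + 2 - 0 : ℝ))) * W l ∂(ballVol n)) := by
      filter_upwards [ae_mem_unitBall n] with z hz
      have hz' := mem_unitBall.1 hz
      have h1 := lintegral_kernel_mul_le hC hK hg hWm (fun _ _ => rfl) (κ := 0) zero_le_one hz'
      calc _ ≤ ∫⁻ w, ‖φ z‖ₑ * (‖h z * g w‖ₑ * ENNReal.ofReal ((1 - ‖w‖ ^ 2) ^ (N + n + 2) *
        ‖1 - inner ℂ w z‖ ^ (-((n + (N + n + 2) + 1 : ℕ) - (0 : ℝ))))) ∂(ballVol n) := by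
            refine lintegral_mono_ae ?_
            filter_upwards [ae_mem_unitBall n] with w hw
            have hw' := mem_unitBall.1 hw
            rw [sub_zero, ← hl, ← norm_weightKernel hz' hw', ofReal_norm, ← enorm_mul, ← enorm_mul,
              ← ofReal_norm, ← ofReal_norm]
            refine ENNReal.ofReal_le_ofReal ?_
            rw [norm_mul, norm_mul, RCLike.norm_conj (φ z), norm_mul (φ z), mul_comm]
            exact mul_le_mul_of_nonneg_left (mul_le_of_le_one_right (norm_nonneg _) (hcoord k w hw)) (norm_nonneg _)
        _ ≤ _ := by
            rw [lintegral_const_mul' _ _ enorm_ne_top, mul_left_comm]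
            exact mul_le_mul_right h1 _
    refine (lintegral_mono_ae hin).trans_lt ?_
    rw [lintegral_const_mul' _ _ ENNReal.ofReal_ne_top]
    refine ENNReal.mul_lt_top ENNReal.ofReal_lt_top ?_
    have hker : Measurable fun z : Cn n => ∫⁻ l, ENNReal.ofReal ((1 - ‖l‖ ^ 2) *
        ‖1 - inner ℂ l z‖ ^ (-(n + 2 - 0 : ℝ))) * W l ∂(ballVol n) :=
      Measurable.lintegral_prod_right' (f := fun p : Cn n × Cn n => ENNReal.ofReal ((1 - ‖p.2‖ ^ 2) *
        ‖1 - inner ℂ p.2 p.1‖ ^ (-(n + 2 - 0 : ℝ))) * W p.2)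
        (Measurable.mul (by fun_prop) (hWm.comp measurable_snd))
    have h2 := lintegral_mul_sq_le (μ := ballVol n) (Lp.aestronglyMeasurable φ).enorm hker.aemeasurable
    have h3 := hC0 W hWm
    have h4 : ∫⁻ l, W l ^ 2 * ENNReal.ofReal ((1 - ‖l‖ ^ 2) ^ (2 * (0 : ℝ))) ∂(ballVol n) < ∞ := by
      simpa only [mul_zero, Real.rpow_zero, ENNReal.ofReal_one, mul_one] using hI
    rw [lintegral_enorm_sq_eq] at h2
    have h5 := h2.trans_lt (ENNReal.mul_lt_top ENNReal.ofReal_lt_top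
      (h3.trans_lt (ENNReal.mul_lt_top ENNReal.coe_lt_top h4)))
    by_contra h6
    rw [not_lt, top_le_iff] at h6
    rw [h6] at h5
    simp at h5
  -- After the interchange, `conj (w k)` and `g w` are constants, and the inner integral over `z`
  -- pairs an element of the submodule with `φ`.
  have hB0 : ∫ z, ∫ w, G z w * conj (w k) * conj (φ z) ∂(ballVol n) ∂(ballVol n) = 0 := by
    rw [integral_integral_swap hBI]
    refine integral_eq_zero_of_ae ?_
    filter_upwards [ae_mem_unitBall n] with w hw
    have h1 := integral_kernel_eq_zero P hφ hu (mem_unitBall.1 hw) (n + l)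
    have h2 : ∫ z, G z w * conj (w k) * conj (φ z) ∂(ballVol n) =
        g w * (((1 - ‖w‖ ^ 2) ^ l : ℝ) : ℂ) * conj (w k) *
          ∫ z, u z * conj (φ z) * (1 / (1 - inner ℂ w z) ^ (n + l + 1)) ∂(ballVol n) := by
      rw [← integral_const_mul]
      refine integral_congr_ae ?_
      filter_upwards [hhu] with z hz
      rw [hz]
      simp only [hG, weightKernel]; ring
    rw [h2, h1, mul_zero]; rfl
  have hsplit : ∀ᵐ z ∂(ballVol n), (c : ℂ) * (conj (z k) * (h z * g z) * conj (φ z)) -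
      ∫ w, G z w * conj (w k) * conj (φ z) ∂(ballVol n) =
      (∫ w, G z w * (conj (z k) - conj (w k)) ∂(ballVol n)) * conj (φ z) := by
    filter_upwards [ae_mem_unitBall n] with z hz
    have hz' := mem_unitBall.1 hz
    have i2 : Integrable (fun w => G z w * conj (w k)) (ballVol n) :=
      (hGI z hz').mul_bdd (c := 1) (hcoordm k).aestronglyMeasurable
        ((ae_mem_unitBall n).mono fun w hw => hcoord k w hw)
    simp_rw [mul_sub]
    rw [integral_sub ((hGI z hz').mul_const _) i2, integral_mul_const, integral_mul_const, hGint z hz']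
    ring
  have hmain : Integrable (fun z => conj (z k) * (h z * g z) * conj (φ z)) (ballVol n) := by
    have h1 := integrable_mul_conj (hLp.toLp _) φ
    have h2 := h1.bdd_mul (c := 1) (f := fun z : Cn n => conj (z k)) (hcoordm k).aestronglyMeasurable
      ((ae_mem_unitBall n).mono fun w hw => hcoord k w hw)
    refine h2.congr ?_
    filter_upwards [hLp.coeFn_toLp] with z hz
    rw [hz]; ring
  have hfin : (c : ℂ) * ∫ z, conj (z k) * (h z * g z) * conj (φ z) ∂(ballVol n) =
      ∫ z, (∫ w, G z w * (conj (z k) - conj (w k)) ∂(ballVol n)) * conj (φ z) ∂(ballVol n) := by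
    have hBI' : Integrable (fun z => ∫ w, G z w * conj (w k) * conj (φ z) ∂(ballVol n)) (ballVol n) :=
      hBI.integral_prod_left
    rw [← integral_congr_ae hsplit, integral_sub (hmain.const_mul _) hBI', integral_const_mul, hB0, sub_zero]
  have hc1 : ∫ z, conj (z k) * (h z * g z) * conj (φ z) ∂(ballVol n) = ((c⁻¹ : ℝ) : ℂ) *
      ∫ z, (∫ w, G z w * (conj (z k) - conj (w k)) ∂(ballVol n)) * conj (φ z) ∂(ballVol n) := by
    rw [← hfin, ← mul_assoc, ← Complex.ofReal_mul, inv_mul_cancel₀ hc0.ne', Complex.ofReal_one, one_mul]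
  rw [hc1, enorm_mul]
  have hc2 : ‖((c⁻¹ : ℝ) : ℂ)‖ₑ = ENNReal.ofReal c⁻¹ := by
    rw [← ofReal_norm, Complex.norm_real, Real.norm_of_nonneg (by positivity)]
  rw [hc2, divisionConst, ENNReal.ofReal_mul (by positivity), mul_assoc]
  refine mul_le_mul_right ?_ _
  refine (enorm_integral_le_lintegral_enorm _).trans ?_
  rw [← lintegral_const_mul' _ _ ENNReal.ofReal_ne_top]
  refine lintegral_mono_ae ?_
  filter_upwards [ae_mem_unitBall n] with z hz
  have hz' := mem_unitBall.1 hz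
  have h1 := lintegral_kernel_mul_le hC hK hg hWm (fun _ _ => rfl) (κ := 1 / 2) (by norm_num) hz'
  rw [enorm_mul, mul_comm, mul_left_comm]
  have hφn : ‖conj (φ z)‖ₑ = ‖φ z‖ₑ := by rw [← ofReal_norm, RCLike.norm_conj, ofReal_norm]
  rw [hφn]
  refine mul_le_mul_right ?_ _
  rw [ENNReal.ofReal_mul (by positivity), mul_assoc]
  refine le_trans ?_ (mul_le_mul_right h1 _)
  refine (enorm_integral_le_lintegral_enorm _).trans ?_
  rw [← lintegral_const_mul' _ _ ENNReal.ofReal_ne_top]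
  refine lintegral_mono_ae ?_
  filter_upwards [ae_mem_unitBall n] with w hw
  have hw' := mem_unitBall.1 hw
  have h2 := norm_coord_sub_mul_weightKernel_le (l := l) hz' hw' k
  simp only [hG]
  rw [mul_assoc, enorm_mul, mul_left_comm]
  refine mul_le_mul_right ?_ _
  rw [← ENNReal.ofReal_mul (by positivity), ← ofReal_norm]
  exact ENNReal.ofReal_le_ofReal h2

lemma KeyInequality.indicator {h : Cn n → ℂ} {C : ℝ} {N : ℕ} (hK : KeyInequality h C N) :
    KeyInequality ((unitBall n).indicator h) C N := by
  intro z hz w hw f hf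
  rw [Set.indicator_of_mem hz]
  refine (hK z hz w hw f hf).trans_eq ?_
  congr 1
  refine integral_congr_ae (ae_restrict_of_ae ?_)
  filter_upwards [ae_mem_unitBall n] with x hx
  rw [Set.indicator_of_mem hx]

/-- The pairings are added before any square is taken, so the Schur test is applied once, to `H = Σ
|h_i g_i|`, with constants independent of `i`. The unweighted division bound serves only to justify
exchanging sum and integral; the weighted one gives the estimate. -/
lemma exists_enorm_integral_conj_coord_le [NeZero n] (P : BergmanSubmodule n) {Λ : Type*} [Countable Λ]
    {h : Λ → Cn n → ℂ} (hd : P.AsympStableDivision h) {C : ℝ} {N : ℕ} (hC : 0 ≤ C)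
    (hK : ∀ i, KeyInequality (h i) C N) :
    ∃ (T : P.toSubmodule ≃L[ℂ] P.toSubmodule) (A : ℝ≥0), ∀ (f : P.toSubmodule), ∀ φ ∈ P.toSubmoduleᗮ, ∀ k : Fin n,
      ‖∫ z, conj (z k) * (T f : L2 n) z * conj (φ z) ∂(ballVol n)‖ₑ ^ 2 ≤
        A * (∫⁻ z, ‖(f : L2 n) z‖ₑ ^ 2 * ENNReal.ofReal (1 - ‖z‖ ^ 2) ∂(ballVol n)) *
          ENNReal.ofReal (‖φ‖ ^ 2) := by
  obtain ⟨hu, T, C₁, C₂, hT⟩ := hd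
  obtain ⟨S, hS⟩ := exists_schur_bound n (κ := 1 / 2) (by norm_num) le_rfl
  refine ⟨T, (divisionConst n C N).toNNReal ^ 2 * (S * C₂), fun f φ hφ k => ?_⟩
  obtain ⟨g, hg, ⟨F, ⟨hF, hTF⟩, hsum⟩, h1, h2⟩ := hT f
  choose u huP hrep using hu
  set hB : Λ → Cn n → ℂ := fun i => (unitBall n).indicator (h i) with hhB
  set gB : Λ → Cn n → ℂ := fun i => (unitBall n).indicator (g i) with hgB
  have hBm : ∀ i, Measurable (hB i) := fun i => measurable_indicator_of_isHolo (hrep i).1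
  have gBm : ∀ i, Measurable (gB i) := fun i => measurable_indicator_of_isHolo (hg i)
  have gBh : ∀ i, IsHolo (gB i) := fun i => (hg i).congr fun z hz => Set.indicator_of_mem hz _
  have hBu : ∀ i, (u i : Cn n → ℂ) =ᵐ[ballVol n] hB i := fun i => by
    filter_upwards [(hrep i).2, ae_mem_unitBall n] with z hz hz'
    rw [hz, hhB]; simp only; rw [Set.indicator_of_mem hz']
  have hval : ∀ᵐ z ∂(ballVol n), ∀ i, hB i z * gB i z = h i z * g i z := by
    filter_upwards [ae_mem_unitBall n] with z hz i
    simp only [hhB, hgB]; rw [Set.indicator_of_mem hz, Set.indicator_of_mem hz]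
  set H : Cn n → ℝ≥0∞ := fun z => ∑' i, ‖hB i z * gB i z‖ₑ with hH
  have hWm : ∀ i, Measurable fun z => ‖hB i z * gB i z‖ₑ := fun i => ((hBm i).mul (gBm i)).enorm
  have hHm : Measurable H := Measurable.tsum hWm
  have hHe : ∀ᵐ z ∂(ballVol n), H z = ∑' i, ‖h i z * g i z‖ₑ := by
    filter_upwards [hval] with z hz
    simp only [hH, hz]
  have hH1 : ∫⁻ z, H z ^ 2 ∂(ballVol n) < ∞ := by
    rw [lintegral_congr_ae (hHe.mono fun z hz => by rw [hz])]
    refine h1.trans_lt (ENNReal.mul_lt_top ENNReal.coe_lt_top ?_)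
    rw [lintegral_enorm_sq_eq]; exact ENNReal.ofReal_lt_top
  -- With `κ = 1/2` the weight of the Schur test is exactly the `1 - |z|²` of the division property.
  have hH2 : ∫⁻ z, H z ^ 2 * ENNReal.ofReal ((1 - ‖z‖ ^ 2) ^ (2 * (1 / 2 : ℝ))) ∂(ballVol n) ≤
      C₂ * ∫⁻ z, ‖(f : L2 n) z‖ₑ ^ 2 * ENNReal.ofReal (1 - ‖z‖ ^ 2) ∂(ballVol n) := by
    refine le_trans (le_of_eq (lintegral_congr_ae (hHe.mono fun z hz => ?_))) h2
    simp only; rw [hz]; norm_num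
  have hφm : AEMeasurable (fun z => ‖φ z‖ₑ) (ballVol n) := (Lp.aestronglyMeasurable φ).enorm
  have hφe : ∀ z, ‖conj (φ z)‖ₑ = ‖φ z‖ₑ := fun z => by rw [← ofReal_norm, RCLike.norm_conj, ofReal_norm]
  have hfm : ∀ i, AEStronglyMeasurable (fun z => conj (z k) * (hB i z * gB i z) * conj (φ z)) (ballVol n) := fun i =>
    (Measurable.aestronglyMeasurable (Measurable.mul (Continuous.measurable (by fun_prop))
      ((hBm i).mul (gBm i)))).mul
      (Complex.continuous_conj.comp_aestronglyMeasurable (Lp.aestronglyMeasurable φ))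
  have hfin : ∑' i, ∫⁻ z, ‖conj (z k) * (hB i z * gB i z) * conj (φ z)‖ₑ ∂(ballVol n) ≠ ∞ := by
    have hle : ∑' i, ∫⁻ z, ‖conj (z k) * (hB i z * gB i z) * conj (φ z)‖ₑ ∂(ballVol n) ≤
        ∫⁻ z, H z * ‖φ z‖ₑ ∂(ballVol n) := by
      rw [← lintegral_tsum fun i => (hfm i).enorm]
      refine lintegral_mono_ae ?_
      filter_upwards [ae_mem_unitBall n] with z hz
      simp only [hH]
      rw [← ENNReal.tsum_mul_right]
      refine ENNReal.tsum_le_tsum fun i => ?_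
      rw [enorm_mul, hφe, enorm_mul (conj (z k))]
      refine mul_le_mul_left ?_ _
      refine mul_le_of_le_one_left' ?_
      rw [← ofReal_norm, RCLike.norm_conj]
      exact ENNReal.ofReal_le_one.2 ((PiLp.norm_apply_le z k).trans (mem_unitBall.1 hz).le)
    have h3 := lintegral_mul_sq_le hHm.aemeasurable hφm
    rw [lintegral_enorm_sq_eq] at h3
    have h4 := h3.trans_lt (ENNReal.mul_lt_top hH1 ENNReal.ofReal_lt_top)
    refine ne_top_of_le_ne_top (fun h5 => ?_) hle
    rw [h5] at h4; simp at h4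
  have hint : ∫ z, conj (z k) * (T f : L2 n) z * conj (φ z) ∂(ballVol n) =
      ∑' i, ∫ z, conj (z k) * (hB i z * gB i z) * conj (φ z) ∂(ballVol n) := by
    rw [← integral_tsum hfm hfin]
    refine integral_congr_ae ?_
    filter_upwards [hTF, hval, ae_mem_unitBall n] with z hz1 hz2 hz3
    rw [hz1, ← (((hsum z hz3).mul_left (conj (z k))).mul_right (conj (φ z))).tsum_eq]
    simp only [hz2]
  have hker : ∀ {W : Cn n → ℝ≥0∞}, Measurable W → Measurable fun z : Cn n => ∫⁻ l, ENNReal.ofReal ((1 - ‖l‖ ^ 2) *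
        ‖1 - inner ℂ l z‖ ^ (-(n + 2 - 1 / 2 : ℝ))) * W l ∂(ballVol n) := fun {W} hW =>
    Measurable.lintegral_prod_right' (f := fun p : Cn n × Cn n => ENNReal.ofReal ((1 - ‖p.2‖ ^ 2) *
        ‖1 - inner ℂ p.2 p.1‖ ^ (-(n + 2 - 1 / 2 : ℝ))) * W p.2)
        (Measurable.mul (by fun_prop) (hW.comp measurable_snd))
  have hbound : ‖∫ z, conj (z k) * (T f : L2 n) z * conj (φ z) ∂(ballVol n)‖ₑ ≤
      ENNReal.ofReal (divisionConst n C N) * ∫⁻ z, ‖φ z‖ₑ * (∫⁻ l, ENNReal.ofReal ((1 - ‖l‖ ^ 2) *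
        ‖1 - inner ℂ l z‖ ^ (-(n + 2 - 1 / 2 : ℝ))) * H l ∂(ballVol n)) ∂(ballVol n) := by
    have hs : ∀ z : Cn n, ∫⁻ l, ENNReal.ofReal ((1 - ‖l‖ ^ 2) *
        ‖1 - inner ℂ l z‖ ^ (-(n + 2 - 1 / 2 : ℝ))) * H l ∂(ballVol n) =
        ∑' i, ∫⁻ l, ENNReal.ofReal ((1 - ‖l‖ ^ 2) *
        ‖1 - inner ℂ l z‖ ^ (-(n + 2 - 1 / 2 : ℝ))) * ‖hB i l * gB i l‖ₑ ∂(ballVol n) := by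
      intro z
      have hm1 : ∀ i, AEMeasurable (fun l : Cn n => ENNReal.ofReal ((1 - ‖l‖ ^ 2) *
          ‖1 - inner ℂ l z‖ ^ (-(n + 2 - 1 / 2 : ℝ))) * ‖hB i l * gB i l‖ₑ) (ballVol n) := fun i =>
        Measurable.aemeasurable (Measurable.mul (by fun_prop) (hWm i))
      rw [← lintegral_tsum hm1]
      refine lintegral_congr fun l => ?_
      rw [hH, ENNReal.tsum_mul_left]
    have hm2 : ∀ i, AEMeasurable (fun z : Cn n => ‖φ z‖ₑ * ∫⁻ l, ENNReal.ofReal ((1 - ‖l‖ ^ 2) *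
        ‖1 - inner ℂ l z‖ ^ (-(n + 2 - 1 / 2 : ℝ))) * ‖hB i l * gB i l‖ₑ ∂(ballVol n)) (ballVol n) := fun i =>
      hφm.mul (hker (hWm i)).aemeasurable
    simp_rw [hs, ← ENNReal.tsum_mul_left]
    rw [lintegral_tsum hm2, ← ENNReal.tsum_mul_left, hint]
    refine enorm_tsum_le_tsum_enorm.trans ?_
    refine ENNReal.tsum_le_tsum fun i => ?_
    refine enorm_integral_conj_coord_mul_le P hφ (huP i) (hBm i) (gBm i) (hBu i) (gBh i) hC (hK i).indicator ?_ k
    refine lt_of_le_of_lt (lintegral_mono fun z => ?_) hH1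
    exact pow_le_pow_left₀ zero_le (ENNReal.le_tsum i) 2
  calc _ ≤ (ENNReal.ofReal (divisionConst n C N) * ∫⁻ z, ‖φ z‖ₑ * (∫⁻ l, ENNReal.ofReal ((1 - ‖l‖ ^ 2) *
        ‖1 - inner ℂ l z‖ ^ (-(n + 2 - 1 / 2 : ℝ))) * H l ∂(ballVol n)) ∂(ballVol n)) ^ 2 :=
        pow_le_pow_left₀ zero_le hbound 2
    _ ≤ ENNReal.ofReal (divisionConst n C N) ^ 2 * (ENNReal.ofReal (‖φ‖ ^ 2) * (S * (C₂ *
        ∫⁻ z, ‖(f : L2 n) z‖ₑ ^ 2 * ENNReal.ofReal (1 - ‖z‖ ^ 2) ∂(ballVol n)))) := by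
        rw [mul_pow]
        refine mul_le_mul_right ?_ _
        refine (lintegral_mul_sq_le hφm (hker hHm).aemeasurable).trans ?_
        rw [lintegral_enorm_sq_eq]
        exact mul_le_mul_right ((hS H hHm).trans (mul_le_mul_right hH2 _)) _
    _ = _ := by
        push_cast
        rw [ENNReal.ofReal]
        ring

/-! ### Singular numbers -/

section HilbertSpace

variable {E G : Type} [NormedAddCommGroup E] [InnerProductSpace ℂ E] [NormedAddCommGroup G] [InnerProductSpace ℂ G]

lemma singularNumber_nonneg (A : E →L[ℂ] E) (k : ℕ) : 0 ≤ singularNumber A k :=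
  Real.iInf_nonneg fun _ => norm_nonneg _

lemma singularNumber_le_of_rank_le {A F : E →L[ℂ] E} {k : ℕ} (hF : LinearMap.rank (F : E →ₗ[ℂ] E) ≤ k) :
    singularNumber A k ≤ ‖A - F‖ :=
  ciInf_le (f := fun F : {F : E →L[ℂ] E // LinearMap.rank (F : E →ₗ[ℂ] E) ≤ k} => ‖A - F‖)
    ⟨0, by rintro _ ⟨F, rfl⟩; exact norm_nonneg _⟩ ⟨F, hF⟩

/-- If `D = -(A₁)* A₂` in the sense of forms and `A₁`, `A₂` are small on the orthogonal complement of
finitely many vectors, then the singular numbers of `D` are small. -/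
lemma singularNumber_le_of_form {D : E →L[ℂ] E} {A₁ A₂ : E →L[ℂ] G}
    (hD : ∀ x y, inner ℂ (D x) y = -inner ℂ (A₂ x) (A₁ y)) {ι : Type} [Fintype ι] (v : ι → E) {c : ℝ}
    (hc : 0 ≤ c) (h₁ : ∀ x, (∀ i, inner ℂ (v i) x = 0) → ‖A₁ x‖ ≤ c * ‖x‖)
    (h₂ : ∀ x, (∀ i, inner ℂ (v i) x = 0) → ‖A₂ x‖ ≤ c * ‖x‖) {k : ℕ} (hk : 2 * Fintype.card ι ≤ k) :
    singularNumber D k ≤ c ^ 2 := by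
  set S : Submodule ℂ E := Submodule.span ℂ (Set.range v) with hS
  have : FiniteDimensional ℂ S := FiniteDimensional.span_of_finite ℂ (Set.finite_range v)
  set Q : E →L[ℂ] E := 1 - S.starProjection with hQ
  have hQv : ∀ x i, inner ℂ (v i) (Q x) = 0 := fun x i =>
    (Submodule.mem_orthogonal _ _).1 (S.sub_starProjection_mem_orthogonal x) _
      (Submodule.subset_span (Set.mem_range_self i))
  have hQn : ∀ x, ‖Q x‖ ≤ ‖x‖ := by
    intro x
    rw [hQ, ← Submodule.starProjection_orthogonal']
    exact Submodule.norm_starProjection_apply_le _ x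
  have hrank : LinearMap.rank (S.starProjection : E →ₗ[ℂ] E) ≤ Fintype.card ι := by
    have h1 : LinearMap.range (S.starProjection : E →ₗ[ℂ] E) = S := S.range_starProjection
    rw [LinearMap.rank, h1]
    refine (rank_span_le _).trans (Cardinal.mk_range_le.trans ?_)
    rw [Cardinal.mk_fintype]
  -- With `S` the projection onto the span of `v`, the approximant is `D - QDQ = SD + QDS`, of rank
  -- at most twice the number of vectors.
  refine (singularNumber_le_of_rank_le (F := D - Q ∘L D ∘L Q) ?_).trans ?_
  · have hF : ((D - Q ∘L D ∘L Q : E →L[ℂ] E) : E →ₗ[ℂ] E) =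
        (S.starProjection : E →ₗ[ℂ] E) ∘ₗ (D : E →ₗ[ℂ] E) +
        ((Q ∘L D : E →L[ℂ] E) : E →ₗ[ℂ] E) ∘ₗ (S.starProjection : E →ₗ[ℂ] E) := by
      ext x
      simp [hQ]
      abel
    rw [hF]
    refine (LinearMap.rank_add_le _ _).trans ?_
    refine (add_le_add (LinearMap.rank_comp_le_left _ _) (LinearMap.rank_comp_le_right _ _)).trans ?_
    refine (add_le_add hrank hrank).trans ?_
    rw [← two_mul]
    exact_mod_cast hk
  · rw [sub_sub_cancel]
    refine ContinuousLinearMap.opNorm_le_bound _ (by positivity) fun x => ?_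
    simp only [ContinuousLinearMap.comp_apply]
    set y := Q (D (Q x)) with hy
    have h1 : inner ℂ (D (Q x)) y = inner ℂ y y := by
      rw [← sub_eq_zero, ← inner_sub_left]
      have : D (Q x) - y = S.starProjection (D (Q x)) := by simp [hy, hQ]
      rw [this]
      exact (Submodule.mem_orthogonal _ _).1 (S.sub_starProjection_mem_orthogonal _) _
        (S.starProjection_apply_mem _)
    -- For `y = QDQx` the form identity reads `|y|² = ⟨DQx, y⟩ = -⟨A₂Qx, A₁y⟩`, and both `Qx` and
    -- `y` are orthogonal to `v`.
    have h2 : ‖y‖ * ‖y‖ ≤ c ^ 2 * ‖x‖ * ‖y‖ := by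
      have h3 : ‖y‖ * ‖y‖ = ‖inner ℂ (A₂ (Q x)) (A₁ y)‖ := by
        rw [← norm_neg (inner ℂ (A₂ (Q x)) (A₁ y)), ← hD, h1, inner_self_eq_norm_sq_to_K]; simp [sq]
      rw [h3]
      refine (norm_inner_le_norm _ _).trans ?_
      have h4 := h₂ (Q x) (hQv x)
      have h5 := h₁ y (hQv _)
      calc _ ≤ (c * ‖Q x‖) * (c * ‖y‖) := mul_le_mul h4 h5 (norm_nonneg _) (by positivity)
        _ ≤ (c * ‖x‖) * (c * ‖y‖) := by gcongr; exact hQn x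
        _ = _ := by ring
    rcases (norm_nonneg y).eq_or_lt with h0 | h0
    · rw [← h0]; positivity
    · exact le_of_mul_le_mul_right h2 h0

/-- The choice `M = ⌊(k / 2)^(1/n)⌋` gives `s k = O(k^(-1/n))`, and `p / n > 1`. The sum is shifted
by one index to avoid dividing by zero at `k = 0`. -/
lemma summable_rpow_of_le_div [NeZero n] {s : ℕ → ℝ} (hs : ∀ k, 0 ≤ s k) {c p : ℝ} (hp : (n : ℝ) < p)
    (h : ∀ M k : ℕ, 2 * M ^ n ≤ k → s k ≤ c / (M + 1)) : Summable fun k => s k ^ p := by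
  have hn : (0 : ℝ) < n := by exact_mod_cast NeZero.pos n
  have hc : 0 ≤ c := by
    have := (hs (2 * 0 ^ n)).trans (h 0 _ le_rfl)
    simpa using this
  rw [← summable_nat_add_iff 1]
  have hsum : Summable fun k : ℕ => (c * 2 ^ (1 / (n : ℝ))) ^ p * ((k + 1 : ℕ) : ℝ) ^ (-(p / n)) := by
    refine Summable.mul_left _ ?_
    rw [summable_nat_add_iff 1 (f := fun k : ℕ => (k : ℝ) ^ (-(p / n)))]
    exact Real.summable_nat_rpow.2 (by rw [neg_lt_neg_iff, one_lt_div hn]; exact hp)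
  refine Summable.of_nonneg_of_le (fun k => Real.rpow_nonneg (hs _) _) (fun k => ?_) hsum
  set x : ℝ := (((k + 1 : ℕ) : ℝ) / 2) ^ (1 / (n : ℝ)) with hx
  have hx0 : 0 < x := by positivity
  have h1 : s (k + 1) ≤ c / (⌊x⌋₊ + 1) := by
    refine h _ _ ?_
    have h2 : (⌊x⌋₊ : ℝ) ^ n ≤ ((k + 1 : ℕ) : ℝ) / 2 := by
      refine (pow_le_pow_left₀ (Nat.cast_nonneg _) (Nat.floor_le hx0.le) n).trans (le_of_eq ?_)
      rw [hx, ← Real.rpow_natCast, ← Real.rpow_mul (by positivity), one_div_mul_cancel hn.ne', Real.rpow_one]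
    have : (2 * ⌊x⌋₊ ^ n : ℝ) ≤ ((k + 1 : ℕ) : ℝ) := by linarith
    exact_mod_cast this
  have h2 : s (k + 1) ≤ c / x := h1.trans (div_le_div_of_nonneg_left hc hx0 (Nat.lt_floor_add_one x).le)
  have hp0 : 0 < p := hn.trans hp
  refine (Real.rpow_le_rpow (hs _) h2 hp0.le).trans (le_of_eq ?_)
  rw [hx, Real.div_rpow (by positivity) zero_le_two, div_div_eq_mul_div, Real.div_rpow (by positivity) (by positivity),
    ← Real.rpow_mul (by positivity), Real.rpow_neg (by positivity), div_eq_mul_inv]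
  congr 3
  ring

end HilbertSpace

/-! ### Hankel type operators, commutators and essential normality -/

lemma coeFn_adjoint_mulCoord (k : Fin n) (f : L2 n) :
    (ContinuousLinearMap.adjoint (mulCoord k) f : Cn n → ℂ) =ᵐ[ballVol n] fun z => conj (z k) * f z := by
  have hm : MemLp (fun z : Cn n => conj (z k) * f z) 2 (ballVol n) := by
    refine MemLp.of_le (Lp.memLp f) (AEStronglyMeasurable.mul (Continuous.aestronglyMeasurable (by fun_prop))
      (Lp.aestronglyMeasurable f)) ?_
    filter_upwards [ae_mem_unitBall n] with z hz
    rw [norm_mul, RCLike.norm_conj]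
    exact mul_le_of_le_one_left (norm_nonneg _) ((PiLp.norm_apply_le z k).trans (mem_unitBall.1 hz).le)
  have : ContinuousLinearMap.adjoint (mulCoord k) f = hm.toLp _ := by
    refine ext_inner_right ℂ fun g => ?_
    rw [ContinuousLinearMap.adjoint_inner_left, L2.inner_def, L2.inner_def]
    refine integral_congr_ae ?_
    filter_upwards [coeFn_mulCoord k g, hm.coeFn_toLp] with z h1 h2
    rw [h1, h2]
    simp only [RCLike.inner_apply, map_mul, RCLike.conj_conj]
    ring
  rw [this]
  exact hm.coeFn_toLp

lemma inner_adjoint_mulCoord_adjoint_mulCoord (i j : Fin n) (f g : L2 n) :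
    inner ℂ (ContinuousLinearMap.adjoint (mulCoord j) f) (ContinuousLinearMap.adjoint (mulCoord i) g) =
      inner ℂ (mulCoord i f) (mulCoord j g) := by
  rw [L2.inner_def, L2.inner_def]
  refine integral_congr_ae ?_
  filter_upwards [coeFn_mulCoord i f, coeFn_mulCoord j g, coeFn_adjoint_mulCoord j f, coeFn_adjoint_mulCoord i g]
    with z h1 h2 h3 h4
  rw [h1, h2, h3, h4]
  simp only [RCLike.inner_apply, map_mul, RCLike.conj_conj]
  ring

namespace BergmanSubmodule

/-- The Hankel type operator `f ↦ (1 - P)(conj z_k f)` from the submodule to `L²`. -/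
def hankel (P : BergmanSubmodule n) (k : Fin n) : P.toSubmodule →L[ℂ] L2 n :=
  P.toSubmoduleᗮ.starProjection ∘L ContinuousLinearMap.adjoint (mulCoord k) ∘L P.toSubmodule.subtypeL

lemma coe_adjoint_R (P : BergmanSubmodule n) (k : Fin n) (f : P.toSubmodule) :
    ((ContinuousLinearMap.adjoint (P.R k) f : P.toSubmodule) : L2 n) =
      P.toSubmodule.starProjection (ContinuousLinearMap.adjoint (mulCoord k) (f : L2 n)) := by
  refine (Submodule.eq_starProjection_of_mem_of_inner_eq_zero (Submodule.coe_mem _) fun g hg => ?_).symm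
  rw [inner_sub_left, sub_eq_zero, ContinuousLinearMap.adjoint_inner_left]
  have := ContinuousLinearMap.adjoint_inner_left (P.R k) ⟨g, hg⟩ f
  rw [Submodule.coe_inner, Submodule.coe_inner] at this
  exact this.symm

/-- The adjoint of `R_k` is the compression of multiplication by `conj z_k`. So `⟨R_j^* f, R_i^* g⟩`
is the part inside the submodule of `⟨conj z_j f, conj z_i g⟩`, whereas `⟨R_i f, R_j g⟩` is all of
it, by commutation of multiplications on `L²`; the difference is minus the part in the orthogonal
complement. -/
lemma inner_commutator (P : BergmanSubmodule n) (i j : Fin n) (f g : P.toSubmodule) :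
    inner ℂ (((P.R i).comp (ContinuousLinearMap.adjoint (P.R j)) -
      (ContinuousLinearMap.adjoint (P.R j)).comp (P.R i)) f) g = -inner ℂ (P.hankel j f) (P.hankel i g) := by
  have h1 : inner ℂ ((P.R i) (ContinuousLinearMap.adjoint (P.R j) f)) g =
      inner ℂ (P.toSubmodule.starProjection (ContinuousLinearMap.adjoint (mulCoord j) (f : L2 n)))
        (P.toSubmodule.starProjection (ContinuousLinearMap.adjoint (mulCoord i) (g : L2 n))) := by
    rw [← ContinuousLinearMap.adjoint_inner_right, Submodule.coe_inner, coe_adjoint_R, coe_adjoint_R]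
  have h2 : inner ℂ (ContinuousLinearMap.adjoint (P.R j) (P.R i f)) g =
      inner ℂ (mulCoord i (f : L2 n)) (mulCoord j (g : L2 n)) := by
    rw [ContinuousLinearMap.adjoint_inner_left]; rfl
  have h3 : ∀ a b : L2 n, inner ℂ a b = inner ℂ (P.toSubmodule.starProjection a) (P.toSubmodule.starProjection b) +
      inner ℂ (P.toSubmoduleᗮ.starProjection a) (P.toSubmoduleᗮ.starProjection b) := by
    intro a b
    rw [Submodule.inner_starProjection_left_eq_right, Submodule.inner_starProjection_left_eq_right,
      ← inner_add_right]
    congr 1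
    have e1 : ∀ (K : Submodule ℂ (L2 n)) [K.HasOrthogonalProjection], K.starProjection (K.starProjection b) = K.starProjection b :=
      fun K _ => Submodule.starProjection_eq_self_iff.2 (K.starProjection_apply_mem _)
    rw [e1, e1, Submodule.starProjection_add_starProjection_orthogonal]
  rw [sub_apply, inner_sub_left, ContinuousLinearMap.comp_apply, ContinuousLinearMap.comp_apply,
    h1, h2, ← inner_adjoint_mulCoord_adjoint_mulCoord, h3 (ContinuousLinearMap.adjoint (mulCoord j) (f : L2 n))]
  simp only [hankel, ContinuousLinearMap.comp_apply, Submodule.subtypeL_apply]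
  ring

lemma exists_norm_hankel_le [NeZero n] (P : BergmanSubmodule n) {Λ : Type*} [Countable Λ]
    {h : Λ → Cn n → ℂ} (hd : P.AsympStableDivision h) {C : ℝ} {N : ℕ} (hC : 0 ≤ C)
    (hK : ∀ i, KeyInequality (h i) C N) :
    ∃ (T : P.toSubmodule ≃L[ℂ] P.toSubmodule) (A : ℝ≥0), ∀ (f : P.toSubmodule) (k : Fin n),
      ENNReal.ofReal (‖P.hankel k (T f)‖ ^ 2) ≤
        A * ∫⁻ z, ‖(f : L2 n) z‖ₑ ^ 2 * ENNReal.ofReal (1 - ‖z‖ ^ 2) ∂(ballVol n) := by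
  obtain ⟨T, A, hT⟩ := exists_enorm_integral_conj_coord_le P hd hC hK
  refine ⟨T, A, fun f k => ?_⟩
  -- Duality: tested against the Hankel image itself, the pairing equals `‖φ‖²`, and one factor
  -- `‖φ‖²` cancels from the squared estimate.
  set φ := P.hankel k (T f) with hφ
  have hφP : φ ∈ P.toSubmoduleᗮ := Submodule.starProjection_apply_mem _ _
  have h1 := hT f φ hφP k
  have h2 : ∫ z, conj (z k) * (T f : L2 n) z * conj (φ z) ∂(ballVol n) = ((‖φ‖ ^ 2 : ℝ) : ℂ) := by
    have h3 : inner ℂ φ (ContinuousLinearMap.adjoint (mulCoord k) (T f : L2 n)) = ((‖φ‖ ^ 2 : ℝ) : ℂ) := by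
      have : inner ℂ φ (ContinuousLinearMap.adjoint (mulCoord k) (T f : L2 n)) = inner ℂ φ φ := by
        have e : φ = P.toSubmoduleᗮ.starProjection φ := (Submodule.starProjection_eq_self_iff.2 hφP).symm
        conv_lhs => rw [e]
        rw [Submodule.inner_starProjection_left_eq_right]
        rfl
      rw [this, inner_self_eq_norm_sq_to_K]; push_cast; rfl
    rw [← h3, L2.inner_def]
    refine integral_congr_ae ?_
    filter_upwards [coeFn_adjoint_mulCoord k (T f : L2 n)] with z hz
    rw [hz, RCLike.inner_apply]
  rw [h2] at h1
  have h4 : ‖((‖φ‖ ^ 2 : ℝ) : ℂ)‖ₑ = ENNReal.ofReal (‖φ‖ ^ 2) := by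
    rw [← ofReal_norm, Complex.norm_real, Real.norm_of_nonneg (by positivity)]
  rw [h4, sq (ENNReal.ofReal (‖φ‖ ^ 2))] at h1
  by_cases h0 : ENNReal.ofReal (‖φ‖ ^ 2) = 0
  · rw [h0]; exact zero_le
  · exact (ENNReal.mul_le_mul_iff_left h0 ENNReal.ofReal_ne_top).1 h1

/-- The class in `L²` of a monomial. -/
def monomialL2 {M : ℕ} (α : Fin n → Fin M) : L2 n :=
  MemLp.toLp (fun z : Cn n => ∏ k, z k ^ (α k : ℕ)) (by
    refine MemLp.of_bound (Continuous.aestronglyMeasurable (by fun_prop)) 1 ?_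
    filter_upwards [ae_mem_unitBall n] with z hz
    rw [norm_prod]
    refine Finset.prod_le_one (fun _ _ => norm_nonneg _) fun k _ => ?_
    rw [norm_pow]
    exact pow_le_one₀ (norm_nonneg _) ((PiLp.norm_apply_le z k).trans (mem_unitBall.1 hz).le))

lemma inner_monomialL2 {M : ℕ} (α : Fin n → Fin M) (f : L2 n) :
    inner ℂ (monomialL2 α) f = ∫ z, f z * conjMonomial α z ∂(ballVol n) := by
  rw [L2.inner_def]
  refine integral_congr_ae ?_
  filter_upwards [MemLp.coeFn_toLp (f := fun z : Cn n => ∏ k, z k ^ (α k : ℕ)) (p := 2) (μ := ballVol n) _] with z hz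
  rw [monomialL2, hz, RCLike.inner_apply, conjMonomial, map_prod]
  simp only [map_pow]

lemma lintegral_weighted_le_of_inner_eq_zero [NeZero n] {f : L2 n} (hf : f ∈ bergman n) {M : ℕ}
    (h : ∀ α : Fin n → Fin M, inner ℂ (monomialL2 α) f = 0) :
    ∫⁻ z, ‖f z‖ₑ ^ 2 * ENNReal.ofReal (1 - ‖z‖ ^ 2) ∂(ballVol n) ≤ ENNReal.ofReal (1 / (M + 1) * ‖f‖ ^ 2) := by
  obtain ⟨F, hF, hfF⟩ := hf
  have hFI : Integrable F (ballVol n) := ((Lp.memLp f).integrable one_le_two).congr hfF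
  have h0 : ∀ α : Fin n → Fin M, ∫ z, F z * conjMonomial α z ∂(ballVol n) = 0 := by
    intro α
    rw [← h α, inner_monomialL2]
    refine integral_congr_ae ?_
    filter_upwards [hfF] with z hz
    rw [hz]
  have h1 := lintegral_weighted_le hF (M := M) fun e he m hm => sliceCoeff_eq_zero hF hFI h0 he hm
  rw [ENNReal.ofReal_mul (by positivity), ← lintegral_enorm_sq_eq]
  have e1 : ∫⁻ z, ‖f z‖ₑ ^ 2 ∂(ballVol n) = ∫⁻ z, ‖F z‖ₑ ^ 2 ∂(ballVol n) :=
    lintegral_congr_ae (hfF.mono fun z hz => by simp only [hz])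
  have e2 : ∫⁻ z, ‖f z‖ₑ ^ 2 * ENNReal.ofReal (1 - ‖z‖ ^ 2) ∂(ballVol n) =
      ∫⁻ z, ‖F z‖ₑ ^ 2 * ENNReal.ofReal (1 - ‖z‖ ^ 2) ∂(ballVol n) :=
    lintegral_congr_ae (hfF.mono fun z hz => by simp only [hz])
  rw [e1, e2]
  exact h1

/-- Essential normality from division with a uniform key inequality. -/
theorem essentiallyNormal_of_keyInequality [NeZero n] (P : BergmanSubmodule n) {Λ : Type*} [Countable Λ]
    {h : Λ → Cn n → ℂ} (hd : P.AsympStableDivision h) {C : ℝ} {N : ℕ} (hC : 0 ≤ C)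
    (hK : ∀ i, KeyInequality (h i) C N) {p : ℝ} (hp : (n : ℝ) < p) : P.EssentiallyNormal p := by
  intro i j
  obtain ⟨T, A, hT⟩ := exists_norm_hankel_le P hd hC hK
  set B : ℝ := A * ‖(T.symm : P.toSubmodule →L[ℂ] P.toSubmodule)‖ ^ 2 with hB
  refine summable_rpow_of_le_div (c := B) (singularNumber_nonneg _) hp fun M k hk => ?_
  -- Orthogonality of `x` to these `M^n` vectors is orthogonality of `T⁻¹ x` to the monomials, and
  -- the Hankel estimate is available for `T` applied to `T⁻¹ x`.
  set v : (Fin n → Fin M) → P.toSubmodule := fun α =>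
    ContinuousLinearMap.adjoint (T.symm : P.toSubmodule →L[ℂ] P.toSubmodule)
      (P.toSubmodule.orthogonalProjectionOnto (monomialL2 α)) with hv
  have key : ∀ (k : Fin n) (x : P.toSubmodule), (∀ α, inner ℂ (v α) x = 0) →
      ‖P.hankel k x‖ ≤ √(B / (M + 1)) * ‖x‖ := by
    intro k x hx
    have h1 := hT (T.symm x) k
    rw [ContinuousLinearEquiv.apply_symm_apply] at h1
    have h2 : ∀ α : Fin n → Fin M, inner ℂ (monomialL2 α) ((T.symm x : P.toSubmodule) : L2 n) = 0 := by
      intro α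
      have := hx α
      rw [hv, ContinuousLinearMap.adjoint_inner_left, Submodule.coe_inner] at this
      rw [← this, ContinuousLinearEquiv.coe_coe, Submodule.coe_orthogonalProjectionOnto_apply,
        Submodule.inner_starProjection_left_eq_right, Submodule.starProjection_eq_self_iff.2 (T.symm x).2]
    have h3 := h1.trans (mul_le_mul_right (lintegral_weighted_le_of_inner_eq_zero
      (P.le_bergman (T.symm x).2) h2) _)
    rw [← ENNReal.ofReal_coe_nnreal, ← ENNReal.ofReal_mul (by positivity),
      ENNReal.ofReal_le_ofReal_iff (by positivity)] at h3
    have h4 : ‖((T.symm x : P.toSubmodule) : L2 n)‖ ≤ ‖(T.symm : P.toSubmodule →L[ℂ] P.toSubmodule)‖ * ‖x‖ :=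
      (T.symm : P.toSubmodule →L[ℂ] P.toSubmodule).le_opNorm x
    refine le_of_sq_le_sq ?_ (by positivity)
    rw [mul_pow, Real.sq_sqrt (by positivity)]
    calc _ ≤ _ := h3
      _ ≤ A * (1 / (M + 1) * (‖(T.symm : P.toSubmodule →L[ℂ] P.toSubmodule)‖ * ‖x‖) ^ 2) := by gcongr
      _ = _ := by rw [hB]; field_simp
  refine (singularNumber_le_of_form (P.inner_commutator i j) v (Real.sqrt_nonneg (B / (M + 1))) (key i) (key j)
    (by simpa using hk)).trans (le_of_eq (Real.sq_sqrt (by positivity)))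

end BergmanSubmodule

/-! ### A Bernstein–Walsh estimate -/

/-- The roots are moved into `φ` one by one, each costing a factor `1 + |x|`, until the maximum
principle applies. A root with `|a| ≥ 1` is moved as `ζ - a`, of modulus `|a|` at `0`, and `|x - a|
≤ (1 + |x|) |a|`. A root with `|a| < 1` is moved as `1 - conj a · ζ`, of the same modulus on the
circle and equal to `1` at `0`. -/
lemma norm_prod_sub_mul_le (s : Multiset ℂ) (x : ℂ) {M : ℝ} : ∀ {φ : ℂ → ℂ},
    DifferentiableOn ℂ φ (Metric.closedBall 0 1) →
    (∀ ζ : ℂ, ‖ζ‖ = 1 → ‖(s.map (ζ - ·)).prod * φ ζ‖ ≤ M) →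
    ‖(s.map (x - ·)).prod * φ 0‖ ≤ (1 + ‖x‖) ^ s.card * M := by
  induction s using Multiset.induction with
  | empty =>
    intro φ hφ h
    simp only [Multiset.map_zero, Multiset.prod_zero, one_mul, Multiset.card_zero, pow_zero] at h ⊢
    have hc : DiffContOnCl ℂ φ (Metric.ball 0 1) :=
      DifferentiableOn.diffContOnCl (by rwa [closure_ball _ one_ne_zero])
    refine Complex.norm_le_of_forall_mem_frontier_norm_le Metric.isBounded_ball hc (fun ζ hζ => ?_)
      (subset_closure (Metric.mem_ball_self one_pos))
    rw [frontier_ball _ one_ne_zero, mem_sphere_zero_iff_norm] at hζ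
    exact h ζ hζ
  | cons a s ih =>
    intro φ hφ h
    simp only [Multiset.map_cons, Multiset.prod_cons, Multiset.card_cons] at h ⊢
    have hM : 0 ≤ (1 + ‖x‖) ^ s.card * M :=
      mul_nonneg (by positivity) ((norm_nonneg _).trans (h 1 norm_one))
    rcases le_or_gt 1 ‖a‖ with ha | ha
    · have h1 := ih (φ := fun ζ => φ ζ * (ζ - a)) (hφ.mul (by fun_prop)) fun ζ hζ => by
        refine le_of_eq_of_le ?_ (h ζ hζ); congr 1; ring
      simp only [zero_sub] at h1
      have h2 : ‖x - a‖ ≤ (1 + ‖x‖) * ‖a‖ := by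
        refine (norm_sub_le _ _).trans ?_
        nlinarith [norm_nonneg x]
      calc ‖(x - a) * (s.map (x - ·)).prod * φ 0‖ = ‖x - a‖ * ‖(s.map (x - ·)).prod * φ 0‖ := by
            rw [mul_assoc, norm_mul]
        _ ≤ (1 + ‖x‖) * ‖a‖ * ‖(s.map (x - ·)).prod * φ 0‖ := by gcongr
        _ = (1 + ‖x‖) * ‖(s.map (x - ·)).prod * (φ 0 * -a)‖ := by
            rw [← mul_assoc (Multiset.prod _), norm_mul _ (-a), norm_neg]; ring
        _ ≤ (1 + ‖x‖) * ((1 + ‖x‖) ^ s.card * M) := by gcongr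
        _ = _ := by ring
    · have h1 := ih (φ := fun ζ => φ ζ * (1 - conj a * ζ)) (hφ.mul (by fun_prop)) fun ζ hζ => by
        refine le_of_eq_of_le ?_ (h ζ hζ)
        have h3 : ‖1 - conj a * ζ‖ = ‖ζ - a‖ := by
          have h4 : ζ * conj ζ = 1 := by rw [Complex.mul_conj, Complex.normSq_eq_norm_sq, hζ]; simp
          have h5 : 1 - conj a * ζ = ζ * conj (ζ - a) := by rw [map_sub, mul_sub, h4]; ring
          rw [h5, norm_mul, RCLike.norm_conj, hζ, one_mul]
        rw [← mul_assoc, norm_mul, h3, mul_assoc, norm_mul (ζ - a)]; ring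
      simp only [mul_zero, sub_zero, mul_one] at h1
      have h2 : ‖x - a‖ ≤ 1 + ‖x‖ := by
        refine (norm_sub_le _ _).trans ?_
        linarith
      calc ‖(x - a) * (s.map (x - ·)).prod * φ 0‖ = ‖x - a‖ * ‖(s.map (x - ·)).prod * φ 0‖ := by
            rw [mul_assoc, norm_mul]
        _ ≤ (1 + ‖x‖) * ((1 + ‖x‖) ^ s.card * M) := mul_le_mul h2 h1 (norm_nonneg _) (by positivity)
        _ = _ := by ring

/-- A Bernstein–Walsh type estimate for the product of a polynomial and a holomorphic function. -/
lemma norm_eval_mul_le {p : Polynomial ℂ} {d : ℕ} (hp : p.natDegree ≤ d) (x : ℂ) {φ : ℂ → ℂ}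
    (hφ : DifferentiableOn ℂ φ (Metric.closedBall 0 1)) {M : ℝ}
    (h : ∀ ζ : ℂ, ‖ζ‖ = 1 → ‖p.eval ζ * φ ζ‖ ≤ M) : ‖p.eval x * φ 0‖ ≤ (1 + ‖x‖) ^ d * M := by
  have hs := (IsAlgClosed.splits p).eval_eq_prod_roots
  have h1 := norm_prod_sub_mul_le p.roots x (φ := fun ζ => p.leadingCoeff * φ ζ) (M := M) (hφ.const_mul _)
    fun ζ hζ => by
      refine le_of_eq_of_le ?_ (h ζ hζ)
      rw [hs]; congr 1; ring
  have hM : 0 ≤ M := (norm_nonneg _).trans (h 1 norm_one)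
  calc ‖p.eval x * φ 0‖ = ‖(p.roots.map (x - ·)).prod * (p.leadingCoeff * φ 0)‖ := by
        rw [hs]; congr 1; ring
    _ ≤ _ := h1
    _ ≤ _ := by
        refine mul_le_mul_of_nonneg_right (pow_le_pow_right₀ (by linarith [norm_nonneg x]) ?_) hM
        exact (Polynomial.card_roots' p).trans hp

/-! ### Ellipsoids in Bergman balls and the key inequality for polynomials -/

lemma aniso_aniso_inv {e : Cn n} (he : ‖e‖ = 1) {a b : ℂ} (ha : a ≠ 0) (hb : b ≠ 0) (w : Cn n) :
    aniso e a b (aniso e a⁻¹ b⁻¹ w) = w := by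
  rw [aniso_apply, inner_aniso he, aniso_apply, smul_add, smul_smul, smul_smul, mul_inv_cancel₀ hb, one_smul,
    add_assoc, ← add_smul]
  convert add_zero w
  convert zero_smul ℂ e
  field_simp
  ring

lemma lintegral_comp_aniso [NeZero n] {e : Cn n} (he : ‖e‖ = 1) {a b : ℝ} (ha : a ≠ 0) (hb : b ≠ 0)
    {Φ : Cn n → ℝ≥0∞} (hΦ : Measurable Φ) (x : Cn n) :
    ∫⁻ y, Φ (x + aniso e a b y) = (ENNReal.ofReal ((a * b ^ (n - 1)) ^ 2))⁻¹ * ∫⁻ y, Φ y := by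
  have hm : Measurable (aniso e (a : ℂ) (b : ℂ)) := (LinearMap.continuous_of_finiteDimensional _).measurable
  have hc : ENNReal.ofReal ((a * b ^ (n - 1)) ^ 2) ≠ 0 := by
    rw [Ne, ENNReal.ofReal_eq_zero, not_le]; positivity
  have hsurj : Function.Surjective (aniso e (a : ℂ) (b : ℂ)) := fun w =>
    ⟨_, aniso_aniso_inv he (by exact_mod_cast ha) (by exact_mod_cast hb) w⟩
  have hmap : Measure.map (aniso e (a : ℂ) (b : ℂ)) volume = (ENNReal.ofReal ((a * b ^ (n - 1)) ^ 2))⁻¹ • volume := by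
    ext s hs
    rw [Measure.map_apply hm hs, Measure.smul_apply, smul_eq_mul]
    have h := volume_image_aniso he a b (aniso e (a : ℂ) (b : ℂ) ⁻¹' s)
    rw [Set.image_preimage_eq _ hsurj] at h
    rw [h, ← mul_assoc, ENNReal.inv_mul_cancel hc ENNReal.ofReal_ne_top, one_mul]
  have hΦx : Measurable fun y => Φ (x + y) := hΦ.comp (measurable_const_add x)
  rw [← lintegral_add_left_eq_self Φ x, ← smul_eq_mul, ← lintegral_smul_measure, ← hmap, lintegral_map hΦx hm]

/-- A linear map taking the ball of radius `2` to an ellipsoid that, centred at `w`, lies in `D(w, 1)`. -/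
def discMap (w e : Cn n) : Cn n →ₗ[ℂ] Cn n :=
  aniso e (((1 - ‖w‖ ^ 2) / 16 : ℝ) : ℂ) ((√(1 - ‖w‖ ^ 2) / 16 : ℝ) : ℂ)

lemma kap_le_half : kap ≤ 1 / 2 := by
  have h1 : 1 ≤ Real.sinh 1 := Real.self_le_sinh_iff.2 zero_le_one
  have h2 := Real.cosh_sq 1
  have h3 := Real.cosh_pos 1
  rw [kap, Real.tanh_eq_sinh_div_cosh, div_pow, sub_le_comm, le_div_iff₀ (by positivity), h2]
  nlinarith

/-- With `D = 1 - |w|²`, displacements of size `O(D)` along `w` and `O(√D)` across keep `1 - |x|² ≥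
47D/64` and `|1 - ⟨x, w⟩| ≤ 9D/8`; then `kap ≤ 1/2` suffices, as `81/128 < 94/128`. Allowing `|v| ≤
2` leaves room for a unit ellipsoid about each point of the unit ellipsoid. -/
lemma add_discMap_mem {w e : Cn n} (hw : ‖w‖ < 1) (he : ‖e‖ = 1) (hwe : w = (‖w‖ : ℂ) • e) {v : Cn n}
    (hv : ‖v‖ ≤ 2) : w + discMap w e v ∈ bergmanDisc w 1 := by
  have hD := one_sub_norm_sq_pos hw
  set r := ‖w‖ with hr
  have hr0 : 0 ≤ r := norm_nonneg w
  set D := 1 - r ^ 2 with hDdef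
  have hD1 : D ≤ 1 := by rw [hDdef]; nlinarith
  have hα : ‖inner ℂ e v‖ ≤ ‖v‖ := by simpa [he] using norm_inner_le_norm (𝕜 := ℂ) e v
  have hin : inner ℂ w (discMap w e v) = ((r * (D / 16) : ℝ) : ℂ) * inner ℂ e v := by
    have h1 : ∀ y : Cn n, inner ℂ w y = (r : ℂ) * inner ℂ e y := fun y => by
      conv_lhs => rw [hwe, inner_smul_left, Complex.conj_ofReal]
    have h2 : discMap w e = aniso e ((D / 16 : ℝ) : ℂ) ((√D / 16 : ℝ) : ℂ) := rfl
    rw [h1, h2, inner_aniso he]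
    push_cast; ring
  have hinn : ‖inner ℂ w (discMap w e v)‖ ≤ D / 8 := by
    rw [hin, norm_mul, Complex.norm_real, Real.norm_of_nonneg (by positivity)]
    calc r * (D / 16) * ‖inner ℂ e v‖ ≤ 1 * (D / 16) * 2 := by gcongr; exact hα.trans hv
      _ = _ := by ring
  have hn : ‖discMap w e v‖ ^ 2 ≤ D / 64 := by
    rw [discMap, norm_aniso_sq he, Complex.norm_real, Complex.norm_real, Real.norm_of_nonneg (by positivity),
      Real.norm_of_nonneg (by positivity), div_pow (√_), Real.sq_sqrt hD.le]
    have h1 : ‖inner ℂ e v‖ ^ 2 ≤ ‖v‖ ^ 2 := by gcongr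
    have h2 : ‖v‖ ^ 2 ≤ 4 := by nlinarith [norm_nonneg v]
    have h3 : (D / 16) ^ 2 ≤ D / 16 ^ 2 := by rw [div_pow]; gcongr; nlinarith
    calc _ ≤ D / 16 ^ 2 * ‖inner ℂ e v‖ ^ 2 + D / 16 ^ 2 * (‖v‖ ^ 2 - ‖inner ℂ e v‖ ^ 2) := by gcongr
      _ = D / 16 ^ 2 * ‖v‖ ^ 2 := by ring
      _ ≤ D / 16 ^ 2 * 4 := by gcongr
      _ = _ := by ring
  have hx : ‖w + discMap w e v‖ ^ 2 ≤ 1 - D * (47 / 64) := by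
    rw [norm_add_sq (𝕜 := ℂ)]
    have h1 := (Complex.re_le_norm (inner ℂ w (discMap w e v))).trans hinn
    simp only [RCLike.re_to_complex]
    have : ‖w‖ ^ 2 = 1 - D := by rw [hDdef]; ring
    rw [this]
    linarith
  have hx1 : ‖w + discMap w e v‖ < 1 := by
    have : ‖w + discMap w e v‖ ^ 2 < 1 := by linarith
    nlinarith [norm_nonneg (w + discMap w e v)]
  rw [mem_bergmanDisc_iff hw]
  refine ⟨hx1, ?_⟩
  have h1 : ‖1 - inner ℂ w (w + discMap w e v)‖ ≤ D * (9 / 8) := by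
    have : 1 - inner ℂ w (w + discMap w e v) = (D : ℂ) - inner ℂ w (discMap w e v) := by
      rw [inner_add_right, inner_self_eq_norm_sq_to_K, hDdef]; push_cast; rw [← hr]
      simp only [Complex.coe_algebraMap]; ring
    rw [this]
    refine (norm_sub_le _ _).trans ?_
    rw [Complex.norm_real, Real.norm_of_nonneg hD.le]
    linarith
  calc kap * ‖1 - inner ℂ w (w + discMap w e v)‖ ^ 2 ≤ 1 / 2 * (D * (9 / 8)) ^ 2 := by
        have := kap_le_half
        gcongr
    _ < D * (D * (47 / 64)) := by nlinarith
    _ ≤ _ := by gcongr; linarith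

lemma integral_ballVol_eq [NeZero n] {G : Cn n → ℂ} (hG : IsHolo G) (hI : Integrable G (ballVol n)) :
    ∫ y, G y ∂(ballVol n) = G 0 := by
  have h := integral_reproducing hG 0 (by simpa using hI) (z := 0) (by simp)
  simpa [Nat.factorial_ne_zero] using h

lemma bergmanDisc_subset_unitBall {w : Cn n} : bergmanDisc w 1 ⊆ unitBall n := fun _ h => h.1

/-- Sub-mean value property on ellipsoids comparable to `D(w, 1)`. -/
lemma enorm_le_lintegral_bergmanDisc [NeZero n] {F : Cn n → ℂ} (hF : IsHolo F) {w e : Cn n} (hw : ‖w‖ < 1)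
    (he : ‖e‖ = 1) (hwe : w = (‖w‖ : ℂ) • e) {u : Cn n} (hu : ‖u‖ ≤ 1) :
    ‖F (w + discMap w e u)‖ₑ ≤ ENNReal.ofReal (16 ^ (2 * n) / (1 - ‖w‖ ^ 2) ^ (n + 1)) *
      ∫⁻ x in bergmanDisc w 1, ‖F x‖ₑ ∂(ballVol n) := by
  have hD := one_sub_norm_sq_pos hw
  set G : Cn n → ℂ := fun y => F (w + discMap w e u + discMap w e y) with hGdef
  have hmem : ∀ y : Cn n, ‖y‖ ≤ 1 → w + discMap w e u + discMap w e y ∈ bergmanDisc w 1 := by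
    intro y hy
    rw [add_assoc, ← map_add]
    exact add_discMap_mem hw he hwe ((norm_add_le _ _).trans (by linarith))
  have hdiff : Differentiable ℂ fun y => w + discMap w e u + discMap w e y :=
    (LinearMap.toContinuousLinearMap (discMap w e)).differentiable.const_add _
  have hGd : DifferentiableOn ℂ G (Metric.closedBall 0 1) :=
    DifferentiableOn.comp hF hdiff.differentiableOn fun y hy =>
      bergmanDisc_subset_unitBall (hmem y (mem_closedBall_zero_iff.1 hy))
  have hG : IsHolo G := hGd.mono Metric.ball_subset_closedBall
  have hGI : Integrable G (ballVol n) := by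
    obtain ⟨B, hB⟩ := (isCompact_closedBall (0 : Cn n) 1).exists_bound_of_continuousOn hGd.continuousOn
    refine Integrable.of_bound (aestronglyMeasurable_of_isHolo hG) B ?_
    filter_upwards [ae_mem_unitBall n] with y hy
    exact hB y (Metric.ball_subset_closedBall hy)
  have h0 := integral_ballVol_eq hG hGI
  have hG0 : G 0 = F (w + discMap w e u) := by simp [hGdef]
  rw [← hG0, ← h0]
  refine (enorm_integral_le_lintegral_enorm _).trans ?_
  set Φ : Cn n → ℝ≥0∞ := (bergmanDisc w 1).indicator fun y => ‖(unitBall n).indicator F y‖ₑ with hΦ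
  have hΦm : Measurable Φ := (measurable_indicator_of_isHolo hF).enorm.indicator (measurableSet_bergmanDisc hw)
  -- The real Jacobian of `discMap` is `(1 - |w|²)^(n+1) / 16^(2n)`.
  have hc : ENNReal.ofReal (16 ^ (2 * n) / (1 - ‖w‖ ^ 2) ^ (n + 1)) =
      (ENNReal.ofReal (((1 - ‖w‖ ^ 2) / 16 * (√(1 - ‖w‖ ^ 2) / 16) ^ (n - 1)) ^ 2))⁻¹ := by
    rw [← ENNReal.ofReal_inv_of_pos (by positivity)]
    congr 1
    have e1 : ((√(1 - ‖w‖ ^ 2) / 16) ^ (n - 1)) ^ 2 = ((1 - ‖w‖ ^ 2) / 16 ^ 2) ^ (n - 1) := by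
      rw [← pow_mul, mul_comm, pow_mul, div_pow, Real.sq_sqrt hD.le]
    rw [mul_pow, e1]
    obtain ⟨m, rfl⟩ := Nat.exists_eq_succ_of_ne_zero (NeZero.ne n)
    simp only [Nat.succ_eq_add_one, Nat.add_sub_cancel]
    rw [div_pow, div_pow, ← pow_mul]
    field_simp
    ring
  have hrestr : (ballVol n).restrict (bergmanDisc w 1) =
      (volume (unitBall n))⁻¹ • (volume : Measure (Cn n)).restrict (bergmanDisc w 1) := by
    rw [ballVol, Measure.restrict_smul, Measure.restrict_restrict (measurableSet_bergmanDisc hw),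
      Set.inter_eq_left.2 bergmanDisc_subset_unitBall]
  rw [hc, hrestr, lintegral_smul_measure, smul_eq_mul, mul_left_comm, ballVol, lintegral_smul_measure, smul_eq_mul]
  refine mul_le_mul_right ?_ _
  have hΦi : ∫⁻ x in bergmanDisc w 1, ‖F x‖ₑ = ∫⁻ x, Φ x := by
    rw [hΦ, lintegral_indicator (measurableSet_bergmanDisc hw)]
    refine setLIntegral_congr_fun (measurableSet_bergmanDisc hw) fun x hx => ?_
    rw [Set.indicator_of_mem (bergmanDisc_subset_unitBall hx)]
  have hs : √(1 - ‖w‖ ^ 2) ≠ 0 := (Real.sqrt_pos.2 hD).ne'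
  rw [hΦi, ← lintegral_comp_aniso he (by positivity) (by positivity) hΦm (w + discMap w e u)]
  refine le_trans (setLIntegral_mono' measurableSet_unitBall fun y hy => ?_) (setLIntegral_le_lintegral (unitBall n) _)
  have h1 := hmem y (mem_unitBall.1 hy).le
  have h2 : Φ (w + discMap w e u + discMap w e y) = ‖G y‖ₑ := by
    rw [hΦ, Set.indicator_of_mem h1, Set.indicator_of_mem (bergmanDisc_subset_unitBall h1)]
  exact h2.ge

/-- The Bergman ball is relatively compact: on it `1 - |x|² ≥ kap (1 - |w|²) / 4`. -/
lemma integrableOn_bergmanDisc {F : Cn n → ℂ} (hF : IsHolo F) {w : Cn n} (hw : ‖w‖ < 1) :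
    IntegrableOn F (bergmanDisc w 1) (ballVol n) := by
  have hD := one_sub_norm_sq_pos hw
  have hk := kap_pos
  set R := √(1 - kap * (1 - ‖w‖ ^ 2) / 4) with hR
  have hR1 : R < 1 := by
    rw [hR, Real.sqrt_lt' one_pos]
    have : 0 < kap * (1 - ‖w‖ ^ 2) := by positivity
    linarith
  have hsub : bergmanDisc w 1 ⊆ Metric.closedBall 0 R := by
    intro x hx
    have hx1 : ‖x‖ < 1 := mem_unitBall.1 (bergmanDisc_subset_unitBall hx)
    have h1 := bergmanDisc_one_sub_le hx1 ((mem_bergmanDisc_comm hw hx1).1 hx)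
    rw [mem_closedBall_zero_iff, hR]
    exact Real.le_sqrt_of_sq_le (by linarith)
  have hcont : ContinuousOn F (Metric.closedBall 0 R) :=
    hF.continuousOn.mono (Metric.closedBall_subset_ball hR1)
  exact (hcont.integrableOn_compact (isCompact_closedBall _ _)).mono_set hsub

/-- Contracting the segment from `w` to `z` by a multiple of `(1 - |w|²) / |1 - ⟨z, w⟩|` brings its
end into the ellipsoid. With `t = |1 - ⟨z, w⟩|` the displacement is at most `6t` along `e` and at
most `√(2t)` in all; `112 = 16 · 7` works because `36 + 4 ≤ 7²`. -/
lemma exists_discMap_eq {z w e : Cn n} (hz : ‖z‖ < 1) (hw : ‖w‖ < 1) (he : ‖e‖ = 1) (hwe : w = (‖w‖ : ℂ) • e) :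
    ∃ u : Cn n, ‖u‖ ≤ 1 ∧
      discMap w e u = (((1 - ‖w‖ ^ 2) / (112 * ‖1 - inner ℂ w z‖) : ℝ) : ℂ) • (z - w) := by
  have hD := one_sub_norm_sq_pos hw
  have ht := norm_one_sub_inner_pos hz hw
  have htD := one_sub_norm_sq_le hz.le hw.le
  have hsub := norm_sub_sq_le hz.le hw.le
  have hr1 : 1 - ‖w‖ ≤ ‖1 - inner ℂ w z‖ := one_sub_norm_le_norm_one_sub_inner hz.le
  have hinw : ‖inner ℂ w (z - w)‖ ≤ 3 * ‖1 - inner ℂ w z‖ := by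
    have h1 : inner ℂ w (z - w) = ((1 - ‖w‖ ^ 2 : ℝ) : ℂ) - (1 - inner ℂ w z) := by
      rw [inner_sub_right, inner_self_eq_norm_sq_to_K]; push_cast
      simp only [Complex.coe_algebraMap]; ring
    rw [h1]
    refine (norm_sub_le _ _).trans ?_
    rw [Complex.norm_real, Real.norm_of_nonneg hD.le]
    linarith
  have hzw : ‖z - w‖ ≤ 2 := (norm_sub_le _ _).trans (by linarith)
  have hα : ‖inner ℂ e (z - w)‖ ≤ 6 * ‖1 - inner ℂ w z‖ := by
    -- When `w` is near the origin its direction carries no information, but then `t ≥ 1/2` and the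
    -- trivial bound `|z - w| ≤ 2` is enough.
    rcases le_or_gt ‖w‖ (1 / 2) with h | h
    · have : ‖inner ℂ e (z - w)‖ ≤ ‖z - w‖ := by
        simpa only [he, one_mul] using norm_inner_le_norm (𝕜 := ℂ) e (z - w)
      linarith
    · have h2 : ‖inner ℂ w (z - w)‖ = ‖w‖ * ‖inner ℂ e (z - w)‖ := by
        have h3 : ∀ y : Cn n, inner ℂ w y = (‖w‖ : ℂ) * inner ℂ e y := fun y => by
          conv_lhs => rw [hwe, inner_smul_left, Complex.conj_ofReal]
        rw [h3, norm_mul, Complex.norm_real, norm_norm]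
      rw [h2] at hinw
      nlinarith [norm_nonneg (inner ℂ e (z - w))]
  set D := 1 - ‖w‖ ^ 2 with hDdef
  set t := ‖1 - inner ℂ w z‖ with htdef
  have hs : 0 < √D := Real.sqrt_pos.2 hD
  have ha : ((D / 16 : ℝ) : ℂ) ≠ 0 := by exact_mod_cast (by positivity : D / 16 ≠ 0)
  have hb : ((√D / 16 : ℝ) : ℂ) ≠ 0 := by exact_mod_cast (by positivity : √D / 16 ≠ 0)
  refine ⟨aniso e ((D / 16 : ℝ) : ℂ)⁻¹ ((√D / 16 : ℝ) : ℂ)⁻¹ (((D / (112 * t) : ℝ) : ℂ) • (z - w)), ?_,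
    aniso_aniso_inv he ha hb _⟩
  rw [← sq_le_one_iff₀ (norm_nonneg _), norm_aniso_sq he, inner_smul_right, norm_smul, norm_mul, norm_inv, norm_inv,
    Complex.norm_real, Complex.norm_real, Complex.norm_real, Real.norm_of_nonneg (by positivity),
    Real.norm_of_nonneg (by positivity), Real.norm_of_nonneg (by positivity), inv_pow, inv_pow, div_pow (√D),
    Real.sq_sqrt hD.le]
  set α := ‖inner ℂ e (z - w)‖ with hαdef
  have hα0 : 0 ≤ α := norm_nonneg _
  have e1 : ((D / 16) ^ 2)⁻¹ * (D / (112 * t) * α) ^ 2 + (D / 16 ^ 2)⁻¹ * ((D / (112 * t) * ‖z - w‖) ^ 2 -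
      (D / (112 * t) * α) ^ 2) = α ^ 2 / (49 * t ^ 2) + D * (‖z - w‖ ^ 2 - α ^ 2) / (49 * t ^ 2) := by
    field_simp; ring
  rw [e1, ← add_div, div_le_one (by positivity)]
  have h1 : α ^ 2 ≤ 36 * t ^ 2 := by nlinarith
  have h2 : D * (‖z - w‖ ^ 2 - α ^ 2) ≤ 4 * t ^ 2 := by
    have : D * (‖z - w‖ ^ 2 - α ^ 2) ≤ (2 * t) * (2 * t) :=
      (mul_le_mul_of_nonneg_left (by nlinarith : ‖z - w‖ ^ 2 - α ^ 2 ≤ 2 * t) hD.le).trans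
        (mul_le_mul_of_nonneg_right htD (by positivity))
    nlinarith
  nlinarith

/-- Restriction of a polynomial in several variables to a complex line. -/
lemma exists_polynomial_eval_line (q : MvPolynomial (Fin n) ℂ) {d : ℕ} (hq : q.totalDegree ≤ d) (w v : Cn n) :
    ∃ p : Polynomial ℂ, p.natDegree ≤ d ∧
      ∀ ζ : ℂ, p.eval ζ = MvPolynomial.eval (fun k => (w + ζ • v) k) q := by
  have key : ∀ ζ : ℂ, (Polynomial.evalRingHom ζ).comp
      (MvPolynomial.aeval fun k => Polynomial.C (w k) + Polynomial.X * Polynomial.C (v k)).toRingHom =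
      MvPolynomial.eval fun k => (w + ζ • v) k := fun ζ => by
    ext k
    · simp
    · simp [mul_comm (v k)]
  refine ⟨MvPolynomial.aeval (fun k => Polynomial.C (w k) + Polynomial.X * Polynomial.C (v k)) q, ?_, fun ζ => ?_⟩
  · have := MvPolynomial.aeval_natDegree_le q hq
      (fun k => Polynomial.C (w k) + Polynomial.X * Polynomial.C (v k)) (n := 1) fun k => by compute_degree
    simpa using this
  · exact RingHom.congr_fun (key ζ) q

lemma isHolo_mvPolynomial (q : MvPolynomial (Fin n) ℂ) :
    IsHolo fun z : Cn n => MvPolynomial.eval (fun k => z k) q := by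
  have := AnalyticOnNhd.eval_continuousLinearMap' (fun k => (EuclideanSpace.proj k : Cn n →L[ℂ] ℂ)) q
  exact (this.differentiableOn).mono (Set.subset_univ _)

/-- Polynomials satisfy the key inequality with constants depending only on the degree. -/
lemma keyInequality_mvPolynomial [NeZero n] (q : MvPolynomial (Fin n) ℂ) {d : ℕ} (hq : q.totalDegree ≤ d) :
    KeyInequality (fun z => MvPolynomial.eval (fun k => z k) q) (16 ^ (2 * n) * 114 ^ d) d := by
  intro z hz w hw f hf
  rw [mem_unitBall] at hz hw
  have hD := one_sub_norm_sq_pos hw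
  have ht := norm_one_sub_inner_pos hz hw
  have htD := one_sub_norm_sq_le hz.le hw.le
  obtain ⟨e, he, hwe⟩ := exists_unit_smul w
  obtain ⟨u, hu, hue⟩ := exists_discMap_eq hz hw he hwe
  set D := 1 - ‖w‖ ^ 2 with hDdef
  set t := ‖1 - inner ℂ w z‖ with htdef
  set η : ℂ := ((D / (112 * t) : ℝ) : ℂ) with hη
  have hη0 : η ≠ 0 := by rw [hη]; exact_mod_cast (by positivity : D / (112 * t) ≠ 0)
  have hηn : ‖η⁻¹‖ = 112 * t / D := by
    rw [norm_inv, hη, Complex.norm_real, Real.norm_of_nonneg (by positivity), inv_div]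
  obtain ⟨p, hp, hpe⟩ := exists_polynomial_eval_line q hq w (η • (z - w))
  set F : Cn n → ℂ := fun x => MvPolynomial.eval (fun k => x k) q * f x with hF
  have hFh : IsHolo F := (isHolo_mvPolynomial q).mul hf
  set I := ∫ x in bergmanDisc w 1, ‖MvPolynomial.eval (fun k => x k) q * f x‖ ∂(ballVol n) with hI
  have hI0 : 0 ≤ I := integral_nonneg fun _ => norm_nonneg _
  have hline : ∀ ζ : ℂ, w + ζ • η • (z - w) = w + discMap w e (ζ • u) := by
    intro ζ; rw [map_smul, hue]
  have hmem : ∀ ζ : ℂ, ‖ζ‖ ≤ 1 → ‖ζ • u‖ ≤ 1 := fun ζ hζ => by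
    rw [norm_smul]; exact mul_le_one₀ hζ (norm_nonneg _) hu
  have hφ : DifferentiableOn ℂ (fun ζ : ℂ => f (w + ζ • η • (z - w))) (Metric.closedBall 0 1) := by
    refine DifferentiableOn.comp hf (by fun_prop) fun ζ hζ => ?_
    rw [hline]
    exact bergmanDisc_subset_unitBall (add_discMap_mem hw he hwe
      ((hmem ζ (mem_closedBall_zero_iff.1 hζ)).trans one_le_two))
  -- On the line `ζ ↦ w + ζ η (z - w)` the point `ζ = 0` is `w` and `ζ = η⁻¹` is `z`. The polynomial
  -- is evaluated at `z` and `f` at `w`, while the product is needed only for `|ζ| = 1`, inside the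
  -- ellipsoid.
  have h1 := norm_eval_mul_le hp η⁻¹ hφ (M := 16 ^ (2 * n) / D ^ (n + 1) * I) fun ζ hζ => by
    have h2 := enorm_le_lintegral_bergmanDisc hFh hw he hwe (hmem ζ hζ.le)
    have h3 : ∫⁻ x in bergmanDisc w 1, ‖F x‖ₑ ∂(ballVol n) = ENNReal.ofReal I :=
      (ofReal_integral_norm_eq_lintegral_enorm (integrableOn_bergmanDisc hFh hw)).symm
    rw [h3, ← hline, ← ENNReal.ofReal_mul (by positivity), ← ofReal_norm,
      ENNReal.ofReal_le_ofReal_iff (by positivity)] at h2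
    rw [hpe]
    exact h2
  rw [hpe, smul_smul, inv_mul_cancel₀ hη0, one_smul, add_sub_cancel, zero_smul, add_zero, hηn] at h1
  refine h1.trans ?_
  -- The `1` is absorbed through `D ≤ 2t`.
  have h4 : 1 + 112 * t / D ≤ 114 * t / D := by
    rw [le_div_iff₀ hD, add_mul, div_mul_cancel₀ _ hD.ne']; linarith
  calc (1 + 112 * t / D) ^ d * (16 ^ (2 * n) / D ^ (n + 1) * I) ≤
        (114 * t / D) ^ d * (16 ^ (2 * n) / D ^ (n + 1) * I) := by gcongr
    _ = 16 ^ (2 * n) * 114 ^ d * (t ^ d / D ^ (n + 1 + d)) * I := by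
        rw [div_pow, mul_pow, pow_add]; field_simp; ring

end BergmanBall

end

/-! ### The theorem -/

theorem theorem3p2 (n : ℕ) (P : BergmanBall.BergmanSubmodule n) :
    (∀ (Λ : Type*) [Countable Λ] (h : Λ → BergmanBall.Cn n → ℂ),
      P.AsympStableDivision h →
      (∀ i, BergmanBall.HoloNearClosedBall (h i)) →
      (∃ (C : Λ → ℝ) (N : Λ → ℕ),
        (∀ i, 0 < C i ∧ 0 < N i ∧ BergmanBall.KeyInequality (h i) (C i) (N i)) ∧
        BddAbove (Set.range C) ∧ BddAbove (Set.range N)) →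
      ∀ p : ℝ, (n : ℝ) < p → P.EssentiallyNormal p) ∧
    (∀ (Λ : Type*) [Countable Λ] (q : Λ → MvPolynomial (Fin n) ℂ) (d : ℕ),
      (∀ i, (q i).totalDegree ≤ d) →
      P.AsympStableDivision (fun i z => MvPolynomial.eval (fun k => z k) (q i)) →
      ∀ p : ℝ, (n : ℝ) < p → P.EssentiallyNormal p) := by
  -- For `n = 0` there are no coordinates and no commutators.
  rcases Nat.eq_zero_or_pos n with rfl | hn
  · exact ⟨fun _ _ _ _ _ _ _ _ i => i.elim0, fun _ _ _ _ _ _ _ _ i => i.elim0⟩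
  have : NeZero n := ⟨hn.ne'⟩
  refine ⟨fun Λ _ h hd _ ⟨C, N, hK, ⟨B, hB⟩, ⟨M, hM⟩⟩ p hp => ?_, fun Λ _ q d hq hd p hp => ?_⟩
  · refine P.essentiallyNormal_of_keyInequality hd (C := max B 0 * 2 ^ M) (N := M) (by positivity) (fun i => ?_) hp
    exact (hK i).2.2.mono (hK i).1.le ((hB (Set.mem_range_self i)).trans (le_max_left _ _))
      (hM (Set.mem_range_self i))
  · exact P.essentiallyNormal_of_keyInequality hd (by positivity)
      (fun i => BergmanBall.keyInequality_mvPolynomial (q i) (hq i)) hp
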